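/- **Setting.** Let $U\subset\mathbb C^2$ be a polydisc centred at $O$, let $V\subset\mathbb C^2$ be a polydisc centred at $c_0$, and let $\mathcal S=\{L_c\}_{c\in V}$ be a transverse holomorphic $2$-parameter family of planar complex curves ($\mathcal S$-lines). That is: (i) $L_c=\{p\in U: F(p,c)=0\}$ with $F$ holomorphic in $U\times V$ and $d_pF(p,c)\neq 0$ whenever $F(p,c)=0$ (so each $L_c$ is a nonsingular curve in $U$ depending holomorphically on $c$); (ii) $O\in L_{c_0}$, and $c\mapsto L_c$ is one-to-one (for nonempty curves); (iii) for every $p\in U$ and every slope $l$ sufficiently close to the slope $l_0$ of $L_{c_0}$ at $O$ there is one and only one $c\in V$ such that $L_c$ passes through $p$ with slope $l$; moreover the lifts of the curves to the bundle of $1$-jets form a holomorphic foliation near $(O,l_0)$, i.e. for $(p,l)$ in a neighbourhood of $(O,l_0)$ this $c$ exists, is unique in $V$, and depends holomorphically on $(p,l)$. Assume that $U,V$ are small enough that through two distinct points $A,B\in U$ there passes at most one $\mathcal S$-line, denoted by $AB$ if it exists. Call seven distinct points $O,A,B,C,A',B',C'$ in $U$ ($O$ being the centre of $U$) an admissible configuration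 if there are three distinct $\mathcal S$-lines through $O$ containing respectively $A,A'$; $B,B'$; $C,C'$; if the intersections $P=AB\cap A'B'$, $Q=AC\cap A'C'$, $R=BC\cap B'C'$ exist in $U$; and if the $\mathcal S$-lines $PQ$, $PR$, $QR$ exist (for coinciding points: if some $\mathcal S$-line passes through them). It has the Desargues property if $P,Q,R$ lie on a common $\mathcal S$-line. A local automorphism of $\mathcal S$ near an $\mathcal S$-line $L_0=L_{c_1}\ni O$ is a biholomorphism $\varphi:W\to W'$ between open neighbourhoods $W,W'\subset U$ of $O$ with $\varphi(O)=O$ such that for every $c$ sufficiently close to $c_1$ there is $c'\in V$ with $\varphi(L_c\cap W)=L_{c'}\cap W'$. **Proposition.** Suppose that every admissible configuration has the Desargues property. Let $L_0=L_{c_1}\ni O$ be a distinguished $\mathcal S$-line with $c_1=c_0$ or, more generally, with $c_1$ in a sufficiently small neighbourhood of $c_0$ (depending only on $\mathcal S$). Then there are a nonempty domain $\Omega\subset\mathbb C$ and a $1$-parameter family $\{\varphi_r\}_{r\in\Omega}$ of local automorphisms $\varphi_r:V_r\to V_r'$ of $\mathcal S$ near $L_0$ such that for each $r\in\Omega$: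 $\varphi_r(O)=O$; $\varphi_r$ is not the identity near $O$; $d\varphi_r(O)=\mathrm{Id}$; $\varphi_r(p)=p$ for all $p\in L_0\cap V_r$; and, as for the projective maps $(z,w)\mapsto(z,w)/(1-rw)$, $\varphi_r(L_c\cap V_r)=L_c\cap V_r'$ for all $c$ sufficiently close to $c_1$ with $O\in L_c$. Moreover the germs of $\varphi_r$ at $O$ are pairwise distinct, the set $\{(r,p): r\in\Omega,\ p\in V_r\}$ is open, and $(r,p)\mapsto\varphi_r(p)$ is holomorphic on it. -/

import Mathlib

open scoped Topology

/-- The open polydisc in `ℂ²` with centre `x` and polyradius `ρ`. -/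
def polydisc (x : ℂ × ℂ) (ρ : ℝ × ℝ) : Set (ℂ × ℂ) :=
  Metric.ball x.1 ρ.1 ×ˢ Metric.ball x.2 ρ.2

/-- `v` is tangent at `p` to the curve `{F (·, c) = 0}`, and `p` lies on this curve. -/
def IsTangentAt (F : (ℂ × ℂ) × (ℂ × ℂ) → ℂ) (p c v : ℂ × ℂ) : Prop :=
  F (p, c) = 0 ∧ fderiv ℂ (fun q : ℂ × ℂ => F (q, c)) p v = 0

/-- A transverse holomorphic `2`-parameter family of planar complex curves
`L c = {p ∈ U | F (p, c) = 0}`, `c ∈ V`, in a polydisc `U` centred at `O`, with parameter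
polydisc `V` centred at `c₀`.  Slopes (points of the projective line) close to the slope of
`L c₀` at `O` are represented by direction vectors close to a tangent vector `v₀ ≠ 0`. -/
structure TransverseFamily where
  /-- the centre of `U` -/
  O : ℂ × ℂ
  /-- the polyradius of `U` -/
  radU : ℝ × ℝ
  radU_pos : 0 < radU.1 ∧ 0 < radU.2
  /-- the centre of `V` -/
  c₀ : ℂ × ℂ
  /-- the polyradius of `V` -/
  radV : ℝ × ℝ
  radV_pos : 0 < radV.1 ∧ 0 < radV.2
  /-- the defining function of the family -/
  F : (ℂ × ℂ) × (ℂ × ℂ) → ℂ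
  holomorphic : AnalyticOnNhd ℂ F (polydisc O radU ×ˢ polydisc c₀ radV)
  /-- all curves are nonsingular -/
  nonsingular : ∀ p ∈ polydisc O radU, ∀ c ∈ polydisc c₀ radV, F (p, c) = 0 →
    fderiv ℂ (fun q : ℂ × ℂ => F (q, c)) p ≠ 0
  /-- `c ↦ L c` is one-to-one (parameters whose curve misses `U` are disregarded) -/
  one_to_one : ∀ c ∈ polydisc c₀ radV, ∀ d ∈ polydisc c₀ radV,
    {p ∈ polydisc O radU | F (p, c) = 0}.Nonempty →
    {p ∈ polydisc O radU | F (p, c) = 0} = {p ∈ polydisc O radU | F (p, d) = 0} → c = d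
  /-- a direction of the curve `L c₀` at `O` -/
  v₀ : ℂ × ℂ
  v₀_ne_zero : v₀ ≠ 0
  /-- `L c₀` passes through `O`, with tangent direction `v₀` -/
  tangent_v₀ : IsTangentAt F O c₀ v₀
  /-- through every `p ∈ U`, in every direction close to `v₀`, there passes one and only one
  curve of the family -/
  transverse : ∀ p ∈ polydisc O radU, ∀ᶠ v in 𝓝 v₀,
    ∃! c, c ∈ polydisc c₀ radV ∧ IsTangentAt F p c v
  /-- the lifts of the curves to the bundle of `1`-jets form a holomorphic foliation near the
  jet `(O, v₀)`: the parameter of the curve through `p` in direction `v` is holomorphic -/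
  foliation : ∃ γ : (ℂ × ℂ) × (ℂ × ℂ) → ℂ × ℂ, AnalyticAt ℂ γ (O, v₀) ∧
    ∀ᶠ q in 𝓝 (O, v₀), ∀ c, (c ∈ polydisc c₀ radV ∧ IsTangentAt F q.1 c q.2) ↔ c = γ q

namespace TransverseFamily

/-- The polydisc in which the curves are defined. -/
def U (S : TransverseFamily) : Set (ℂ × ℂ) := polydisc S.O S.radU

/-- The polydisc of parameters. -/
def V (S : TransverseFamily) : Set (ℂ × ℂ) := polydisc S.c₀ S.radV

/-- The curve (`S`-line) with parameter `c`. -/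
def L (S : TransverseFamily) (c : ℂ × ℂ) : Set (ℂ × ℂ) := {p ∈ S.U | S.F (p, c) = 0}

/-- All points of `T` lie on a common `S`-line. -/
def Collinear (S : TransverseFamily) (T : Set (ℂ × ℂ)) : Prop := ∃ c ∈ S.V, T ⊆ S.L c

/-- Through two distinct points there passes at most one `S`-line. -/
def TwoPointUnique (S : TransverseFamily) : Prop :=
  ∀ A B : ℂ × ℂ, A ≠ B → ∀ c ∈ S.V, ∀ d ∈ S.V,
    A ∈ S.L c → B ∈ S.L c → A ∈ S.L d → B ∈ S.L d → c = d

/-- The seven points `O, A, B, C, A', B', C'` are distinct, lie two by two on three distinct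
`S`-lines through `O`, the intersections `P = AB ∩ A'B'`, `Q = AC ∩ A'C'`, `R = BC ∩ B'C'`
exist, and so do the `S`-lines `PQ`, `PR`, `QR`.  (`S.Collinear {A, B, P}`, for `A ≠ B`, says
that the `S`-line `AB` exists and contains `P`.) -/
structure IsAdmissible (S : TransverseFamily) (A B C A' B' C' P Q R : ℂ × ℂ) : Prop where
  distinct : [S.O, A, B, C, A', B', C'].Nodup
  lineA : S.Collinear {S.O, A, A'}
  lineB : S.Collinear {S.O, B, B'}
  lineC : S.Collinear {S.O, C, C'}
  lineA_ne_lineB : ¬ S.Collinear {S.O, A, B}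
  lineA_ne_lineC : ¬ S.Collinear {S.O, A, C}
  lineB_ne_lineC : ¬ S.Collinear {S.O, B, C}
  P_mem : S.Collinear {A, B, P} ∧ S.Collinear {A', B', P}
  Q_mem : S.Collinear {A, C, Q} ∧ S.Collinear {A', C', Q}
  R_mem : S.Collinear {B, C, R} ∧ S.Collinear {B', C', R}
  linePQ : S.Collinear {P, Q}
  linePR : S.Collinear {P, R}
  lineQR : S.Collinear {Q, R}

/-- All admissible configurations have the Desargues property. -/
def HasDesargues (S : TransverseFamily) : Prop :=
  ∀ A B C A' B' C' P Q R : ℂ × ℂ,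
    S.IsAdmissible A B C A' B' C' P Q R → S.Collinear {P, Q, R}

/-- `φ`, a biholomorphism between open neighbourhoods `φ.source` and `φ.target` of `O` with
`φ O = O`, is a local automorphism of `S` near the `S`-line `L c₁` through `O`: it maps the
portion in `φ.source` of every `S`-line close to `L c₁` onto the portion in `φ.target` of
an `S`-line. -/
structure IsLocalAutomorphism (S : TransverseFamily) (c₁ : ℂ × ℂ)
    (φ : OpenPartialHomeomorph (ℂ × ℂ) (ℂ × ℂ)) : Prop where
  O_mem : S.O ∈ φ.source
  map_O : φ S.O = S.O
  source_subset : φ.source ⊆ S.U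
  target_subset : φ.target ⊆ S.U
  holomorphic : AnalyticOnNhd ℂ φ φ.source
  holomorphic_symm : AnalyticOnNhd ℂ φ.symm φ.target
  maps_lines : ∀ᶠ c in 𝓝 c₁, ∃ c' ∈ S.V, φ '' (S.L c ∩ φ.source) = S.L c' ∩ φ.target

end TransverseFamily

/-! The maps sought are elations with centre O and axis `L c₁`. For straight lines, an elation is
determined by one pair A, A' on a line through O: if P is the point where Ap meets the axis, the
image of p lies on A'P and on Op. Desargues' theorem makes the result independent of choices and
compatible with lines. The proof carries out this construction with S-lines. The difficulty is that
S-lines are only available near one tangent direction, and that all points and lines used must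
exist, be in general position and stay in `U`.

A rescaling settles this. Near its jet at O, the curve `L c₁` and its neighbours are graphs w = f(z,
b, m), where b and m are the value and slope at z = 0. Once `L c₁` is straightened to the axis w =
0, f equals b + z m up to cubic terms (`cubic_remainder`). Giving z, m weight 1 and w, b weight 2 in
a parameter ε turns the curves into w = b + z m + O(ε), analytic up to ε = 0, where they are
ordinary non-vertical lines (`nonempty_lineModel`). Joins and meets that are transversal for
ordinary lines therefore persist analytically for small ε. Strict nondegeneracy conditions need only
be checked at ε = 0, and for ε ≠ 0 the perturbed figure is a figure of S-lines to which the
Desargues hypothesis applies (`germ_desargues`).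

The line Op makes no sense at p = O, so the image is defined with two pairs: A, A' on the line of
slope 1, and an auxiliary pair D, D' on the line of slope -1. With Q the projection of p from D to
the axis, φ(p) = A'P ∩ D'Q. This is analytic near p = O, and for ε = 0, r = 2 it is the map (z, w) ↦
(z, w)/(1 - w/2). The abscissa r of A' is the parameter of the family.

Desargues for the triangles ADB and A'D'B' shows that φ preserves curves through O
(`preserves_generic`); for ABC and A'B'C' it shows that φ maps curves to curves (`germ_axis`,
`preserves_line_generic`). Both arguments need general position and work near base points depending
on the figure. The incidences are analytic equations, so an identity theorem with parameters
(`AnalyticAt.eventually_eq_zero_of_frequently`) extends them to a neighbourhood of O that is uniform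
in ε. Finally one small ε ≠ 0 is fixed and everything is transported back to `U`
(`exists_automorphisms`). -/

set_option maxSynthPendingDepth 3
attribute [local fun_prop] analyticAt_fst analyticAt_snd

/-! ### Analytic tools: implicit functions and Taylor expansions. -/

open Filter in
/-- The analytic implicit function theorem, in the form of a local characterization. -/
theorem AnalyticAt.exists_implicit {E F : Type*} [NormedAddCommGroup E] [NormedSpace ℂ E]
    [CompleteSpace E] [NormedAddCommGroup F] [NormedSpace ℂ F] [FiniteDimensional ℂ F]
    {G : E × F → F} {x₀ : E} {y₀ : F} (hG : AnalyticAt ℂ G (x₀, y₀)) (h₀ : G (x₀, y₀) = 0)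
    {A : F →L[ℂ] F} (hA : HasFDerivAt (fun y => G (x₀, y)) A y₀) (hinj : Function.Injective A) :
    ∃ g : E → F, AnalyticAt ℂ g x₀ ∧ g x₀ = y₀ ∧
      ∀ᶠ p in 𝓝 (x₀, y₀), G p = 0 ↔ p.2 = g p.1 := by
  have : CompleteSpace F := FiniteDimensional.complete ℂ F
  have hc : ContDiffAt ℂ ⊤ G (x₀, y₀) := hG.contDiffAt
  have hA' : fderiv ℂ G (x₀, y₀) ∘L .inr ℂ E F = A := by
    have h1 : HasFDerivAt G (fderiv ℂ G (x₀, y₀)) (x₀, y₀) := hG.differentiableAt.hasFDerivAt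
    have h2 : HasFDerivAt (fun y : F => (x₀, y)) (.inr ℂ E F) y₀ := by
      exact hasFDerivAt_prodMk_right x₀ y₀
    exact (HasFDerivAt.comp y₀ h1 h2).unique hA
  have hinv : (fderiv ℂ G (x₀, y₀) ∘L .inr ℂ E F).IsInvertible := by
    rw [hA']
    refine ⟨(LinearEquiv.ofInjectiveEndo A.toLinearMap hinj).toContinuousLinearEquiv, ?_⟩
    ext; simp
  refine ⟨hc.implicitFunction (by simp) hinv, ?_, ?_, ?_⟩
  · exact (hc.contDiffAt_implicitFunction (by simp) hinv).analyticAt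
  · exact hc.implicitFunction_apply_self (by simp) hinv
  · filter_upwards [hc.eventually_apply_eq_iff_implicitFunction (by simp) hinv] with p hp
    rw [← h₀, hp, eq_comm]

/-- The analytic implicit function theorem for one scalar unknown. -/
theorem AnalyticAt.exists_implicit_scalar {E : Type*} [NormedAddCommGroup E] [NormedSpace ℂ E]
    [CompleteSpace E] {G : E × ℂ → ℂ} {x₀ : E} {y₀ : ℂ} (hG : AnalyticAt ℂ G (x₀, y₀))
    (h₀ : G (x₀, y₀) = 0) {a : ℂ} (hA : HasDerivAt (fun y => G (x₀, y)) a y₀) (ha : a ≠ 0) :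
    ∃ g : E → ℂ, AnalyticAt ℂ g x₀ ∧ g x₀ = y₀ ∧
      ∀ᶠ p in 𝓝 (x₀, y₀), G p = 0 ↔ p.2 = g p.1 := by
  refine hG.exists_implicit h₀ hA.hasFDerivAt fun x y hxy => ?_
  simpa [ha] using hxy

/-- Hadamard's lemma: `f x = f 0 + g x x` with an analytic, operator valued `g`. -/
theorem AnalyticAt.exists_hadamard {E F : Type*} [NormedAddCommGroup E] [NormedSpace ℂ E]
    [NormedAddCommGroup F] [NormedSpace ℂ F] [CompleteSpace F] {f : E → F}
    (hf : AnalyticAt ℂ f 0) :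
    ∃ g : E → E →L[ℂ] F, AnalyticAt ℂ g 0 ∧ ∀ᶠ x in 𝓝 0, f x = f 0 + g x x := by
  obtain ⟨p, r, hp⟩ := hf
  have hr : 0 < p.shift.radius := by
    rw [FormalMultilinearSeries.radius_shift]
    exact hp.r_pos.trans_le hp.r_le
  have hg := p.shift.hasFPowerSeriesOnBall hr
  refine ⟨p.shift.sum, hg.analyticAt, ?_⟩
  have h1 := (hg.unshift (z := f 0)).hasFPowerSeriesAt.eventually_hasSum
  have h2 := hp.hasFPowerSeriesAt.eventually_hasSum
  filter_upwards [h1, h2] with x hx1 hx2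
  have : p.shift.unshift (f 0) = p := by
    ext n v
    cases n with
    | zero =>
      have := hp.coeff_zero v
      simp [FormalMultilinearSeries.unshift, this]
    | succ n =>
      simp only [FormalMultilinearSeries.unshift, FormalMultilinearSeries.shift]
      exact congrArg (fun q => q v)
        ((continuousMultilinearCurryRightEquiv' ℂ n E F).symm_apply_apply (p (n + 1)))
  rw [this] at hx1
  simpa using hx2.unique hx1

/-- A third order Taylor expansion with analytic remainder. -/
theorem AnalyticAt.exists_taylor_three {E F : Type*} [NormedAddCommGroup E] [NormedSpace ℂ E]
    [NormedAddCommGroup F] [NormedSpace ℂ F] [CompleteSpace F] {f : E → F}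
    (hf : AnalyticAt ℂ f 0) :
    ∃ (l : E →L[ℂ] F) (B : E →L[ℂ] E →L[ℂ] F) (C : E → E →L[ℂ] E →L[ℂ] E →L[ℂ] F),
      AnalyticAt ℂ C 0 ∧ ∀ᶠ x in 𝓝 0, f x = f 0 + l x + B x x + C x x x x := by
  obtain ⟨g₁, hg₁, h₁⟩ := hf.exists_hadamard
  obtain ⟨g₂, hg₂, h₂⟩ := hg₁.exists_hadamard
  obtain ⟨g₃, hg₃, h₃⟩ := hg₂.exists_hadamard
  refine ⟨g₁ 0, g₂ 0, g₃, hg₃, ?_⟩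
  filter_upwards [h₁, h₂, h₃] with x hx₁ hx₂ hx₃
  rw [hx₁, hx₂, hx₃]
  simp [add_assoc]

/-- Uniqueness of the first two coefficients of an expansion. -/
theorem expansion_unique {α β : ℂ} {h : ℂ → ℂ} (hh : ContinuousAt h 0)
    (H : ∀ᶠ s in 𝓝[≠] (0 : ℂ), α + s * β + s ^ 2 * h s = 0) : α = 0 ∧ β = 0 := by
  have hid : Filter.Tendsto (fun s : ℂ => s) (𝓝[≠] 0) (𝓝 0) := nhdsWithin_le_nhds
  have hh' : Filter.Tendsto h (𝓝[≠] 0) (𝓝 (h 0)) := hh.tendsto.mono_left nhdsWithin_le_nhds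
  have hα : α = 0 := by
    have h1 : Filter.Tendsto (fun s => α + s * β + s ^ 2 * h s) (𝓝[≠] 0)
        (𝓝 (α + 0 * β + 0 ^ 2 * h 0)) :=
      (tendsto_const_nhds.add (hid.mul_const β)).add ((hid.pow 2).mul hh')
    have h2 := tendsto_nhds_unique (h1.congr' H) tendsto_const_nhds
    simpa using h2
  refine ⟨hα, ?_⟩
  have h1 : Filter.Tendsto (fun s => β + s * h s) (𝓝[≠] 0) (𝓝 (β + 0 * h 0)) :=
    tendsto_const_nhds.add (hid.mul hh')
  have h2 : (fun s => β + s * h s) =ᶠ[𝓝[≠] 0] fun _ => 0 := by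
    filter_upwards [H, self_mem_nhdsWithin] with s hs hs0
    have hs0' : s ≠ 0 := hs0
    have : s * (β + s * h s) = 0 := by rw [← hs, hα]; ring
    exact (mul_eq_zero.mp this).resolve_left hs0'
  simpa using tendsto_nhds_unique (h1.congr' h2) tendsto_const_nhds

theorem ContinuousAt.tendsto_of_eq {X Y : Type*} [TopologicalSpace X] [TopologicalSpace Y]
    {f : X → Y} {a : X} {b : Y} (hf : ContinuousAt f a) (hb : f a = b) :
    Filter.Tendsto f (𝓝 a) (𝓝 b) := hb ▸ hf

theorem AnalyticAt.clm_apply' {E F G : Type*} [NormedAddCommGroup E] [NormedSpace ℂ E]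
    [NormedAddCommGroup F] [NormedSpace ℂ F] [NormedAddCommGroup G] [NormedSpace ℂ G]
    [CompleteSpace F] [CompleteSpace G] {T : E → F →L[ℂ] G} {y : E → F} {a : E} (hT : AnalyticAt ℂ T a)
    (hy : AnalyticAt ℂ y a) : AnalyticAt ℂ (fun x => T x (y x)) a :=
  (hT.contDiffAt (n := ⊤).clm_apply hy.contDiffAt).analyticAt

/-- For a function `f (z, b, m)` with `f (0, b, m) = b`, `∂f/∂z (0, b, m) = m` and `f (z, 0, 0) = 0`,
the Taylor expansion at `0` is `b + z m` up to cubic terms. -/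
theorem cubic_remainder {f : ℂ × ℂ × ℂ → ℂ} (hf : AnalyticAt ℂ f 0)
    (h0 : ∀ᶠ l in 𝓝 (0 : ℂ × ℂ), f (0, l) = l.1)
    (h1 : ∀ᶠ l in 𝓝 (0 : ℂ × ℂ), HasDerivAt (fun z => f (z, l)) l.2 0)
    (h2 : ∀ᶠ z in 𝓝 (0 : ℂ), f (z, 0) = 0) :
    ∃ C : ℂ × ℂ × ℂ → (ℂ × ℂ × ℂ) →L[ℂ] (ℂ × ℂ × ℂ) →L[ℂ] (ℂ × ℂ × ℂ) →L[ℂ] ℂ,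
      AnalyticAt ℂ C 0 ∧ ∀ᶠ x in 𝓝 0, f x = x.2.1 + x.1 * x.2.2 + C x x x x := by
  obtain ⟨l, B, C, hC, hexp⟩ := hf.exists_taylor_three
  have hf0 : f 0 = 0 := h2.self_of_nhds
  have hline : ∀ e : ℂ × ℂ × ℂ, Filter.Tendsto (fun s : ℂ => s • e) (𝓝 0) (𝓝 0) := fun e => by
    have : ContinuousAt (fun s : ℂ => s • e) 0 := by fun_prop
    simpa [ContinuousAt] using this
  have hCline : ∀ e : ℂ × ℂ × ℂ, ContinuousAt (fun s : ℂ => C (s • e)) 0 := fun e => by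
    refine ContinuousAt.comp (g := C) ?_ (by fun_prop)
    simpa using hC.continuousAt
  have clm3 : ∀ {T : ℂ → (ℂ × ℂ × ℂ) →L[ℂ] (ℂ × ℂ × ℂ) →L[ℂ] (ℂ × ℂ × ℂ) →L[ℂ] ℂ},
      ContinuousAt T 0 → ∀ a b c, ContinuousAt (fun s => T s a b c) 0 := fun hT a b c =>
    ((hT.clm_apply continuousAt_const).clm_apply continuousAt_const).clm_apply continuousAt_const
  have hC3 := fun e => clm3 (hCline e)
  -- On a ray, the expansion is a power series in one variable, so its first two coefficients read
  -- off `l e` and `B e e`.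
  have ray : ∀ (e : ℂ × ℂ × ℂ) (a : ℂ), (∀ᶠ s in 𝓝 (0 : ℂ), f (s • e) = s * a) →
      l e = a ∧ B e e = 0 := by
    intro e a hea
    have := expansion_unique (α := l e - a) (β := B e e) (h := fun s => C (s • e) e e e)
      (hC3 e e e e) (by
        filter_upwards [nhdsWithin_le_nhds hea, nhdsWithin_le_nhds ((hline e).eventually hexp),
          self_mem_nhdsWithin] with s hs1 hs2 hs0
        have hs0' : s ≠ 0 := hs0
        apply mul_left_cancel₀ hs0'
        rw [hs1, hf0] at hs2
        simp only [map_smul, smul_eq_mul, smul_apply] at hs2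
        linear_combination -hs2)
    exact ⟨sub_eq_zero.mp this.1, this.2⟩
  have hy : ∀ y : ℂ × ℂ, l (0, y) = y.1 ∧ B (0, y) (0, y) = 0 := fun y => by
    refine ray (0, y) y.1 ?_
    have : Filter.Tendsto (fun s : ℂ => s • y) (𝓝 0) (𝓝 0) := by
      have : ContinuousAt (fun s : ℂ => s • y) 0 := by fun_prop
      simpa [ContinuousAt] using this
    filter_upwards [this.eventually h0] with s hs
    simpa using hs
  have he : l (1, 0) = 0 ∧ B (1, 0) (1, 0) = 0 := by
    refine ray (1, 0) 0 ?_
    filter_upwards [h2] with s hs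
    simpa using hs
  -- The mixed quadratic part is obtained by differentiating the expansion in z at (0, s y): the
  -- derivative is s y.2 by hypothesis, and the coefficient of s on the other side is B e w + B w e.
  have hmix : ∀ y : ℂ × ℂ, B (1, 0) (0, y) + B (0, y) (1, 0) = y.2 := fun y => by
    set e : ℂ × ℂ × ℂ := (1, 0) with he'
    set w : ℂ × ℂ × ℂ := (0, y) with hw
    have hC' : ContinuousAt (fun s : ℂ => fderiv ℂ C (s • w)) 0 := by
      refine ContinuousAt.comp (g := fderiv ℂ C) ?_ (by fun_prop)
      simpa using hC.fderiv.continuousAt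
    have hC'e : ContinuousAt (fun s : ℂ => fderiv ℂ C (s • w) e) 0 :=
      hC'.clm_apply continuousAt_const
    have := expansion_unique (α := l e) (β := B e w + B w e - y.2)
      (h := fun s => s * (fderiv ℂ C (s • w) e w w w) + C (s • w) e w w + C (s • w) w e w
        + C (s • w) w w e) (((continuousAt_id.mul (clm3 hC'e w w w)).add
        (hC3 w e w w)).add (hC3 w w e w) |>.add (hC3 w w w e)) (by
        have hy0 : Filter.Tendsto (fun s : ℂ => s • y) (𝓝 0) (𝓝 0) := by
          have : ContinuousAt (fun s : ℂ => s • y) 0 := by fun_prop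
          simpa [ContinuousAt] using this
        filter_upwards [nhdsWithin_le_nhds (hy0.eventually h1),
          nhdsWithin_le_nhds ((hline w).eventually hexp.eventually_nhds),
          nhdsWithin_le_nhds ((hline w).eventually hC.eventually_analyticAt)] with s hs1 hs2 hs3
        have hx : HasDerivAt (fun z : ℂ => (z, s • y)) e 0 :=
          (hasDerivAt_id (0 : ℂ)).prodMk (hasDerivAt_const _ _)
        have hx0 : ((0 : ℂ), s • y) = s • w := by simp [hw]
        have hC1 : HasDerivAt (fun z : ℂ => C (z, s • y)) (fderiv ℂ C (s • w) e) 0 := by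
          refine HasFDerivAt.comp_hasDerivAt (l := C) (0 : ℂ) ?_ hx
          rw [hx0]; exact hs3.differentiableAt.hasFDerivAt
        have hL : HasDerivAt (fun z : ℂ => l (z, s • y)) (l e) 0 :=
          l.hasFDerivAt.comp_hasDerivAt (0 : ℂ) hx
        have hB : HasDerivAt (fun z : ℂ => B (z, s • y)) (B e) 0 :=
          B.hasFDerivAt.comp_hasDerivAt (0 : ℂ) hx
        have hT := ((hL.const_add (f 0)).add (hB.clm_apply hx)).add
          (((hC1.clm_apply hx).clm_apply hx).clm_apply hx)
        have hcont : Filter.Tendsto (fun z : ℂ => (z, s • y)) (𝓝 0) (𝓝 (s • w)) := by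
          have := hx.continuousAt.tendsto
          rwa [hx0] at this
        have hT' := hs1.congr_of_eventuallyEq
          (f₁ := fun z => f 0 + l (z, s • y) + B (z, s • y) (z, s • y)
            + C (z, s • y) (z, s • y) (z, s • y) (z, s • y)) (by
          filter_upwards [hcont.eventually hs2] with z hz
          exact hz.symm)
        have := hT.unique hT'
        simp only [hx0, add_apply] at this
        simp only [map_smul, smul_eq_mul, smul_apply, Prod.smul_snd] at this
        linear_combination this)
    linear_combination this.2
  refine ⟨C, hC, ?_⟩
  filter_upwards [hexp] with x hx
  obtain ⟨z, y⟩ := x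
  have hdec : ((z, y) : ℂ × ℂ × ℂ) = z • (1, 0) + (0, y) := by simp
  have hlx : l (z, y) = y.1 := by
    rw [hdec, map_add, map_smul, he.1, (hy y).1]; simp
  have hBx : B (z, y) (z, y) = z * y.2 := by
    rw [hdec, map_add, map_smul]
    simp only [add_apply, smul_apply, map_add, map_smul,
      smul_eq_mul, he.2, (hy y).2]
    linear_combination z * hmix y
  rw [hx, hf0, hlx, hBx]; ring

/-! ### Jet coordinates: the curves near `L c₁` as graphs. -/

namespace TransverseFamily

/-- A tangent vector `v` at `O` of the curve `L c₁`, close to which the `1`-jet foliation is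
described by `γ`, together with a transverse vector `u`. -/
structure Frame (S : TransverseFamily) (c₁ : ℂ × ℂ) where
  v : ℂ × ℂ
  u : ℂ × ℂ
  γ : (ℂ × ℂ) × (ℂ × ℂ) → ℂ × ℂ
  mem : c₁ ∈ S.V
  O_mem : S.F (S.O, c₁) = 0
  v_ne_zero : v ≠ 0
  tangent : fderiv ℂ (fun q : ℂ × ℂ => S.F (q, c₁)) S.O v = 0
  transverse : fderiv ℂ (fun q : ℂ × ℂ => S.F (q, c₁)) S.O u ≠ 0
  analytic : AnalyticAt ℂ γ (S.O, v)
  foliation : ∀ᶠ q in 𝓝 (S.O, v), ∀ c,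
    (c ∈ polydisc S.c₀ S.radV ∧ IsTangentAt S.F q.1 c q.2) ↔ c = γ q

theorem isOpen_polydisc (x : ℂ × ℂ) (ρ : ℝ × ℝ) : IsOpen (polydisc x ρ) :=
  Metric.isOpen_ball.prod Metric.isOpen_ball

theorem O_mem_U (S : TransverseFamily) : S.O ∈ S.U :=
  ⟨Metric.mem_ball_self S.radU_pos.1, Metric.mem_ball_self S.radU_pos.2⟩

theorem c₀_mem_V (S : TransverseFamily) : S.c₀ ∈ S.V :=
  ⟨Metric.mem_ball_self S.radV_pos.1, Metric.mem_ball_self S.radV_pos.2⟩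

theorem U_mem_nhds (S : TransverseFamily) : S.U ∈ 𝓝 S.O :=
  (isOpen_polydisc _ _).mem_nhds S.O_mem_U

theorem analyticAt_F (S : TransverseFamily) {p c : ℂ × ℂ} (hp : p ∈ S.U) (hc : c ∈ S.V) :
    AnalyticAt ℂ S.F (p, c) := S.holomorphic _ ⟨hp, hc⟩

theorem fderiv_F (S : TransverseFamily) {p c : ℂ × ℂ} (h : AnalyticAt ℂ S.F (p, c)) :
    fderiv ℂ (fun q : ℂ × ℂ => S.F (q, c)) p = (fderiv ℂ S.F (p, c)).comp (.inl ℂ _ _) :=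
  (HasFDerivAt.comp (g := S.F) p h.differentiableAt.hasFDerivAt
    (hasFDerivAt_prodMk_left p c)).fderiv

/-- The tangent direction at O depends continuously on the parameter, so for c₁ near c₀ it stays in
the range where γ describes the foliation. Closeness of c₁ to c₀ enters the proof only here. -/
theorem exists_frame (S : TransverseFamily) :
    ∀ᶠ c₁ in 𝓝 S.c₀, S.O ∈ S.L c₁ → Nonempty (S.Frame c₁) := by
  obtain ⟨γ, hγ, hfol⟩ := S.foliation
  have hO := S.O_mem_U
  have hns := S.nonsingular S.O hO S.c₀ S.c₀_mem_V S.tangent_v₀.1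
  obtain ⟨u, hu⟩ : ∃ u, fderiv ℂ (fun q : ℂ × ℂ => S.F (q, S.c₀)) S.O u ≠ 0 := by
    by_contra! h
    exact hns (ContinuousLinearMap.ext h)
  have hFan := S.analyticAt_F hO S.c₀_mem_V
  let D : ℂ × ℂ → (ℂ × ℂ) →L[ℂ] ℂ := fun c => (fderiv ℂ S.F (S.O, c)).comp (.inl ℂ _ _)
  have hDc : ContinuousAt D S.c₀ := by
    have h1 : ContinuousAt (fun c => fderiv ℂ S.F (S.O, c)) S.c₀ :=
      ContinuousAt.comp (g := fderiv ℂ S.F) (f := fun c => (S.O, c)) hFan.fderiv.continuousAt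
        (by fun_prop)
    exact h1.clm_comp continuousAt_const
  have hD0 : D S.c₀ = fderiv ℂ (fun q : ℂ × ℂ => S.F (q, S.c₀)) S.O := (S.fderiv_F hFan).symm
  have hDu : ContinuousAt (fun c => D c u) S.c₀ := by fun_prop
  have hDv : ContinuousAt (fun c => D c S.v₀) S.c₀ := by fun_prop
  have hu0 : D S.c₀ u ≠ 0 := by rw [hD0]; exact hu
  have hv0 : D S.c₀ S.v₀ = 0 := by rw [hD0]; exact S.tangent_v₀.2
  -- Correcting `v₀` along the transverse vector u gives a vector tangent to `L c` that tends to
  -- `v₀` as c tends to `c₀`.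
  let w : ℂ × ℂ → ℂ × ℂ := fun c => S.v₀ - (D c S.v₀ / D c u) • u
  have hwc : ContinuousAt w S.c₀ := continuousAt_const.sub ((hDv.div hDu hu0).smul continuousAt_const)
  have hw0 : w S.c₀ = S.v₀ := by simp [w, hv0]
  have hwt : Filter.Tendsto (fun c => (S.O, w c)) (𝓝 S.c₀) (𝓝 (S.O, S.v₀)) := by
    have : ContinuousAt (fun c => (S.O, w c)) S.c₀ := by fun_prop
    simpa [ContinuousAt, hw0] using this
  have hwne : ∀ᶠ c in 𝓝 S.c₀, w c ≠ 0 := by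
    apply hwc.eventually_ne
    rw [hw0]; exact S.v₀_ne_zero
  filter_upwards [hwne, hDu.eventually_ne hu0, hwt.eventually hfol.eventually_nhds,
    hwt.eventually hγ.eventually_analyticAt, (isOpen_polydisc _ _).mem_nhds S.c₀_mem_V]
    with c hc1 hc2 hc3 hc4 hc5 hOc
  have hDc' : fderiv ℂ (fun q : ℂ × ℂ => S.F (q, c)) S.O = D c :=
    S.fderiv_F (S.analyticAt_F hO hc5)
  exact ⟨{ v := w c, u := u, γ := γ, mem := hc5, O_mem := hOc.2, v_ne_zero := hc1,
           tangent := by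
            rw [hDc']; simp only [w, map_sub, map_smul, smul_eq_mul]
            field_simp; simp
           transverse := by rw [hDc']; exact hc2
           analytic := hc4, foliation := hc3 }⟩

end TransverseFamily

namespace TransverseFamily

variable {S : TransverseFamily} {c₁ : ℂ × ℂ}

namespace Frame

/-- The parameter of the curve through `O + b u` in the direction `v + m u`, `l = (b, m)`. -/
def line (Φ : S.Frame c₁) (l : ℂ × ℂ) : ℂ × ℂ := Φ.γ (S.O + l.1 • Φ.u, Φ.v + l.2 • Φ.u)

theorem analyticAt_line (Φ : S.Frame c₁) : AnalyticAt ℂ Φ.line 0 := by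
  refine AnalyticAt.comp (g := Φ.γ) (f := fun l : ℂ × ℂ => (S.O + l.1 • Φ.u, Φ.v + l.2 • Φ.u)) ?_
    (by fun_prop)
  simpa using Φ.analytic

theorem line_spec (Φ : S.Frame c₁) : ∀ᶠ l in 𝓝 (0 : ℂ × ℂ), ∀ c,
    (c ∈ S.V ∧ IsTangentAt S.F (S.O + l.1 • Φ.u) c (Φ.v + l.2 • Φ.u)) ↔ c = Φ.line l := by
  have : ContinuousAt (fun l : ℂ × ℂ => (S.O + l.1 • Φ.u, Φ.v + l.2 • Φ.u)) 0 := by fun_prop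
  have h2 := this.tendsto
  simp only [Prod.fst_zero, zero_smul, add_zero, Prod.snd_zero] at h2
  exact h2.eventually Φ.foliation

theorem line_zero (Φ : S.Frame c₁) : Φ.line 0 = c₁ := by
  refine ((Φ.line_spec.self_of_nhds c₁).mp ⟨Φ.mem, ?_⟩).symm
  simpa [IsTangentAt] using And.intro Φ.O_mem Φ.tangent

/-- The function `F` in the coordinates `(z, l)`, `w`. -/
def eqn (Φ : S.Frame c₁) (y : (ℂ × ℂ × ℂ) × ℂ) : ℂ :=
  S.F (S.O + (y.1.1 • Φ.v + y.2 • Φ.u), Φ.line y.1.2)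

/-- The graph exists because u is transverse to `L c₁`. Its value and slope at z = 0 are b and m
because `line` selects the curve through O + b u in the direction v + m u; the slope follows by
differentiating the equation along the graph and cancelling the nonzero derivative of F along u. -/
theorem exists_graph (Φ : S.Frame c₁) : ∃ f : ℂ × ℂ × ℂ → ℂ, AnalyticAt ℂ f 0 ∧
    (∀ᶠ y : (ℂ × ℂ × ℂ) × ℂ in 𝓝 0, Φ.eqn y = 0 ↔ y.2 = f y.1) ∧
    (∀ᶠ l in 𝓝 (0 : ℂ × ℂ), f (0, l) = l.1) ∧
    (∀ᶠ l in 𝓝 (0 : ℂ × ℂ), HasDerivAt (fun z => f (z, l)) l.2 0) := by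
  have hFan : AnalyticAt ℂ S.F (S.O, c₁) := S.analyticAt_F S.O_mem_U Φ.mem
  have hline2 : AnalyticAt ℂ (fun y : (ℂ × ℂ × ℂ) × ℂ => Φ.line y.1.2) 0 :=
    AnalyticAt.comp (g := Φ.line) (f := fun y : (ℂ × ℂ × ℂ) × ℂ => y.1.2) Φ.analyticAt_line
      (by fun_prop)
  have hG : AnalyticAt ℂ Φ.eqn 0 := by
    refine AnalyticAt.comp (g := S.F) (f := fun y : (ℂ × ℂ × ℂ) × ℂ =>
      (S.O + (y.1.1 • Φ.v + y.2 • Φ.u), Φ.line y.1.2)) ?_ (by fun_prop)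
    simpa [Φ.line_zero] using hFan
  have hG0 : Φ.eqn 0 = 0 := by simpa [eqn, Φ.line_zero] using Φ.O_mem
  have hA : HasDerivAt (fun w : ℂ => Φ.eqn ((0 : ℂ × ℂ × ℂ), w))
      (fderiv ℂ (fun q : ℂ × ℂ => S.F (q, c₁)) S.O Φ.u) 0 := by
    have h1 : HasDerivAt (fun w : ℂ => S.O + ((0 : ℂ) • Φ.v + w • Φ.u)) Φ.u 0 := by
      have := ((hasDerivAt_id (0 : ℂ)).smul_const Φ.u).const_add (S.O + (0 : ℂ) • Φ.v)
      simpa [add_assoc] using this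
    have h2 : HasFDerivAt (fun q : ℂ × ℂ => S.F (q, c₁))
        (fderiv ℂ (fun q : ℂ × ℂ => S.F (q, c₁)) S.O) (S.O + ((0 : ℂ) • Φ.v + (0 : ℂ) • Φ.u)) := by
      simp only [zero_smul, add_zero]
      have : AnalyticAt ℂ (fun q : ℂ × ℂ => S.F (q, c₁)) S.O :=
        AnalyticAt.comp (g := S.F) (f := fun q : ℂ × ℂ => (q, c₁)) hFan (by fun_prop)
      exact this.differentiableAt.hasFDerivAt
    have h3 := h2.comp_hasDerivAt (0 : ℂ) h1
    refine h3.congr_of_eventuallyEq (Filter.Eventually.of_forall fun w => ?_)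
    simp [eqn, Φ.line_zero]
  obtain ⟨f, hf, hf0, hfG⟩ := AnalyticAt.exists_implicit_scalar (x₀ := (0 : ℂ × ℂ × ℂ)) (y₀ := 0)
    hG hG0 hA Φ.transverse
  have hfG' : ∀ᶠ y : (ℂ × ℂ × ℂ) × ℂ in 𝓝 0, Φ.eqn y = 0 ↔ y.2 = f y.1 := hfG
  have ht2 : ∀ᶠ l in 𝓝 (0 : ℂ × ℂ), f (0, l) = l.1 := by
    have ht : Filter.Tendsto (fun l : ℂ × ℂ => (((0, l), l.1) : (ℂ × ℂ × ℂ) × ℂ))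
        (𝓝 0) (𝓝 0) := by
      have : ContinuousAt (fun l : ℂ × ℂ => (((0, l), l.1) : (ℂ × ℂ × ℂ) × ℂ)) 0 := by fun_prop
      exact this.tendsto
    filter_upwards [Φ.line_spec, ht.eventually hfG'] with l hl1 hl2
    refine (hl2.mp ?_).symm
    have := ((hl1 _).mpr rfl).2.1
    simpa [eqn] using this
  refine ⟨f, hf, hfG', ht2, ?_⟩
  · have hcont : ContinuousAt (fun l : ℂ × ℂ => (S.O + l.1 • Φ.u, Φ.line l)) 0 := by
      have := Φ.analyticAt_line.continuousAt
      fun_prop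
    have hcont' : Filter.Tendsto (fun l : ℂ × ℂ => (S.O + l.1 • Φ.u, Φ.line l)) (𝓝 0)
        (𝓝 (S.O, c₁)) := by simpa [ContinuousAt, Φ.line_zero] using hcont
    have hDu : ∀ᶠ q in 𝓝 (S.O, c₁), (fderiv ℂ S.F q).comp (.inl ℂ _ _) Φ.u ≠ 0 := by
      have hc : ContinuousAt (fun q => (fderiv ℂ S.F q).comp (.inl ℂ _ _) Φ.u) (S.O, c₁) :=
        (hFan.fderiv.continuousAt.clm_comp continuousAt_const).clm_apply continuousAt_const
      apply hc.eventually_ne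
      rw [← S.fderiv_F hFan]; exact Φ.transverse
    have hinc : ContinuousAt (fun l : ℂ × ℂ => ((0, l) : ℂ × ℂ × ℂ)) 0 := by fun_prop
    have ht : Filter.Tendsto (fun l : ℂ × ℂ => (((0, l), f (0, l)) : (ℂ × ℂ × ℂ) × ℂ)) (𝓝 0)
        (𝓝 0) := by
      have : ContinuousAt (fun l : ℂ × ℂ => (((0, l), f (0, l)) : (ℂ × ℂ × ℂ) × ℂ)) 0 :=
        hinc.prodMk (ContinuousAt.comp (g := f) hf.continuousAt hinc)
      have h2 := this.tendsto
      have h3 : f (0, 0) = 0 := hf0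
      rw [h3] at h2
      exact h2
    filter_upwards [Φ.line_spec, hcont'.eventually hDu, hcont'.eventually hFan.eventually_analyticAt,
      ht.eventually hfG'.eventually_nhds, hinc.tendsto.eventually hf.eventually_analyticAt, ht2]
      with l hl1 hl2 hl3 hl4 hl5 hl6
    have htan := ((hl1 _).mpr rfl).2.2
    rw [S.fderiv_F hl3] at htan
    set D := (fderiv ℂ S.F (S.O + l.1 • Φ.u, Φ.line l)).comp (.inl ℂ (ℂ × ℂ) (ℂ × ℂ)) with hD
    have hz : HasDerivAt (fun z : ℂ => (z, l)) (1, 0) 0 :=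
      (hasDerivAt_id (0 : ℂ)).prodMk (hasDerivAt_const _ _)
    have hfz : HasDerivAt (fun z : ℂ => f (z, l)) (fderiv ℂ f (0, l) (1, 0)) 0 :=
      hl5.differentiableAt.hasFDerivAt.comp_hasDerivAt (0 : ℂ) hz
    set a := fderiv ℂ f (0, l) (1, 0)
    have hpt : HasDerivAt (fun z : ℂ => S.O + (z • Φ.v + f (z, l) • Φ.u)) (Φ.v + a • Φ.u) 0 := by
      have := (((hasDerivAt_id (0 : ℂ)).smul_const Φ.v).add (hfz.smul_const Φ.u)).const_add S.O
      simpa using this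
    have hFq : HasFDerivAt (fun q : ℂ × ℂ => S.F (q, Φ.line l)) D
        (S.O + ((0 : ℂ) • Φ.v + f (0, l) • Φ.u)) := by
      have : AnalyticAt ℂ (fun q : ℂ × ℂ => S.F (q, Φ.line l)) (S.O + l.1 • Φ.u) :=
        AnalyticAt.comp (g := S.F) (f := fun q : ℂ × ℂ => (q, Φ.line l)) hl3 (by fun_prop)
      rw [hl6, zero_smul, zero_add, hD, ← S.fderiv_F hl3]
      exact this.differentiableAt.hasFDerivAt
    have hcomp := hFq.comp_hasDerivAt (0 : ℂ) hpt
    have hzero : HasDerivAt (fun z : ℂ => S.F (S.O + (z • Φ.v + f (z, l) • Φ.u), Φ.line l)) 0 0 := by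
      refine (hasDerivAt_const (0 : ℂ) (0 : ℂ)).congr_of_eventuallyEq ?_
      have : ContinuousAt (fun z : ℂ => (((z, l), f (z, l)) : (ℂ × ℂ × ℂ) × ℂ)) 0 :=
        hz.continuousAt.prodMk hfz.continuousAt
      filter_upwards [this.tendsto.eventually hl4] with z hz'
      exact hz'.mpr rfl
    have hDa := hcomp.unique hzero
    rw [map_add, map_smul] at hDa htan
    have : (a - l.2) * D Φ.u = 0 := by
      simp only [smul_eq_mul] at hDa htan
      linear_combination hDa - htan
    have hal : a = l.2 := sub_eq_zero.mp ((mul_eq_zero.mp this).resolve_right hl2)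
    rw [hal] at hfz
    exact hfz

end Frame

/-! ### Rescaling the family to a perturbation of straight lines. -/

/-- Anisotropically rescaled coordinates `θ ε` near `O` and `κ ε` near `c₁`, in which the curves
become the graphs `w = Ψ (ε, z, b, m)`, a holomorphic perturbation of the lines `w = b + z m`. -/
structure LineModel (S : TransverseFamily) (c₁ : ℂ × ℂ) where
  Ψ : ℂ × ℂ × ℂ × ℂ → ℂ
  θ : ℂ → ℂ × ℂ → ℂ × ℂ
  θinv : ℂ → ℂ × ℂ → ℂ × ℂ
  κ : ℂ → ℂ × ℂ → ℂ × ℂ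
  analyticAt : ∀ x : ℂ × ℂ × ℂ, AnalyticAt ℂ Ψ (0, x)
  Ψ_zero : ∀ z b m, Ψ (0, z, b, m) = b + z * m
  Ψ_axis : ∀ z, ∀ᶠ x : ℂ × ℂ in 𝓝 (0, z), Ψ (x.1, x.2, 0) = 0
  Ψ_left : ∀ l : ℂ × ℂ, ∀ᶠ x : ℂ × ℂ × ℂ in 𝓝 (0, l), Ψ (x.1, 0, x.2) = x.2.1
  hasDerivAt : ∀ᶠ x : ℂ × ℂ in 𝓝 0, HasDerivAt (fun z => Ψ (x.1, z, 0, x.2)) x.2 0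
  incidence : ∀ p l, ∀ᶠ x : ℂ × (ℂ × ℂ) × (ℂ × ℂ) in 𝓝 (0, p, l), x.1 ≠ 0 →
    θ x.1 x.2.1 ∈ S.U ∧ κ x.1 x.2.2 ∈ S.V ∧
      (S.F (θ x.1 x.2.1, κ x.1 x.2.2) = 0 ↔ x.2.1.2 = Ψ (x.1, x.2.1.1, x.2.2))
  θ_zero : ∀ ε, θ ε 0 = S.O
  κ_zero : ∀ ε, κ ε 0 = c₁
  left_inv : ∀ ε ≠ 0, ∀ p, θinv ε (θ ε p) = p
  right_inv : ∀ ε ≠ 0, ∀ q, θ ε (θinv ε q) = q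
  analyticAt_θ : ∀ᶠ x : ℂ × ℂ × ℂ in 𝓝 0, AnalyticAt ℂ (θ x.1) x.2
  analyticAt_θinv : ∀ᶠ x : ℂ × ℂ × ℂ in 𝓝 0, x.1 ≠ 0 → AnalyticAt ℂ (θinv x.1) (θ x.1 x.2)
  param : ∀ ε ≠ 0, ∀ N ∈ 𝓝 (0 : ℂ × ℂ), ∀ᶠ c in 𝓝 c₁, ∃ l ∈ N, κ ε l = c

namespace Frame

/-- An automorphism must control all curves with parameter near c₁, so each of them has to arise
from some small l. The preimage is explicit: the height of the curve along u over z = 0, and its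
slope there. -/
theorem line_surjective (Φ : S.Frame c₁) {N : Set (ℂ × ℂ)} (hN : N ∈ 𝓝 (0 : ℂ × ℂ)) :
    ∀ᶠ c in 𝓝 c₁, ∃ l ∈ N, Φ.line l = c := by
  have hFan : AnalyticAt ℂ S.F (S.O, c₁) := S.analyticAt_F S.O_mem_U Φ.mem
  have hG : AnalyticAt ℂ (fun y : (ℂ × ℂ) × ℂ => S.F (S.O + y.2 • Φ.u, y.1)) (c₁, 0) := by
    refine AnalyticAt.comp (g := S.F) (f := fun y : (ℂ × ℂ) × ℂ => (S.O + y.2 • Φ.u, y.1)) ?_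
      (by fun_prop)
    simpa using hFan
  have hA : HasDerivAt (fun w : ℂ => S.F (S.O + w • Φ.u, c₁))
      (fderiv ℂ (fun q : ℂ × ℂ => S.F (q, c₁)) S.O Φ.u) 0 := by
    have h1 : HasDerivAt (fun w : ℂ => S.O + w • Φ.u) Φ.u 0 := by
      simpa using ((hasDerivAt_id (0 : ℂ)).smul_const Φ.u).const_add S.O
    have h2 : HasFDerivAt (fun q : ℂ × ℂ => S.F (q, c₁))
        (fderiv ℂ (fun q : ℂ × ℂ => S.F (q, c₁)) S.O) (S.O + (0 : ℂ) • Φ.u) := by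
      simp only [zero_smul, add_zero]
      have : AnalyticAt ℂ (fun q : ℂ × ℂ => S.F (q, c₁)) S.O :=
        AnalyticAt.comp (g := S.F) (f := fun q : ℂ × ℂ => (q, c₁)) hFan (by fun_prop)
      exact this.differentiableAt.hasFDerivAt
    exact h2.comp_hasDerivAt (0 : ℂ) h1
  obtain ⟨β, hβ, hβ0, hβG⟩ := hG.exists_implicit_scalar (by simpa using Φ.O_mem) hA Φ.transverse
  have hpt : ContinuousAt (fun c => (S.O + β c • Φ.u, c)) c₁ := by
    have := hβ.continuousAt
    fun_prop
  have hpt' : Filter.Tendsto (fun c => (S.O + β c • Φ.u, c)) (𝓝 c₁) (𝓝 (S.O, c₁)) := by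
    simpa [ContinuousAt, hβ0] using hpt
  let D : ℂ × ℂ → ℂ × ℂ → ℂ := fun c x => (fderiv ℂ S.F (S.O + β c • Φ.u, c)).comp (.inl ℂ _ _) x
  have hD : ∀ x, ContinuousAt (fun c => D c x) c₁ := fun x => by
    have h1 : ContinuousAt (fun c => fderiv ℂ S.F (S.O + β c • Φ.u, c)) c₁ := by
      refine ContinuousAt.comp (g := fderiv ℂ S.F) (f := fun c => (S.O + β c • Φ.u, c)) ?_ hpt
      simpa [hβ0] using hFan.fderiv.continuousAt
    exact (h1.clm_comp continuousAt_const).clm_apply continuousAt_const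
  have hD0 : ∀ x, D c₁ x = fderiv ℂ (fun q : ℂ × ℂ => S.F (q, c₁)) S.O x := fun x => by
    simp only [D, hβ0, zero_smul, add_zero]
    rw [← S.fderiv_F hFan]
  have hDu : D c₁ Φ.u ≠ 0 := by rw [hD0]; exact Φ.transverse
  have hDv : D c₁ Φ.v = 0 := by rw [hD0]; exact Φ.tangent
  let l : ℂ × ℂ → ℂ × ℂ := fun c => (β c, -(D c Φ.v / D c Φ.u))
  have hl : ContinuousAt l c₁ := hβ.continuousAt.prodMk (((hD _).div (hD _) hDu).neg)
  have hl0 : l c₁ = 0 := by simp [l, hβ0, hDv]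
  have hl' : Filter.Tendsto l (𝓝 c₁) (𝓝 0) := by simpa [ContinuousAt, hl0] using hl
  have hβt : Filter.Tendsto (fun c => (c, β c)) (𝓝 c₁) (𝓝 (c₁, 0)) := by
    have : ContinuousAt (fun c => (c, β c)) c₁ := continuousAt_id.prodMk hβ.continuousAt
    simpa [ContinuousAt, hβ0] using this
  filter_upwards [hl'.eventually hN, hl'.eventually Φ.line_spec, hβt.eventually hβG,
    hpt'.eventually hFan.eventually_analyticAt, (hD Φ.u).eventually_ne hDu,
    (isOpen_polydisc _ _).mem_nhds Φ.mem] with c h1 h2 h3 h4 h5 h6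
  refine ⟨l c, h1, ((h2 c).mp ⟨h6, h3.mpr rfl, ?_⟩).symm⟩
  rw [S.fderiv_F h4, map_add, map_smul]
  change D c Φ.v + -(D c Φ.v / D c Φ.u) * D c Φ.u = 0
  field_simp
  ring

/-- The linear coordinates `(z, w) ↦ z v + w u`. -/
theorem exists_coordinates (Φ : S.Frame c₁) :
    ∃ N : (ℂ × ℂ) ≃L[ℂ] (ℂ × ℂ), ∀ p, N p = p.1 • Φ.v + p.2 • Φ.u := by
  let A : (ℂ × ℂ) →ₗ[ℂ] (ℂ × ℂ) :=
    (LinearMap.fst ℂ ℂ ℂ).smulRight Φ.v + (LinearMap.snd ℂ ℂ ℂ).smulRight Φ.u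
  have hA : ∀ p, A p = p.1 • Φ.v + p.2 • Φ.u := fun p => rfl
  have hinj : Function.Injective A := by
    rw [← LinearMap.ker_eq_bot, LinearMap.ker_eq_bot']
    intro p hp
    rw [hA] at hp
    have h2 : p.2 = 0 := by
      have := congrArg (fderiv ℂ (fun q : ℂ × ℂ => S.F (q, c₁)) S.O) hp
      simpa [Φ.tangent, Φ.transverse] using this
    have h1 : p.1 = 0 := by simpa [h2, Φ.v_ne_zero] using hp
    exact Prod.ext h1 h2
  exact ⟨(LinearEquiv.ofInjectiveEndo A hinj).toContinuousLinearEquiv, fun p => hA p⟩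

/-- With weight 1 for z and m and weight 2 for w and b, the leading part b + z m is homogeneous of
weight 2, while a cubic remainder has weight at least 3. Division by ε² therefore leaves a family
analytic at ε = 0. -/
theorem nonempty_lineModel (Φ : S.Frame c₁) : Nonempty (S.LineModel c₁) := by
  obtain ⟨f, hf, hfG, hleft, hder⟩ := Φ.exists_graph
  obtain ⟨N, hN⟩ := Φ.exists_coordinates
  set f₀ : ℂ → ℂ := fun z => f (z, 0) with hf₀
  have hf00 : f₀ 0 = 0 := hleft.self_of_nhds
  have hf₀an : AnalyticAt ℂ f₀ 0 :=
    AnalyticAt.comp (g := f) (f := fun z : ℂ => (z, (0 : ℂ × ℂ))) hf (by fun_prop)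
  -- Subtracting the graph of `L c₁` straightens it to the axis and removes the pure powers of z,
  -- the only quadratic or linear terms besides b and z m that the normalization at z = 0 permits.
  set g : ℂ × ℂ × ℂ → ℂ := fun x => f x - f₀ x.1 with hg
  have hgan : AnalyticAt ℂ g 0 := by
    refine hf.sub (AnalyticAt.comp (g := f₀) (f := fun x : ℂ × ℂ × ℂ => x.1) hf₀an (by fun_prop))
  have hgleft : ∀ᶠ l in 𝓝 (0 : ℂ × ℂ), g (0, l) = l.1 := by
    filter_upwards [hleft] with l hl
    simp [hg, hl, hf00]
  have hgder : ∀ᶠ l in 𝓝 (0 : ℂ × ℂ), HasDerivAt (fun z => g (z, l)) l.2 0 := by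
    filter_upwards [hder] with l hl
    have h := hl.sub hder.self_of_nhds
    simp only [Prod.snd_zero, sub_zero] at h
    exact h
  obtain ⟨C, hC, hCexp⟩ := cubic_remainder hgan hgleft hgder
    (Filter.Eventually.of_forall fun z => by simp [hg, hf₀])
  -- The rescaled argument is X = ε y with y still analytic at ε = 0, so the cubic remainder C(X, X,
  -- X) carries a factor ε³.
  let y : ℂ × ℂ × ℂ × ℂ → ℂ × ℂ × ℂ := fun x => (x.2.1, x.1 * x.2.2.1, x.2.2.2)
  let X : ℂ × ℂ × ℂ × ℂ → ℂ × ℂ × ℂ := fun x => (x.1 * x.2.1, x.1 ^ 2 * x.2.2.1, x.1 * x.2.2.2)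
  have hXy : ∀ x, X x = x.1 • y x := fun x => by simp [X, y]; ring
  let Ψ : ℂ × ℂ × ℂ × ℂ → ℂ := fun x =>
    x.2.2.1 + x.2.1 * x.2.2.2 + x.1 * C (X x) (y x) (y x) (y x)
  have hX : ∀ a, Filter.Tendsto X (𝓝 (0, a)) (𝓝 0) := fun a => by
    have : ContinuousAt X (0, a) := by fun_prop
    exact this.tendsto_of_eq (by simp [X])
  have hΨ : ∀ a, ∀ᶠ x in 𝓝 ((0 : ℂ), a), x.1 ^ 2 * Ψ x = g (X x) := fun a => by
    filter_upwards [(hX a).eventually hCexp] with x hx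
    rw [hx]
    have : C (X x) (X x) (X x) (X x) = x.1 ^ 3 * C (X x) (y x) (y x) (y x) := by
      generalize hT : C (X x) = T
      rw [hXy]
      simp only [map_smul, smul_apply, smul_eq_mul]
      ring
    rw [this]
    simp only [Ψ, X]
    ring
  have hΨ0 : ∀ z b m, Ψ (0, z, b, m) = b + z * m := fun z b m => by simp [Ψ]
  -- The map undoes both the rescaling and the straightening: the term `f₀` puts the axis back onto
  -- `L c₁`.
  let θ : ℂ → ℂ × ℂ → ℂ × ℂ := fun ε p => S.O + N (ε * p.1, ε ^ 2 * p.2 + f₀ (ε * p.1))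
  let θinv : ℂ → ℂ × ℂ → ℂ × ℂ := fun ε q =>
    ((N.symm (q - S.O)).1 / ε, ((N.symm (q - S.O)).2 - f₀ (N.symm (q - S.O)).1) / ε ^ 2)
  let κ : ℂ → ℂ × ℂ → ℂ × ℂ := fun ε l => Φ.line (ε ^ 2 * l.1, ε * l.2)
  have hleftinv : ∀ ε ≠ 0, ∀ p, θinv ε (θ ε p) = p := fun ε hε p => by
    ext <;> simp [θ, θinv, hε]
  have hsmall : Filter.Tendsto (fun x : ℂ × ℂ × ℂ => x.1 * x.2.1) (𝓝 0) (𝓝 0) := by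
    have : ContinuousAt (fun x : ℂ × ℂ × ℂ => x.1 * x.2.1) 0 := by fun_prop
    simpa [ContinuousAt] using this
  refine ⟨⟨Ψ, θ, θinv, κ, ?_, hΨ0, ?_, ?_, ?_, ?_, ?_, ?_, hleftinv, ?_, ?_, ?_, ?_⟩⟩
  · intro a
    have hCX : AnalyticAt ℂ (fun x => C (X x)) (0, a) := by
      refine AnalyticAt.comp (g := C) (f := X) ?_ (by fun_prop)
      have : X (0, a) = 0 := by simp [X]
      rwa [this]
    have hy : AnalyticAt ℂ y (0, a) := by fun_prop
    have : AnalyticAt ℂ (fun x => C (X x) (y x) (y x) (y x)) (0, a) :=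
      ((hCX.clm_apply' hy).clm_apply' hy).clm_apply' hy
    exact AnalyticAt.add (by fun_prop) (analyticAt_fst.mul this)
  · intro z
    have : ContinuousAt (fun x : ℂ × ℂ => (x.1, x.2, (0 : ℂ × ℂ))) (0, z) := by fun_prop
    filter_upwards [this.tendsto.eventually (hΨ _)] with x hx
    by_cases h : x.1 = 0
    · rw [h]; exact (hΨ0 x.2 0 0).trans (by simp)
    · have h0 : g (X (x.1, x.2, 0)) = 0 := by simp [X, hg, hf₀, Prod.zero_eq_mk]
      rw [h0] at hx
      simpa [h] using hx
  · intro l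
    have : ContinuousAt (fun x : ℂ × ℂ × ℂ => (x.1, (0 : ℂ), x.2)) (0, l) := by fun_prop
    have h2 : ContinuousAt (fun x : ℂ × ℂ × ℂ => (x.1 ^ 2 * x.2.1, x.1 * x.2.2)) (0, l) := by
      fun_prop
    have h3 : Filter.Tendsto (fun x : ℂ × ℂ × ℂ => (x.1 ^ 2 * x.2.1, x.1 * x.2.2)) (𝓝 (0, l))
        (𝓝 0) := h2.tendsto_of_eq (by simp)
    filter_upwards [this.tendsto.eventually (hΨ _), h3.eventually hgleft] with x hx hx3
    by_cases h : x.1 = 0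
    · rw [h]; simpa using hΨ0 0 x.2.1 x.2.2
    · have h0 : g (X (x.1, 0, x.2)) = x.1 ^ 2 * x.2.1 := by simpa [X] using hx3
      rw [h0] at hx
      exact mul_left_cancel₀ (pow_ne_zero 2 h) hx
  · have h1 : ContinuousAt (fun x : ℂ × ℂ => (x.1, (0 : ℂ), (0 : ℂ), x.2)) 0 := by fun_prop
    have h3 : Filter.Tendsto (fun x : ℂ × ℂ => ((0 : ℂ), x.1 * x.2)) (𝓝 0) (𝓝 0) := by
      have h2 : ContinuousAt (fun x : ℂ × ℂ => ((0 : ℂ), x.1 * x.2)) 0 := by fun_prop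
      exact h2.tendsto_of_eq (by simp)
    filter_upwards [h1.tendsto.eventually (hΨ 0).eventually_nhds, h3.eventually hgder] with x hx hx3
    by_cases h : x.1 = 0
    · simp only [h, hΨ0, zero_add]
      simpa using (hasDerivAt_id (0 : ℂ)).mul_const x.2
    · have h4 : ContinuousAt (fun z : ℂ => (x.1, z, (0 : ℂ), x.2)) 0 := by fun_prop
      have h5 : HasDerivAt (fun z : ℂ => x.1 * z) x.1 0 := by
        simpa using (hasDerivAt_id (0 : ℂ)).const_mul x.1
      have h6 : HasDerivAt (fun z : ℂ => g (x.1 * z, 0, x.1 * x.2)) (x.1 * x.2 * x.1) 0 := by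
        have h7 : HasDerivAt (fun z => g (z, 0, x.1 * x.2)) (x.1 * x.2) (x.1 * 0) := by
          simpa using hx3
        exact HasDerivAt.comp (0 : ℂ) h7 h5
      have h8 := h6.div_const (x.1 ^ 2)
      have h9 : x.1 * x.2 * x.1 / x.1 ^ 2 = x.2 := by field_simp
      rw [h9] at h8
      refine h8.congr_of_eventuallyEq ?_
      filter_upwards [h4.tendsto.eventually hx] with z hz
      have h10 : g (X (x.1, z, 0, x.2)) = g (x.1 * z, 0, x.1 * x.2) := by simp [X]
      rw [h10] at hz
      rw [← hz]
      field_simp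
  · intro p l
    have h1 : ContinuousAt (fun x : ℂ × (ℂ × ℂ) × (ℂ × ℂ) => (x.1, x.2.1.1, x.2.2)) (0, p, l) := by
      fun_prop
    have h0 : Filter.Tendsto (fun x : ℂ × (ℂ × ℂ) × (ℂ × ℂ) => f₀ (x.1 * x.2.1.1)) (𝓝 (0, p, l))
        (𝓝 0) := by
      have : ContinuousAt (fun x : ℂ × (ℂ × ℂ) × (ℂ × ℂ) => f₀ (x.1 * x.2.1.1)) (0, p, l) := by
        refine ContinuousAt.comp (g := f₀) (f := fun x : ℂ × (ℂ × ℂ) × (ℂ × ℂ) => x.1 * x.2.1.1) ?_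
          (by fun_prop)
        simpa using hf₀an.continuousAt
      simpa [ContinuousAt, hf00] using this
    have h2 : Filter.Tendsto (fun x : ℂ × (ℂ × ℂ) × (ℂ × ℂ) => x.1 ^ 2 * x.2.1.2)
        (𝓝 (0, p, l)) (𝓝 0) := by
      have : ContinuousAt (fun x : ℂ × (ℂ × ℂ) × (ℂ × ℂ) => x.1 ^ 2 * x.2.1.2) (0, p, l) := by
        fun_prop
      simpa [ContinuousAt] using this
    have h3 : Filter.Tendsto (fun x : ℂ × (ℂ × ℂ) × (ℂ × ℂ) => (X (x.1, x.2.1.1, x.2.2),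
        x.1 ^ 2 * x.2.1.2 + f₀ (x.1 * x.2.1.1))) (𝓝 (0, p, l)) (𝓝 0) := by
      have := ((hX _).comp h1.tendsto).prodMk_nhds (h2.add h0)
      rw [zero_add] at this
      exact this
    have h4 : Filter.Tendsto (fun x : ℂ × (ℂ × ℂ) × (ℂ × ℂ) => θ x.1 x.2.1) (𝓝 (0, p, l))
        (𝓝 S.O) := by
      have h5 : Filter.Tendsto (fun x : ℂ × (ℂ × ℂ) × (ℂ × ℂ) => x.1 * x.2.1.1) (𝓝 (0, p, l))
          (𝓝 0) := by
        have : ContinuousAt (fun x : ℂ × (ℂ × ℂ) × (ℂ × ℂ) => x.1 * x.2.1.1) (0, p, l) := by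
          fun_prop
        simpa [ContinuousAt] using this
      have h6 := (N.continuous.tendsto (0, 0 + 0)).comp (h5.prodMk_nhds (h2.add h0))
      have h7 := (tendsto_const_nhds (x := S.O)).add h6
      simpa [Prod.zero_eq_mk.symm] using h7
    have h5 : Filter.Tendsto (fun x : ℂ × (ℂ × ℂ) × (ℂ × ℂ) => κ x.1 x.2.2) (𝓝 (0, p, l))
        (𝓝 c₁) := by
      have : ContinuousAt (fun x : ℂ × (ℂ × ℂ) × (ℂ × ℂ) => κ x.1 x.2.2) (0, p, l) := by
        refine ContinuousAt.comp (g := Φ.line) (f := fun x : ℂ × (ℂ × ℂ) × (ℂ × ℂ) =>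
          (x.1 ^ 2 * x.2.2.1, x.1 * x.2.2.2)) ?_ (by fun_prop)
        simpa [Prod.zero_eq_mk.symm] using Φ.analyticAt_line.continuousAt
      simpa [ContinuousAt, κ, Prod.zero_eq_mk.symm, Φ.line_zero] using this
    filter_upwards [h3.eventually hfG, h4.eventually S.U_mem_nhds,
      h5.eventually ((isOpen_polydisc _ _).mem_nhds Φ.mem), h1.tendsto.eventually (hΨ _)]
      with x hx1 hx2 hx3 hx4 hε
    refine ⟨hx2, hx3, ?_⟩
    have : S.F (θ x.1 x.2.1, κ x.1 x.2.2) = Φ.eqn (X (x.1, x.2.1.1, x.2.2),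
        x.1 ^ 2 * x.2.1.2 + f₀ (x.1 * x.2.1.1)) := by
      simp [θ, κ, hN, eqn, X]
    rw [this, hx1]
    simp only [hg] at hx4
    have hX1 : (X (x.1, x.2.1.1, x.2.2)).1 = x.1 * x.2.1.1 := rfl
    rw [hX1] at hx4
    constructor
    · intro h
      apply mul_left_cancel₀ (pow_ne_zero 2 hε)
      rw [hx4, ← h]; ring
    · intro h
      rw [h, hx4]; ring
  · intro ε
    have : ((0 : ℂ), f₀ 0) = 0 := by simp [hf00]
    simp [θ, this]
  · intro ε
    simpa [κ, Prod.zero_eq_mk.symm] using Φ.line_zero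
  · intro ε hε q
    have : (ε * (θinv ε q).1, ε ^ 2 * (θinv ε q).2 + f₀ (ε * (θinv ε q).1)) = N.symm (q - S.O) := by
      ext
      · simp [θinv]; field_simp
      · simp only [θinv]
        rw [mul_div_cancel₀ _ hε]
        field_simp
        ring
    simp only [θ, this]
    simp
  · filter_upwards [hsmall.eventually hf₀an.eventually_analyticAt] with x hx
    have h1 : AnalyticAt ℂ (fun p : ℂ × ℂ => f₀ (x.1 * p.1)) x.2 :=
      AnalyticAt.comp (g := f₀) (f := fun p : ℂ × ℂ => x.1 * p.1) hx (by fun_prop)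
    have h2 : AnalyticAt ℂ (fun p : ℂ × ℂ => (x.1 * p.1, x.1 ^ 2 * p.2 + f₀ (x.1 * p.1))) x.2 := by
      fun_prop
    exact analyticAt_const.add
      ((N.toContinuousLinearMap.analyticAt _).comp h2)
  · filter_upwards [hsmall.eventually hf₀an.eventually_analyticAt] with x hx hε
    have h0 : AnalyticAt ℂ (fun q : ℂ × ℂ => N.symm (q - S.O)) (θ x.1 x.2) :=
      (N.symm.toContinuousLinearMap.analyticAt _).comp (by fun_prop)
    have h1 : AnalyticAt ℂ (fun q : ℂ × ℂ => f₀ (N.symm (q - S.O)).1) (θ x.1 x.2) := by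
      refine AnalyticAt.comp (g := f₀) (f := fun q : ℂ × ℂ => (N.symm (q - S.O)).1) ?_
        (analyticAt_fst.comp h0)
      simpa [θ] using hx
    exact ((analyticAt_fst.comp h0).div analyticAt_const hε).prod
      (((analyticAt_snd.comp h0).sub h1).div analyticAt_const (pow_ne_zero 2 hε))
  · intro ε hε M hM
    have h1 : Filter.Tendsto (fun l : ℂ × ℂ => (l.1 / ε ^ 2, l.2 / ε)) (𝓝 0) (𝓝 0) := by
      have : ContinuousAt (fun l : ℂ × ℂ => (l.1 / ε ^ 2, l.2 / ε)) 0 := by fun_prop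
      exact this.tendsto_of_eq (by simp)
    filter_upwards [Φ.line_surjective (h1 hM)] with c ⟨l, hl, hlc⟩
    refine ⟨_, hl, ?_⟩
    rw [← hlc]
    simp only [κ]
    congr 1
    ext
    · simp; field_simp
    · simp; field_simp

end Frame

/-! ### Incidence in the model: joins and meets that persist for small ε. -/

namespace LineModel

/-- The model point `p` lies on the model line `l`. -/
def Inc (M : S.LineModel c₁) (ε : ℂ) (p l : ℂ × ℂ) : Prop := p.2 = M.Ψ (ε, p.1, l)

/-- The point of `U` represented by `p` lies on the curve represented by `l`. -/
def On (M : S.LineModel c₁) (ε : ℂ) (p l : ℂ × ℂ) : Prop := M.θ ε p ∈ S.L (M.κ ε l)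

theorem inc_zero (M : S.LineModel c₁) {p l : ℂ × ℂ} : M.Inc 0 p l ↔ p.2 = l.1 + p.1 * l.2 := by
  obtain ⟨b, m⟩ := l
  rw [Inc, M.Ψ_zero]

/-- At ε = 0, the conditions on (b, m) are linear with determinant q.1 - p.1, so different abscissas
suffice for the implicit function theorem. -/
theorem exists_join (M : S.LineModel c₁) {p q l : ℂ × ℂ} (hp : M.Inc 0 p l) (hq : M.Inc 0 q l)
    (hne : p.1 ≠ q.1) : ∃ j : ℂ × (ℂ × ℂ) × (ℂ × ℂ) → ℂ × ℂ, AnalyticAt ℂ j (0, p, q) ∧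
      j (0, p, q) = l ∧
      ∀ᶠ x in 𝓝 ((0 : ℂ), p, q), M.Inc x.1 x.2.1 (j x) ∧ M.Inc x.1 x.2.2 (j x) := by
  let G : (ℂ × (ℂ × ℂ) × (ℂ × ℂ)) × (ℂ × ℂ) → ℂ × ℂ := fun y =>
    (M.Ψ (y.1.1, y.1.2.1.1, y.2) - y.1.2.1.2, M.Ψ (y.1.1, y.1.2.2.1, y.2) - y.1.2.2.2)
  have h1 : AnalyticAt ℂ (fun y : (ℂ × (ℂ × ℂ) × (ℂ × ℂ)) × (ℂ × ℂ) =>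
      M.Ψ (y.1.1, y.1.2.1.1, y.2)) ((0, p, q), l) :=
    AnalyticAt.comp (g := M.Ψ) (f := fun y : (ℂ × (ℂ × ℂ) × (ℂ × ℂ)) × (ℂ × ℂ) =>
      (y.1.1, y.1.2.1.1, y.2)) (M.analyticAt _) (by fun_prop)
  have h2 : AnalyticAt ℂ (fun y : (ℂ × (ℂ × ℂ) × (ℂ × ℂ)) × (ℂ × ℂ) =>
      M.Ψ (y.1.1, y.1.2.2.1, y.2)) ((0, p, q), l) :=
    AnalyticAt.comp (g := M.Ψ) (f := fun y : (ℂ × (ℂ × ℂ) × (ℂ × ℂ)) × (ℂ × ℂ) =>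
      (y.1.1, y.1.2.2.1, y.2)) (M.analyticAt _) (by fun_prop)
  have hG : AnalyticAt ℂ G ((0, p, q), l) := by fun_prop
  have hG0 : G ((0, p, q), l) = 0 :=
    Prod.ext (sub_eq_zero.mpr (Eq.symm hp)) (sub_eq_zero.mpr (Eq.symm hq))
  let A : ℂ × ℂ →L[ℂ] ℂ × ℂ :=
    (ContinuousLinearMap.fst ℂ ℂ ℂ + p.1 • ContinuousLinearMap.snd ℂ ℂ ℂ).prod
      (ContinuousLinearMap.fst ℂ ℂ ℂ + q.1 • ContinuousLinearMap.snd ℂ ℂ ℂ)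
  have hAapp : ∀ y, A y = (y.1 + p.1 * y.2, y.1 + q.1 * y.2) := fun y => rfl
  have hA : HasFDerivAt (fun y => G ((0, p, q), y)) A l := by
    have h3 := A.hasFDerivAt (x := l) |>.sub_const (p.2, q.2)
    refine h3.congr_of_eventuallyEq (Filter.Eventually.of_forall fun y => ?_)
    obtain ⟨b, m⟩ := y
    simp [G, M.Ψ_zero, hAapp]
  obtain ⟨j, hj, hj0, hjG⟩ := hG.exists_implicit hG0 hA (by
    intro x y hxy
    rw [hAapp, hAapp, Prod.mk.injEq] at hxy
    have h4 : (p.1 - q.1) * (x.2 - y.2) = 0 := by linear_combination hxy.1 - hxy.2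
    have h5 : x.2 = y.2 :=
      sub_eq_zero.mp ((mul_eq_zero.mp h4).resolve_left (sub_ne_zero.mpr hne))
    refine Prod.ext ?_ h5
    rw [h5] at hxy
    exact add_right_cancel hxy.1)
  refine ⟨j, hj, hj0, ?_⟩
  have ht : ContinuousAt (fun x => (x, j x)) (0, p, q) := continuousAt_id.prodMk hj.continuousAt
  filter_upwards [(ht.tendsto_of_eq (by rw [hj0])).eventually hjG] with x hx
  have h6 := hx.mpr rfl
  exact ⟨(sub_eq_zero.mp (congrArg Prod.fst h6)).symm, (sub_eq_zero.mp (congrArg Prod.snd h6)).symm⟩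

/-- Only the abscissa has to be solved for; at ε = 0 the equation has derivative l.2 - k.2, the
difference of the slopes. -/
theorem exists_meet (M : S.LineModel c₁) {p l k : ℂ × ℂ} (hl : M.Inc 0 p l) (hk : M.Inc 0 p k)
    (hne : l.2 ≠ k.2) : ∃ μ : ℂ × (ℂ × ℂ) × (ℂ × ℂ) → ℂ × ℂ, AnalyticAt ℂ μ (0, l, k) ∧
      μ (0, l, k) = p ∧
      ∀ᶠ x in 𝓝 ((0 : ℂ), l, k), M.Inc x.1 (μ x) x.2.1 ∧ M.Inc x.1 (μ x) x.2.2 := by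
  let G : (ℂ × (ℂ × ℂ) × (ℂ × ℂ)) × ℂ → ℂ := fun y =>
    M.Ψ (y.1.1, y.2, y.1.2.1) - M.Ψ (y.1.1, y.2, y.1.2.2)
  have h1 : AnalyticAt ℂ (fun y : (ℂ × (ℂ × ℂ) × (ℂ × ℂ)) × ℂ =>
      M.Ψ (y.1.1, y.2, y.1.2.1)) ((0, l, k), p.1) :=
    AnalyticAt.comp (g := M.Ψ) (f := fun y : (ℂ × (ℂ × ℂ) × (ℂ × ℂ)) × ℂ =>
      (y.1.1, y.2, y.1.2.1)) (M.analyticAt _) (by fun_prop)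
  have h2 : AnalyticAt ℂ (fun y : (ℂ × (ℂ × ℂ) × (ℂ × ℂ)) × ℂ =>
      M.Ψ (y.1.1, y.2, y.1.2.2)) ((0, l, k), p.1) :=
    AnalyticAt.comp (g := M.Ψ) (f := fun y : (ℂ × (ℂ × ℂ) × (ℂ × ℂ)) × ℂ =>
      (y.1.1, y.2, y.1.2.2)) (M.analyticAt _) (by fun_prop)
  have hG : AnalyticAt ℂ G ((0, l, k), p.1) := h1.sub h2
  have hG0 : G ((0, l, k), p.1) = 0 := by
    simp only [G]
    rw [Inc] at hl hk
    rw [← hl, ← hk, sub_self]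
  have hA : HasDerivAt (fun y => G ((0, l, k), y)) (l.2 - k.2) p.1 := by
    have h3 := ((hasDerivAt_id p.1).mul_const (l.2 - k.2)).const_add (l.1 - k.1)
    rw [one_mul] at h3
    refine h3.congr_of_eventuallyEq (Filter.Eventually.of_forall fun y => ?_)
    obtain ⟨b, m⟩ := l
    obtain ⟨b', m'⟩ := k
    simp [G, M.Ψ_zero]
    ring
  obtain ⟨t, ht, ht0, htG⟩ := hG.exists_implicit_scalar hG0 hA (sub_ne_zero.mpr hne)
  have hμ : AnalyticAt ℂ (fun x : ℂ × (ℂ × ℂ) × (ℂ × ℂ) => M.Ψ (x.1, t x, x.2.1)) (0, l, k) :=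
    AnalyticAt.comp (g := M.Ψ) (f := fun x : ℂ × (ℂ × ℂ) × (ℂ × ℂ) => (x.1, t x, x.2.1))
      (M.analyticAt _) (by fun_prop)
  refine ⟨fun x => (t x, M.Ψ (x.1, t x, x.2.1)), by fun_prop, ?_, ?_⟩
  · refine Prod.ext ht0 ?_
    simp only [ht0]
    exact hl.symm
  have hc : ContinuousAt (fun x => (x, t x)) (0, l, k) := continuousAt_id.prodMk ht.continuousAt
  filter_upwards [(hc.tendsto_of_eq (by rw [ht0])).eventually htG] with x hx
  exact ⟨rfl, sub_eq_zero.mp (hx.mpr rfl)⟩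

section Analytic

variable {E : Type*} [NormedAddCommGroup E] [NormedSpace ℂ E] {x₀ : E} {e : E → ℂ}

theorem join_analytic (M : S.LineModel c₁) {p q : E → ℂ × ℂ} {l : ℂ × ℂ}
    (he : AnalyticAt ℂ e x₀) (he0 : e x₀ = 0) (hp : AnalyticAt ℂ p x₀) (hq : AnalyticAt ℂ q x₀)
    (hpl : M.Inc 0 (p x₀) l) (hql : M.Inc 0 (q x₀) l) (hne : (p x₀).1 ≠ (q x₀).1) :
    ∃ j : E → ℂ × ℂ, AnalyticAt ℂ j x₀ ∧ j x₀ = l ∧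
      ∀ᶠ x in 𝓝 x₀, M.Inc (e x) (p x) (j x) ∧ M.Inc (e x) (q x) (j x) := by
  obtain ⟨j, hj, hj0, hjI⟩ := M.exists_join hpl hql hne
  have ht : AnalyticAt ℂ (fun x => (e x, p x, q x)) x₀ := he.prod (hp.prod hq)
  refine ⟨fun x => j (e x, p x, q x), ?_, by simp only [he0, hj0], ?_⟩
  · refine AnalyticAt.comp (g := j) (f := fun x => (e x, p x, q x)) ?_ ht
    rwa [he0]
  · exact (ht.continuousAt.tendsto_of_eq (by rw [he0])).eventually hjI

theorem meet_analytic (M : S.LineModel c₁) {l k : E → ℂ × ℂ} {p : ℂ × ℂ}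
    (he : AnalyticAt ℂ e x₀) (he0 : e x₀ = 0) (hl : AnalyticAt ℂ l x₀) (hk : AnalyticAt ℂ k x₀)
    (hpl : M.Inc 0 p (l x₀)) (hpk : M.Inc 0 p (k x₀)) (hne : (l x₀).2 ≠ (k x₀).2) :
    ∃ μ : E → ℂ × ℂ, AnalyticAt ℂ μ x₀ ∧ μ x₀ = p ∧
      ∀ᶠ x in 𝓝 x₀, M.Inc (e x) (μ x) (l x) ∧ M.Inc (e x) (μ x) (k x) := by
  obtain ⟨j, hj, hj0, hjI⟩ := M.exists_meet hpl hpk hne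
  have ht : AnalyticAt ℂ (fun x => (e x, l x, k x)) x₀ := he.prod (hl.prod hk)
  refine ⟨fun x => j (e x, l x, k x), ?_, by simp only [he0, hj0], ?_⟩
  · refine AnalyticAt.comp (g := j) (f := fun x => (e x, l x, k x)) ?_ ht
    rwa [he0]
  · exact (ht.continuousAt.tendsto_of_eq (by rw [he0])).eventually hjI

end Analytic

section Germ

variable {X : Type*} {f : Filter X} {e : X → ℂ}

/-- Version for families along an arbitrary filter on which ε tends to 0 through nonzero values. All
hypotheses concern the limiting straight figure. -/
theorem germ_join (M : S.LineModel c₁) {p q : X → ℂ × ℂ} {p₀ q₀ l : ℂ × ℂ}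
    (he : Filter.Tendsto e f (𝓝[≠] 0)) (hp : Filter.Tendsto p f (𝓝 p₀))
    (hq : Filter.Tendsto q f (𝓝 q₀)) (hpl : M.Inc 0 p₀ l) (hql : M.Inc 0 q₀ l)
    (hne : p₀.1 ≠ q₀.1) : ∃ j : X → ℂ × ℂ, Filter.Tendsto j f (𝓝 l) ∧
      ∀ᶠ x in f, M.Inc (e x) (p x) (j x) ∧ M.Inc (e x) (q x) (j x) := by
  obtain ⟨j, hj, hj0, hjI⟩ := M.exists_join hpl hql hne
  have ht := (he.mono_right nhdsWithin_le_nhds).prodMk_nhds (hp.prodMk_nhds hq)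
  exact ⟨fun x => j (e x, p x, q x), (hj.continuousAt.tendsto_of_eq hj0).comp ht,
    ht.eventually hjI⟩

theorem germ_meet (M : S.LineModel c₁) {l k : X → ℂ × ℂ} {l₀ k₀ p : ℂ × ℂ}
    (he : Filter.Tendsto e f (𝓝[≠] 0)) (hl : Filter.Tendsto l f (𝓝 l₀))
    (hk : Filter.Tendsto k f (𝓝 k₀)) (hpl : M.Inc 0 p l₀) (hpk : M.Inc 0 p k₀)
    (hne : l₀.2 ≠ k₀.2) : ∃ μ : X → ℂ × ℂ, Filter.Tendsto μ f (𝓝 p) ∧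
      ∀ᶠ x in f, M.Inc (e x) (μ x) (l x) ∧ M.Inc (e x) (μ x) (k x) := by
  obtain ⟨j, hj, hj0, hjI⟩ := M.exists_meet hpl hpk hne
  have ht := (he.mono_right nhdsWithin_le_nhds).prodMk_nhds (hl.prodMk_nhds hk)
  exact ⟨fun x => j (e x, l x, k x), (hj.continuousAt.tendsto_of_eq hj0).comp ht,
    ht.eventually hjI⟩

theorem germ_on (M : S.LineModel c₁) {p l : X → ℂ × ℂ} {p₀ l₀ : ℂ × ℂ}
    (he : Filter.Tendsto e f (𝓝[≠] 0)) (hp : Filter.Tendsto p f (𝓝 p₀))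
    (hl : Filter.Tendsto l f (𝓝 l₀)) :
    ∀ᶠ x in f, M.θ (e x) (p x) ∈ S.U ∧ M.κ (e x) (l x) ∈ S.V ∧
      (M.On (e x) (p x) (l x) ↔ M.Inc (e x) (p x) (l x)) := by
  have ht := (he.mono_right nhdsWithin_le_nhds).prodMk_nhds (hp.prodMk_nhds hl)
  filter_upwards [ht.eventually (M.incidence p₀ l₀), he.eventually self_mem_nhdsWithin] with x hx h0
  obtain ⟨h1, h2, h3⟩ := hx h0
  exact ⟨h1, h2, ⟨fun h => h3.mp h.2, fun h => ⟨h1, h3.mpr h⟩⟩⟩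

/-- Non-incidence is an open condition, so it is inherited from the limiting straight lines;
incidence is not, and is always carried along explicitly. -/
theorem germ_not_on (M : S.LineModel c₁) {p l : X → ℂ × ℂ} {p₀ l₀ : ℂ × ℂ}
    (he : Filter.Tendsto e f (𝓝[≠] 0)) (hp : Filter.Tendsto p f (𝓝 p₀))
    (hl : Filter.Tendsto l f (𝓝 l₀)) (h : ¬ M.Inc 0 p₀ l₀) :
    ∀ᶠ x in f, ¬ M.On (e x) (p x) (l x) := by
  have ht := (he.mono_right nhdsWithin_le_nhds).prodMk_nhds
    ((((continuous_fst.tendsto p₀).comp hp)).prodMk_nhds hl)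
  have h1 := (M.analyticAt (p₀.1, l₀)).continuousAt.tendsto.comp ht
  have h2 := (continuous_snd.tendsto p₀).comp hp
  have h3 : ∀ᶠ x in f, (p x).2 ≠ M.Ψ (e x, (p x).1, l x) := by
    have := (h2.prodMk_nhds h1).eventually (isOpen_ne_fun continuous_fst continuous_snd
      |>.mem_nhds (x := (p₀.2, M.Ψ (0, p₀.1, l₀))) h)
    exact this
  filter_upwards [M.germ_on he hp hl, h3] with x hx hx3
  rw [hx.2.2]; exact hx3

theorem θ_injective (M : S.LineModel c₁) {ε : ℂ} (hε : ε ≠ 0) {p q : ℂ × ℂ}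
    (h : M.θ ε p = M.θ ε q) : p = q := by
  rw [← M.left_inv ε hε p, h, M.left_inv ε hε q]

theorem germ_ne (M : S.LineModel c₁) {p q : X → ℂ × ℂ} {p₀ q₀ : ℂ × ℂ}
    (he : Filter.Tendsto e f (𝓝[≠] 0)) (hp : Filter.Tendsto p f (𝓝 p₀))
    (hq : Filter.Tendsto q f (𝓝 q₀)) (h : p₀ ≠ q₀) :
    ∀ᶠ x in f, M.θ (e x) (p x) ≠ M.θ (e x) (q x) := by
  have := (hp.prodMk_nhds hq).eventually (isOpen_ne_fun continuous_fst continuous_snd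
      |>.mem_nhds (x := (p₀, q₀)) h)
  filter_upwards [this, he.eventually self_mem_nhdsWithin] with x hx h0 h1
  exact hx (M.θ_injective h0 h1)

end Germ

end LineModel

/-! ### Desargues' hypothesis in usable form. -/

/-- Desargues' theorem, for two triangles in perspective from `O` two of whose pairs of sides
intersect in distinct points of a curve `L c` : the third pair intersects on `L c`, too. -/
theorem HasDesargues.third_mem {S : TransverseFamily} (hS : S.TwoPointUnique) (hD : S.HasDesargues)
    {A B C A' B' C' P Q R c a b d ab ab' ad ad' bd bd' pr qr : ℂ × ℂ}
    (hc : c ∈ S.V) (hP : P ∈ S.L c) (hQ : Q ∈ S.L c) (hPQ : P ≠ Q)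
    (ha : a ∈ S.V) (hOa : S.O ∈ S.L a) (hAa : A ∈ S.L a) (hA'a : A' ∈ S.L a)
    (hb : b ∈ S.V) (hOb : S.O ∈ S.L b) (hBb : B ∈ S.L b) (hB'b : B' ∈ S.L b)
    (hd : d ∈ S.V) (hOd : S.O ∈ S.L d) (hCd : C ∈ S.L d) (hC'd : C' ∈ S.L d)
    (hA : A ≠ S.O) (hA' : A' ≠ S.O) (hAA' : A ≠ A')
    (hB : B ≠ S.O) (hB' : B' ≠ S.O) (hBB' : B ≠ B')
    (hC : C ≠ S.O) (hC' : C' ≠ S.O) (hCC' : C ≠ C')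
    (hBa : B ∉ S.L a) (hCa : C ∉ S.L a) (hCb : C ∉ S.L b)
    (hab : ab ∈ S.V) (hAab : A ∈ S.L ab) (hBab : B ∈ S.L ab) (hPab : P ∈ S.L ab)
    (hab' : ab' ∈ S.V) (hA'ab : A' ∈ S.L ab') (hB'ab : B' ∈ S.L ab') (hP'ab : P ∈ S.L ab')
    (had : ad ∈ S.V) (hAad : A ∈ S.L ad) (hCad : C ∈ S.L ad) (hQad : Q ∈ S.L ad)
    (had' : ad' ∈ S.V) (hA'ad : A' ∈ S.L ad') (hC'ad : C' ∈ S.L ad') (hQ'ad : Q ∈ S.L ad')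
    (hbd : bd ∈ S.V) (hBbd : B ∈ S.L bd) (hCbd : C ∈ S.L bd) (hRbd : R ∈ S.L bd)
    (hbd' : bd' ∈ S.V) (hB'bd : B' ∈ S.L bd') (hC'bd : C' ∈ S.L bd') (hR'bd : R ∈ S.L bd')
    (hpr : pr ∈ S.V) (hPpr : P ∈ S.L pr) (hRpr : R ∈ S.L pr)
    (hqr : qr ∈ S.V) (hQqr : Q ∈ S.L qr) (hRqr : R ∈ S.L qr) : R ∈ S.L c := by
  have tri : ∀ {x y z k : ℂ × ℂ}, k ∈ S.V → x ∈ S.L k → y ∈ S.L k → z ∈ S.L k →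
      S.Collinear {x, y, z} := by
    intro x y z k hk h1 h2 h3
    refine ⟨k, hk, ?_⟩
    rintro w (rfl | rfl | rfl) <;> assumption
  have two : ∀ {x y k : ℂ × ℂ}, k ∈ S.V → x ∈ S.L k → y ∈ S.L k → S.Collinear {x, y} := by
    intro x y k hk h1 h2
    refine ⟨k, hk, ?_⟩
    rintro w (rfl | rfl) <;> assumption
  have nocol : ∀ {x y k : ℂ × ℂ}, k ∈ S.V → S.O ∈ S.L k → x ∈ S.L k → x ≠ S.O → y ∉ S.L k →
      ¬ S.Collinear {S.O, x, y} := by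
    rintro x y k hk h1 h2 h3 h4 ⟨k', hk', hsub⟩
    have := hS S.O x h3.symm k hk k' hk' h1 h2 (hsub (by simp)) (hsub (by simp))
    exact h4 (this ▸ hsub (by simp))
  have hab_ne : a ≠ b := fun h => hBa (h ▸ hBb)
  have had_ne : a ≠ d := fun h => hCa (h ▸ hCd)
  have hbd_ne : b ≠ d := fun h => hCb (h ▸ hCd)
  have key : ∀ {x y k m : ℂ × ℂ}, k ∈ S.V → m ∈ S.V → k ≠ m → S.O ∈ S.L k → S.O ∈ S.L m →
      x ∈ S.L k → y ∈ S.L m → x ≠ S.O → x ≠ y := by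
    rintro x y k m hk hm hkm h1 h2 h3 h4 h5 rfl
    exact hkm (hS S.O x h5.symm k hk m hm h1 h3 h2 h4)
  obtain ⟨k, hk, hsub⟩ := hD A B C A' B' C' P Q R
    { distinct := by
        simp only [List.nodup_cons, List.mem_cons, List.not_mem_nil, or_false, not_or,
          List.nodup_nil, and_true, not_false_eq_true]
        exact ⟨⟨hA.symm, hB.symm, hC.symm, hA'.symm, hB'.symm, hC'.symm⟩,
          ⟨key ha hb hab_ne hOa hOb hAa hBb hA, key ha hd had_ne hOa hOd hAa hCd hA, hAA',
            key ha hb hab_ne hOa hOb hAa hB'b hA, key ha hd had_ne hOa hOd hAa hC'd hA⟩,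
          ⟨key hb hd hbd_ne hOb hOd hBb hCd hB, key hb ha hab_ne.symm hOb hOa hBb hA'a hB, hBB',
            key hb hd hbd_ne hOb hOd hBb hC'd hB⟩,
          ⟨key hd ha had_ne.symm hOd hOa hCd hA'a hC, key hd hb hbd_ne.symm hOd hOb hCd hB'b hC,
            hCC'⟩,
          ⟨key ha hb hab_ne hOa hOb hA'a hB'b hA', key ha hd had_ne hOa hOd hA'a hC'd hA'⟩,
          key hb hd hbd_ne hOb hOd hB'b hC'd hB'⟩
      lineA := tri ha hOa hAa hA'a
      lineB := tri hb hOb hBb hB'b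
      lineC := tri hd hOd hCd hC'd
      lineA_ne_lineB := nocol ha hOa hAa hA hBa
      lineA_ne_lineC := nocol ha hOa hAa hA hCa
      lineB_ne_lineC := nocol hb hOb hBb hB hCb
      P_mem := ⟨tri hab hAab hBab hPab, tri hab' hA'ab hB'ab hP'ab⟩
      Q_mem := ⟨tri had hAad hCad hQad, tri had' hA'ad hC'ad hQ'ad⟩
      R_mem := ⟨tri hbd hBbd hCbd hRbd, tri hbd' hB'bd hC'bd hR'bd⟩
      linePQ := two hc hP hQ
      linePR := two hpr hPpr hRpr
      lineQR := two hqr hQqr hRqr }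
  -- The curve supplied by Desargues and the given `L c` share the two distinct points P and Q, so
  -- they coincide.
  have := hS P Q hPQ c hc k hk hP hQ (hsub (by simp)) (hsub (by simp))
  exact this ▸ hsub (by simp)

/-! ### Construction of the elation. -/

namespace LineModel

/-- The point with abscissa `r` on the model line through the origin of slope `m`. -/
def pt (M : S.LineModel c₁) (m ε r : ℂ) : ℂ × ℂ := (r, M.Ψ (ε, r, 0, m))

theorem inc_pt (M : S.LineModel c₁) (m ε r : ℂ) : M.Inc ε (M.pt m ε r) (0, m) := rfl

theorem pt_zero (M : S.LineModel c₁) (m r : ℂ) : M.pt m 0 r = (r, r * m) := by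
  simp [pt, M.Ψ_zero]

theorem analyticAt_pt (M : S.LineModel c₁) (m r : ℂ) :
    AnalyticAt ℂ (fun y : ℂ × ℂ => M.pt m y.1 y.2) (0, r) := by
  have : AnalyticAt ℂ (fun y : ℂ × ℂ => M.Ψ (y.1, y.2, 0, m)) (0, r) :=
    AnalyticAt.comp (g := M.Ψ) (f := fun y : ℂ × ℂ => (y.1, y.2, (0 : ℂ), m)) (M.analyticAt _)
      (by fun_prop)
  exact analyticAt_snd.prod this

/-- The image `D'` of the auxiliary point `D`, constructed from `A` and its image `A'` of
abscissa `r`; all functions depend on `y = (ε, r)`. -/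
structure Auxiliary (M : S.LineModel c₁) where
  T : ℂ × ℂ → ℂ × ℂ
  lT : ℂ × ℂ → ℂ × ℂ
  lT' : ℂ × ℂ → ℂ × ℂ
  D' : ℂ × ℂ → ℂ × ℂ
  T_an : AnalyticAt ℂ T (0, 2)
  lT_an : AnalyticAt ℂ lT (0, 2)
  lT'_an : AnalyticAt ℂ lT' (0, 2)
  D'_an : AnalyticAt ℂ D' (0, 2)
  T_val : T (0, 2) = (4 / 3, 0)
  lT_val : lT (0, 2) = (4, -3)
  lT'_val : lT' (0, 2) = (-4, 3)
  D'_val : D' (0, 2) = (1, -1)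
  inc : ∀ᶠ y in 𝓝 ((0 : ℂ), (2 : ℂ)),
    (M.Inc y.1 (M.pt 1 y.1 1) (lT y) ∧ M.Inc y.1 (M.pt (-1) y.1 2) (lT y) ∧
      M.Inc y.1 (T y) (lT y)) ∧ M.Inc y.1 (T y) 0 ∧
    (M.Inc y.1 (M.pt 1 y.1 y.2) (lT' y) ∧ M.Inc y.1 (T y) (lT' y) ∧ M.Inc y.1 (D' y) (lT' y)) ∧
    M.Inc y.1 (D' y) (0, -1)

theorem nonempty_auxiliary (M : S.LineModel c₁) : Nonempty M.Auxiliary := by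
  have hA : AnalyticAt ℂ (fun y : ℂ × ℂ => M.pt 1 y.1 1) (0, 2) :=
    AnalyticAt.comp (g := fun y : ℂ × ℂ => M.pt 1 y.1 y.2) (f := fun y : ℂ × ℂ => (y.1, (1 : ℂ)))
      (M.analyticAt_pt 1 1) (by fun_prop)
  have hD : AnalyticAt ℂ (fun y : ℂ × ℂ => M.pt (-1) y.1 2) (0, 2) :=
    AnalyticAt.comp (g := fun y : ℂ × ℂ => M.pt (-1) y.1 y.2) (f := fun y : ℂ × ℂ => (y.1, (2 : ℂ)))
      (M.analyticAt_pt (-1) 2) (by fun_prop)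
  have hA' := M.analyticAt_pt 1 2
  -- The values refer to ε = 0, r = 2: A = (1, 1) and D = (2, -2) span w = 4 - 3z, which meets the
  -- axis at T = (4/3, 0); A' = (2, 2) and T span w = -4 + 3z, which meets w = -z at D' = (1, -1).
  obtain ⟨lT, h1, h1v, h1i⟩ := M.join_analytic (e := Prod.fst) (l := (4, -3)) analyticAt_fst rfl hA hD
    (by rw [M.inc_zero, M.pt_zero]; norm_num) (by rw [M.inc_zero, M.pt_zero]; norm_num)
    (by simp only [pt]; norm_num)
  obtain ⟨T, h2, h2v, h2i⟩ := M.meet_analytic (e := Prod.fst) (l := lT) (k := fun _ => 0)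
    (p := (4 / 3, 0)) analyticAt_fst rfl h1 analyticAt_const
    (by rw [M.inc_zero, h1v]; norm_num) (by rw [M.inc_zero]; norm_num)
    (by rw [h1v]; norm_num)
  obtain ⟨lT', h3, h3v, h3i⟩ := M.join_analytic (e := Prod.fst) (l := (-4, 3)) analyticAt_fst rfl hA' h2
    (by rw [M.inc_zero, M.pt_zero]; norm_num) (by rw [M.inc_zero, h2v]; norm_num)
    (by rw [h2v]; simp only [pt]; norm_num)
  obtain ⟨D', h4, h4v, h4i⟩ := M.meet_analytic (e := Prod.fst) (l := lT') (k := fun _ => (0, -1))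
    (p := (1, -1)) analyticAt_fst rfl h3 analyticAt_const
    (by rw [M.inc_zero, h3v]; norm_num) (by rw [M.inc_zero]; norm_num)
    (by rw [h3v]; norm_num)
  refine ⟨⟨T, lT, lT', D', h2, h1, h3, h4, h2v, h1v, h3v, h4v, ?_⟩⟩
  filter_upwards [h1i, h2i, h3i, h4i] with y i1 i2 i3 i4
  exact ⟨⟨i1.1, i1.2, i2.1⟩, i2.2, ⟨i3.1, i3.2, i4.1⟩, i4.2⟩

/-- The map `φ (ε, r, p) = A'P ∩ D'Q`, where `P` and `Q` are the projections of `p` from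
`A` and `D` to the axis `l = 0`; all functions depend on `x = (ε, r, p)`. -/
structure Elation (M : S.LineModel c₁) extends M.Auxiliary where
  lA : ℂ × ℂ × ℂ × ℂ → ℂ × ℂ
  P : ℂ × ℂ × ℂ × ℂ → ℂ × ℂ
  lA' : ℂ × ℂ × ℂ × ℂ → ℂ × ℂ
  lD : ℂ × ℂ × ℂ × ℂ → ℂ × ℂ
  Q : ℂ × ℂ × ℂ × ℂ → ℂ × ℂ
  lD' : ℂ × ℂ × ℂ × ℂ → ℂ × ℂ
  φ : ℂ × ℂ × ℂ × ℂ → ℂ × ℂ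
  lA_an : AnalyticAt ℂ lA (0, 2, 0)
  P_an : AnalyticAt ℂ P (0, 2, 0)
  lA'_an : AnalyticAt ℂ lA' (0, 2, 0)
  lD_an : AnalyticAt ℂ lD (0, 2, 0)
  Q_an : AnalyticAt ℂ Q (0, 2, 0)
  lD'_an : AnalyticAt ℂ lD' (0, 2, 0)
  φ_an : AnalyticAt ℂ φ (0, 2, 0)
  lA_val : lA (0, 2, 0) = (0, 1)
  P_val : P (0, 2, 0) = 0
  lA'_val : lA' (0, 2, 0) = (0, 1)
  lD_val : lD (0, 2, 0) = (0, -1)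
  Q_val : Q (0, 2, 0) = 0
  lD'_val : lD' (0, 2, 0) = (0, -1)
  φ_val : φ (0, 2, 0) = 0
  incA : ∀ᶠ x in 𝓝 ((0 : ℂ), (2 : ℂ), (0 : ℂ × ℂ)),
    (M.Inc x.1 (M.pt 1 x.1 1) (lA x) ∧ M.Inc x.1 x.2.2 (lA x) ∧ M.Inc x.1 (P x) (lA x)) ∧
    M.Inc x.1 (P x) 0 ∧
    (M.Inc x.1 (M.pt 1 x.1 x.2.1) (lA' x) ∧ M.Inc x.1 (P x) (lA' x) ∧ M.Inc x.1 (φ x) (lA' x))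
  incD : ∀ᶠ x in 𝓝 ((0 : ℂ), (2 : ℂ), (0 : ℂ × ℂ)),
    (M.Inc x.1 (M.pt (-1) x.1 2) (lD x) ∧ M.Inc x.1 x.2.2 (lD x) ∧ M.Inc x.1 (Q x) (lD x)) ∧
    M.Inc x.1 (Q x) 0 ∧
    (M.Inc x.1 (D' (x.1, x.2.1)) (lD' x) ∧ M.Inc x.1 (Q x) (lD' x) ∧ M.Inc x.1 (φ x) (lD' x))

/-- As p tends to O, the four lines through P and Q tend to the lines of slopes 1 and -1 through O,
while the axis has slope 0. All joins and meets thus stay transversal at p = O. -/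
theorem nonempty_elation (M : S.LineModel c₁) : Nonempty M.Elation := by
  obtain ⟨N⟩ := M.nonempty_auxiliary
  let x₀ : ℂ × ℂ × ℂ × ℂ := (0, 2, 0)
  have hA : AnalyticAt ℂ (fun x : ℂ × ℂ × ℂ × ℂ => M.pt 1 x.1 1) x₀ :=
    AnalyticAt.comp (g := fun y : ℂ × ℂ => M.pt 1 y.1 y.2)
      (f := fun x : ℂ × ℂ × ℂ × ℂ => (x.1, (1 : ℂ))) (M.analyticAt_pt 1 1) (by fun_prop)
  have hA' : AnalyticAt ℂ (fun x : ℂ × ℂ × ℂ × ℂ => M.pt 1 x.1 x.2.1) x₀ :=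
    AnalyticAt.comp (g := fun y : ℂ × ℂ => M.pt 1 y.1 y.2)
      (f := fun x : ℂ × ℂ × ℂ × ℂ => (x.1, x.2.1)) (M.analyticAt_pt 1 2) (by fun_prop)
  have hD : AnalyticAt ℂ (fun x : ℂ × ℂ × ℂ × ℂ => M.pt (-1) x.1 2) x₀ :=
    AnalyticAt.comp (g := fun y : ℂ × ℂ => M.pt (-1) y.1 y.2)
      (f := fun x : ℂ × ℂ × ℂ × ℂ => (x.1, (2 : ℂ))) (M.analyticAt_pt (-1) 2) (by fun_prop)
  have hD' : AnalyticAt ℂ (fun x : ℂ × ℂ × ℂ × ℂ => N.D' (x.1, x.2.1)) x₀ :=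
    AnalyticAt.comp (g := N.D') (f := fun x : ℂ × ℂ × ℂ × ℂ => (x.1, x.2.1)) N.D'_an (by fun_prop)
  have he : AnalyticAt ℂ (fun x : ℂ × ℂ × ℂ × ℂ => x.1) x₀ := by fun_prop
  have hp : AnalyticAt ℂ (fun x : ℂ × ℂ × ℂ × ℂ => x.2.2) x₀ := by fun_prop
  obtain ⟨lA, h1, h1v, h1i⟩ := M.join_analytic (l := (0, 1)) he rfl hA hp
    (by simp only [x₀]; rw [M.inc_zero, M.pt_zero]; norm_num)
    (by simp only [x₀]; rw [M.inc_zero]; norm_num) (by simp only [pt, x₀]; norm_num)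
  obtain ⟨P, h2, h2v, h2i⟩ := M.meet_analytic (l := lA) (k := fun _ => 0)
    (p := 0) he rfl h1 analyticAt_const
    (by rw [M.inc_zero, h1v]; norm_num) (by rw [M.inc_zero]; norm_num)
    (by rw [h1v]; norm_num)
  obtain ⟨lA', h3, h3v, h3i⟩ := M.join_analytic (l := (0, 1)) he rfl hA' h2
    (by simp only [x₀]; rw [M.inc_zero, M.pt_zero]; norm_num) (by rw [M.inc_zero, h2v]; norm_num)
    (by rw [h2v]; simp only [pt, x₀]; norm_num)
  obtain ⟨lD, k1, k1v, k1i⟩ := M.join_analytic (l := (0, -1)) he rfl hD hp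
    (by simp only [x₀]; rw [M.inc_zero, M.pt_zero]; norm_num)
    (by simp only [x₀]; rw [M.inc_zero]; norm_num) (by simp only [pt, x₀]; norm_num)
  obtain ⟨Q, k2, k2v, k2i⟩ := M.meet_analytic (l := lD) (k := fun _ => 0)
    (p := 0) he rfl k1 analyticAt_const
    (by rw [M.inc_zero, k1v]; norm_num) (by rw [M.inc_zero]; norm_num)
    (by rw [k1v]; norm_num)
  obtain ⟨lD', k3, k3v, k3i⟩ := M.join_analytic (l := (0, -1)) he rfl hD' k2
    (by simp only [x₀]; rw [M.inc_zero, N.D'_val]; norm_num) (by rw [M.inc_zero, k2v]; norm_num)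
    (by rw [k2v]; simp only [x₀]; rw [N.D'_val]; norm_num)
  obtain ⟨φ, h4, h4v, h4i⟩ := M.meet_analytic (l := lA') (k := lD')
    (p := 0) he rfl h3 k3
    (by rw [M.inc_zero, h3v]; norm_num) (by rw [M.inc_zero, k3v]; norm_num)
    (by rw [h3v, k3v]; norm_num)
  refine ⟨{ N with
    lA := lA, P := P, lA' := lA', lD := lD, Q := Q, lD' := lD', φ := φ, lA_an := h1, P_an := h2,
    lA'_an := h3, lD_an := k1, Q_an := k2, lD'_an := k3, φ_an := h4, lA_val := h1v, P_val := h2v,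
    lA'_val := h3v, lD_val := k1v, Q_val := k2v, lD'_val := k3v, φ_val := h4v, incA := ?_,
    incD := ?_ }⟩
  · filter_upwards [h1i, h2i, h3i, h4i] with y i1 i2 i3 i4
    exact ⟨⟨i1.1, i1.2, i2.1⟩, i2.2, i3.1, i3.2, i4.1⟩
  · filter_upwards [k1i, k2i, k3i, h4i] with y i1 i2 i3 i4
    exact ⟨⟨i1.1, i1.2, i2.1⟩, i2.2, i3.1, i3.2, i4.2⟩

theorem tendsto_slice (p : ℂ × ℂ) :
    Filter.Tendsto (fun p : ℂ × ℂ => ((0 : ℂ), (2 : ℂ), p)) (𝓝 p) (𝓝 (0, 2, p)) :=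
  (by fun_prop : Continuous fun p : ℂ × ℂ => ((0 : ℂ), (2 : ℂ), p)).tendsto p

/-- The explicit form of the construction for straight lines and `r = 2`. -/
theorem Elation.formula {M : S.LineModel c₁} (Λ : M.Elation) : ∀ᶠ p : ℂ × ℂ in 𝓝 0,
    (Λ.P (0, 2, p)).2 = 0 ∧ (Λ.P (0, 2, p)).1 * (1 - p.2) = p.1 - p.2 ∧
    (Λ.Q (0, 2, p)).2 = 0 ∧ (Λ.Q (0, 2, p)).1 * (2 + p.2) = 2 * (p.1 + p.2) ∧
    (Λ.φ (0, 2, p)).1 * (2 - p.2) = 2 * p.1 ∧ (Λ.φ (0, 2, p)).2 * (2 - p.2) = 2 * p.2 := by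
  have h1 : ∀ᶠ p : ℂ × ℂ in 𝓝 0, 1 - p.2 ≠ 0 :=
    (by fun_prop : ContinuousAt (fun p : ℂ × ℂ => 1 - p.2) 0).eventually_ne (by norm_num)
  -- This excludes the line AD, on which P = Q = T and A'P = D'Q. The linear system for φ(p), with
  -- the denominators of P and Q cleared, has determinant a multiple of (2 - w)(4 - 3z - w).
  have h2 : ∀ᶠ p : ℂ × ℂ in 𝓝 0, 4 - 3 * p.1 - p.2 ≠ 0 :=
    (by fun_prop : ContinuousAt (fun p : ℂ × ℂ => 4 - 3 * p.1 - p.2) 0).eventually_ne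
      (by norm_num)
  filter_upwards [(tendsto_slice 0).eventually Λ.incA, (tendsto_slice 0).eventually Λ.incD, h1, h2]
    with p hA hD h1 h2
  simp only [M.inc_zero, M.pt_zero, Λ.D'_val, Prod.fst_zero, Prod.snd_zero] at hA hD
  obtain ⟨⟨a1, a2, a3⟩, a4, a5, a6, a7⟩ := hA
  obtain ⟨⟨d1, d2, d3⟩, d4, d5, d6, d7⟩ := hD
  set P := Λ.P (0, 2, p)
  set Q := Λ.Q (0, 2, p)
  set φ := Λ.φ (0, 2, p)
  obtain ⟨z, w⟩ := p
  simp only at *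
  have hP2 : P.2 = 0 := by rw [a4]; ring
  have hQ2 : Q.2 = 0 := by rw [d4]; ring
  rw [hP2] at a3 a6
  rw [hQ2] at d3 d6
  set lA := Λ.lA (0, 2, z, w)
  set lA' := Λ.lA' (0, 2, z, w)
  set lD := Λ.lD (0, 2, z, w)
  set lD' := Λ.lD' (0, 2, z, w)
  have hm : lA.2 * (1 - z) = 1 - w := by linear_combination a2 - a1
  have hm' : lA.2 * (1 - P.1) = 1 := by linear_combination a3 - a1
  have hk : lD.2 * (2 - z) = -2 - w := by linear_combination d2 - d1
  have hk' : lD.2 * (2 - Q.1) = -2 := by linear_combination d3 - d1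
  have hP : P.1 * (1 - w) = z - w := by linear_combination (1 - P.1) * hm - (1 - z) * hm'
  have hQ : Q.1 * (2 + w) = 2 * (z + w) := by
    linear_combination (2 - z) * hk' - (2 - Q.1) * hk
  have E1 : φ.2 * (2 - P.1) = 2 * φ.1 - 2 * P.1 := by
    linear_combination (2 - P.1) * (a7 - a6) + (φ.1 - P.1) * (a6 - a5)
  have E2 : φ.2 * (1 - Q.1) = -φ.1 + Q.1 := by
    linear_combination (1 - Q.1) * (d7 - d6) + (φ.1 - Q.1) * (d6 - d5)
  have F1 : φ.2 * (2 - w - z) = 2 * φ.1 * (1 - w) - 2 * (z - w) := by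
    linear_combination (1 - w) * E1 + (φ.2 - 2) * hP
  have F2 : φ.2 * (2 - w - 2 * z) = -φ.1 * (2 + w) + 2 * (z + w) := by
    linear_combination (2 + w) * E2 + (φ.2 + 1) * hQ
  have hφ2 : φ.2 * (2 - w) = 2 * w := by
    apply mul_left_cancel₀ h2
    linear_combination (2 + w) * F1 + 2 * (1 - w) * F2
  refine ⟨hP2, hP, hQ2, hQ, ?_, hφ2⟩
  apply mul_left_cancel₀ (mul_ne_zero two_ne_zero h1)
  linear_combination -(2 - w) * F1 + (2 - w - z) * hφ2

end LineModel

end TransverseFamily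

/-! ### Invariance of the curves through O, and the fixed axis. -/

/-- The identity theorem with parameters. -/
theorem AnalyticAt.eventually_eq_zero_of_frequently {E F : Type*} [NormedAddCommGroup E]
    [NormedSpace ℂ E] [NormedAddCommGroup F] [NormedSpace ℂ F] {H : E × F → ℂ} {a : E}
    (hH : AnalyticAt ℂ H (a, 0)) {P : E → Prop}
    (hgen : ∃ᶠ y₀ in 𝓝 (0 : F), ∀ᶠ x in 𝓝 (a, y₀), P x.1 → H x = 0) :
    ∀ᶠ x in 𝓝 (a, (0 : F)), P x.1 → H x = 0 := by
  -- The radius δ is fixed before y₀ is chosen. The neighbourhood of (a, y₀) where H is known to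
  -- vanish may shrink with y₀; only its projection to x limits the result, and in y the identity
  -- theorem fills the whole ball.
  obtain ⟨δ, hδ, hball⟩ := Metric.eventually_nhds_iff_ball.mp hH.eventually_analyticAt
  obtain ⟨y₀, hy₀, hy₀δ⟩ := (hgen.and_eventually (Metric.ball_mem_nhds (0 : F) hδ)).exists
  have h1 : ∀ᶠ x in 𝓝 a, ∀ᶠ y in 𝓝 y₀, P x → H (x, y) = 0 := hy₀.curry_nhds
  rw [nhds_prod_eq]
  filter_upwards [(h1.and (Metric.ball_mem_nhds a hδ)).prod_mk
    (Metric.ball_mem_nhds (0 : F) hδ)] with x ⟨⟨hx1, hx2⟩, hx3⟩ hP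
  have han : AnalyticOnNhd ℂ (fun y => H (x.1, y)) (Metric.ball (0 : F) δ) := by
    intro y hy
    refine AnalyticAt.comp (g := H) (f := fun y => (x.1, y)) (hball _ ?_)
      (analyticAt_const.prod analyticAt_id)
    rw [← ball_prod_same]
    exact ⟨hx2, hy⟩
  exact han.eqOn_zero_of_preconnected_of_eventuallyEq_zero
    (convex_ball (0 : F) δ).isPreconnected hy₀δ (hx1.mono fun y hy => hy hP) hx3

namespace TransverseFamily

variable {S : TransverseFamily} {c₁ : ℂ × ℂ}

/-- The point x witnesses that the two curves differ, so they share at most one point. Different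
constructions of the same intersection are identified in this way. -/
theorem TwoPointUnique.eq_point (hS : S.TwoPointUnique) {p q x k m : ℂ × ℂ} (hk : k ∈ S.V)
    (hm : m ∈ S.V) (hpk : p ∈ S.L k) (hpm : p ∈ S.L m) (hqk : q ∈ S.L k) (hqm : q ∈ S.L m)
    (hxk : x ∈ S.L k) (hxm : x ∉ S.L m) : p = q := by
  by_contra h
  exact hxm (hS p q h k hk m hm hpk hqk hpm hqm ▸ hxk)

namespace LineModel

theorem germ_mem (M : S.LineModel c₁) {X : Type*} {f : Filter X} {e : X → ℂ} {p l : X → ℂ × ℂ}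
    {p₀ l₀ : ℂ × ℂ} (he : Filter.Tendsto e f (𝓝[≠] 0)) (hp : Filter.Tendsto p f (𝓝 p₀))
    (hl : Filter.Tendsto l f (𝓝 l₀)) (h : ∀ᶠ x in f, M.Inc (e x) (p x) (l x)) :
    ∀ᶠ x in f, M.On (e x) (p x) (l x) := by
  filter_upwards [M.germ_on he hp hl, h] with x hx hx'
  exact hx.2.2.mpr hx'

/-- Desargues' theorem for germs of configurations. -/
theorem germ_desargues (M : S.LineModel c₁) (hS : S.TwoPointUnique) (hD : S.HasDesargues)
    {X : Type*} {f : Filter X} {e : X → ℂ} (he : Filter.Tendsto e f (𝓝[≠] 0))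
    {A B C A' B' C' P Q a b d ab ab' ad ad' bd bd' : X → ℂ × ℂ}
    {A₀ B₀ C₀ A₀' B₀' C₀' P₀ Q₀ R₀ a₀ b₀ d₀ ab₀ ab₀' ad₀ ad₀' bd₀ bd₀' : ℂ × ℂ}
    (tA : Filter.Tendsto A f (𝓝 A₀)) (tB : Filter.Tendsto B f (𝓝 B₀))
    (tC : Filter.Tendsto C f (𝓝 C₀)) (tA' : Filter.Tendsto A' f (𝓝 A₀'))
    (tB' : Filter.Tendsto B' f (𝓝 B₀')) (tC' : Filter.Tendsto C' f (𝓝 C₀'))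
    (tP : Filter.Tendsto P f (𝓝 P₀)) (tQ : Filter.Tendsto Q f (𝓝 Q₀))
    (ta : Filter.Tendsto a f (𝓝 a₀)) (tb : Filter.Tendsto b f (𝓝 b₀))
    (td : Filter.Tendsto d f (𝓝 d₀)) (tab : Filter.Tendsto ab f (𝓝 ab₀))
    (tab' : Filter.Tendsto ab' f (𝓝 ab₀')) (tad : Filter.Tendsto ad f (𝓝 ad₀))
    (tad' : Filter.Tendsto ad' f (𝓝 ad₀')) (tbd : Filter.Tendsto bd f (𝓝 bd₀))
    (tbd' : Filter.Tendsto bd' f (𝓝 bd₀'))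
    (ia : ∀ᶠ x in f, M.Inc (e x) 0 (a x) ∧ M.Inc (e x) (A x) (a x) ∧ M.Inc (e x) (A' x) (a x))
    (ib : ∀ᶠ x in f, M.Inc (e x) 0 (b x) ∧ M.Inc (e x) (B x) (b x) ∧ M.Inc (e x) (B' x) (b x))
    (id : ∀ᶠ x in f, M.Inc (e x) 0 (d x) ∧ M.Inc (e x) (C x) (d x) ∧ M.Inc (e x) (C' x) (d x))
    (iab : ∀ᶠ x in f,
      M.Inc (e x) (A x) (ab x) ∧ M.Inc (e x) (B x) (ab x) ∧ M.Inc (e x) (P x) (ab x))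
    (iab' : ∀ᶠ x in f,
      M.Inc (e x) (A' x) (ab' x) ∧ M.Inc (e x) (B' x) (ab' x) ∧ M.Inc (e x) (P x) (ab' x))
    (iad : ∀ᶠ x in f,
      M.Inc (e x) (A x) (ad x) ∧ M.Inc (e x) (C x) (ad x) ∧ M.Inc (e x) (Q x) (ad x))
    (iad' : ∀ᶠ x in f,
      M.Inc (e x) (A' x) (ad' x) ∧ M.Inc (e x) (C' x) (ad' x) ∧ M.Inc (e x) (Q x) (ad' x))
    (ibd : ∀ᶠ x in f, M.Inc (e x) (B x) (bd x) ∧ M.Inc (e x) (C x) (bd x))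
    (ibd' : ∀ᶠ x in f, M.Inc (e x) (B' x) (bd' x) ∧ M.Inc (e x) (C' x) (bd' x))
    (iPQ : ∀ᶠ x in f, M.Inc (e x) (P x) 0 ∧ M.Inc (e x) (Q x) 0)
    (nA : A₀ ≠ 0) (nA' : A₀' ≠ 0) (nAA' : A₀ ≠ A₀') (nB : B₀ ≠ 0) (nB' : B₀' ≠ 0)
    (nBB' : B₀ ≠ B₀') (nC : C₀ ≠ 0) (nC' : C₀' ≠ 0) (nCC' : C₀ ≠ C₀')
    (nBa : ¬ M.Inc 0 B₀ a₀) (nCa : ¬ M.Inc 0 C₀ a₀) (nCb : ¬ M.Inc 0 C₀ b₀)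
    (iR : M.Inc 0 R₀ bd₀) (iR' : M.Inc 0 R₀ bd₀') (nbd : bd₀.2 ≠ bd₀'.2)
    (P2 : P₀.2 = 0) (Q2 : Q₀.2 = 0) (R2 : R₀.2 = 0)
    (nPQ : P₀.1 ≠ Q₀.1) (nPR : P₀.1 ≠ R₀.1) (nQR : Q₀.1 ≠ R₀.1) :
    ∃ R : X → ℂ × ℂ, Filter.Tendsto R f (𝓝 R₀) ∧
      ∀ᶠ x in f, M.Inc (e x) (R x) (bd x) ∧ M.Inc (e x) (R x) (bd' x) ∧ M.Inc (e x) (R x) 0 := by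
  have axis : ∀ {p : ℂ × ℂ}, p.2 = 0 → M.Inc 0 p 0 := fun {p} hp => by
    rw [M.inc_zero, hp]; simp
  -- Admissibility requires the curves PR and QR before anything is known about R. They exist
  -- because P, Q, R have limits on the axis with pairwise different abscissas.
  obtain ⟨R, tR, hR⟩ := M.germ_meet he tbd tbd' iR iR' nbd
  obtain ⟨pr, tpr, hpr⟩ := M.germ_join he tP tR (axis P2) (axis R2) nPR
  obtain ⟨qr, tqr, hqr⟩ := M.germ_join he tQ tR (axis Q2) (axis R2) nQR
  have t0 : Filter.Tendsto (fun _ : X => (0 : ℂ × ℂ)) f (𝓝 0) := tendsto_const_nhds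
  refine ⟨R, tR, ?_⟩
  have mem : ∀ {p l : X → ℂ × ℂ} {p₀ l₀ : ℂ × ℂ}, Filter.Tendsto p f (𝓝 p₀) →
      Filter.Tendsto l f (𝓝 l₀) → (∀ᶠ x in f, M.Inc (e x) (p x) (l x)) →
      ∀ᶠ x in f, M.On (e x) (p x) (l x) := fun hp hl h => M.germ_mem he hp hl h
  have par : ∀ {l : X → ℂ × ℂ} {l₀ : ℂ × ℂ}, Filter.Tendsto l f (𝓝 l₀) →
      ∀ᶠ x in f, M.κ (e x) (l x) ∈ S.V := fun hl => (M.germ_on he t0 hl).mono fun x hx => hx.2.1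
  have g : ∀ {p q : X → Prop}, (∀ᶠ x in f, p x ∧ q x) → ∀ᶠ x in f, p x :=
    fun h => h.mono fun x hx => hx.1
  have g' : ∀ {p q : X → Prop}, (∀ᶠ x in f, p x ∧ q x) → ∀ᶠ x in f, q x :=
    fun h => h.mono fun x hx => hx.2
  filter_upwards [hR, M.germ_on he tR t0, par t0, mem tP t0 (g iPQ), mem tQ t0 (g' iPQ),
    M.germ_ne he tP tQ (fun h => nPQ (congrArg Prod.fst h)),
    par ta, mem t0 ta (g ia), mem tA ta (g (g' ia)), mem tA' ta (g' (g' ia)),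
    par tb, mem t0 tb (g ib), mem tB tb (g (g' ib)), mem tB' tb (g' (g' ib)),
    par td, mem t0 td (g id), mem tC td (g (g' id)), mem tC' td (g' (g' id)),
    M.germ_ne he tA t0 nA, M.germ_ne he tA' t0 nA', M.germ_ne he tA tA' nAA',
    M.germ_ne he tB t0 nB, M.germ_ne he tB' t0 nB', M.germ_ne he tB tB' nBB',
    M.germ_ne he tC t0 nC, M.germ_ne he tC' t0 nC', M.germ_ne he tC tC' nCC',
    M.germ_not_on he tB ta nBa, M.germ_not_on he tC ta nCa, M.germ_not_on he tC tb nCb,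
    par tab, mem tA tab (g iab), mem tB tab (g (g' iab)), mem tP tab (g' (g' iab)),
    par tab', mem tA' tab' (g iab'), mem tB' tab' (g (g' iab')), mem tP tab' (g' (g' iab')),
    par tad, mem tA tad (g iad), mem tC tad (g (g' iad)), mem tQ tad (g' (g' iad)),
    par tad', mem tA' tad' (g iad'), mem tC' tad' (g (g' iad')), mem tQ tad' (g' (g' iad')),
    par tbd, mem tB tbd (g ibd), mem tC tbd (g' ibd), mem tR tbd (g hR),
    par tbd', mem tB' tbd' (g ibd'), mem tC' tbd' (g' ibd'), mem tR tbd' (g' hR),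
    par tpr, mem tP tpr (g hpr), mem tR tpr (g' hpr),
    par tqr, mem tQ tqr (g hqr), mem tR tqr (g' hqr)]
    with x hRx hR0 v0 mP mQ nPQ va mOa mA mA' vb mOb mB mB' vd mOd mC mC' nA nA' nAA' nB nB' nBB'
      nC nC' nCC' nBa nCa nCb vab mab1 mab2 mab3 vab' mab1' mab2' mab3' vad mad1 mad2 mad3
      vad' mad1' mad2' mad3' vbd mbd1 mbd2 mbd3 vbd' mbd1' mbd2' mbd3' vpr mpr1 mpr2
      vqr mqr1 mqr2
  rw [On, M.θ_zero] at mOa mOb mOd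
  rw [M.θ_zero] at nA nA' nB nB' nC nC'
  refine ⟨hRx.1, hRx.2, hR0.2.2.mp ?_⟩
  exact hD.third_mem hS v0 mP mQ nPQ va mOa mA mA' vb mOb mB mB' vd mOd mC mC' nA nA' nAA' nB nB'
    nBB' nC nC' nCC' nBa nCa nCb vab mab1 mab2 mab3 vab' mab1' mab2' mab3' vad mad1 mad2 mad3
    vad' mad1' mad2' mad3' vbd mbd1 mbd2 mbd3 vbd' mbd1' mbd2' mbd3' vpr mpr1 mpr2 vqr mqr1 mqr2

theorem analyticAt_pt₃ (M : S.LineModel c₁) (r m : ℂ) :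
    AnalyticAt ℂ (fun y : ℂ × ℂ × ℂ => M.pt y.2.2 y.1 y.2.1) (0, r, m) := by
  have : AnalyticAt ℂ (fun y : ℂ × ℂ × ℂ => M.Ψ (y.1, y.2.1, 0, y.2.2)) (0, r, m) :=
    AnalyticAt.comp (g := M.Ψ) (f := fun y : ℂ × ℂ × ℂ => (y.1, y.2.1, (0 : ℂ), y.2.2))
      (M.analyticAt _) (by fun_prop)
  exact (analyticAt_fst.comp analyticAt_snd).prod this

theorem tendsto_param {F : Type*} [TopologicalSpace F] (y : F) :
    Filter.Tendsto (fun x : (ℂ × ℂ) × F => x.1.1)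
      (𝓝[{x | x.1.1 ≠ 0}] (((0 : ℂ), (2 : ℂ)), y)) (𝓝[≠] 0) := by
  refine tendsto_nhdsWithin_iff.mpr ⟨?_, self_mem_nhdsWithin⟩
  have : Continuous (fun x : (ℂ × ℂ) × F => x.1.1) := by fun_prop
  exact (this.tendsto (((0 : ℂ), (2 : ℂ)), y)).mono_left nhdsWithin_le_nhds

theorem inc_axis_zero (M : S.LineModel c₁) {p : ℂ × ℂ} : M.Inc 0 p 0 ↔ p.2 = 0 := by
  rw [M.inc_zero]; simp

theorem germ_origin (M : S.LineModel c₁) {X : Type*} {f : Filter X} {e m : X → ℂ} {m₀ : ℂ}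
    (he : Filter.Tendsto e f (𝓝[≠] 0)) (hm : Filter.Tendsto m f (𝓝 m₀)) :
    ∀ᶠ x in f, M.Inc (e x) 0 (0, m x) := by
  have h := (he.mono_right nhdsWithin_le_nhds).prodMk_nhds
    ((tendsto_const_nhds (x := (0 : ℂ)) (f := f)).prodMk_nhds hm)
  filter_upwards [h.eventually (M.Ψ_left (0, m₀))] with x hx
  exact hx.symm

/-- Let B be a point of a curve through O and put B' = A'P ∩ OB. Desargues is applied to ADB and
A'D'B': AD, A'D' meet at T and AB, A'B' meet at P, both on the axis, so DB and D'B' also meet on the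
axis. That point is Q, hence B' lies on D'Q and equals φ(B). Here B must be off the axis and
different from O, whence y.1 ≠ 0 and y.2 ≠ 0. -/
theorem Elation.preserves_generic {M : S.LineModel c₁} (Λ : M.Elation) (hS : S.TwoPointUnique)
    (hD : S.HasDesargues) : ∀ᶠ y in 𝓝 (0 : ℂ × ℂ), y.1 ≠ 0 → y.2 ≠ 0 →
      ∀ᶠ x in 𝓝 (((0 : ℂ), (2 : ℂ)), y), x.1.1 ≠ 0 →
        M.Inc x.1.1 (Λ.φ (x.1.1, x.1.2, M.pt x.2.2 x.1.1 x.2.1)) (0, x.2.2) := by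
  let β : ℂ × ℂ → ℂ × ℂ × ℂ × ℂ := fun y => (0, 2, (y.1, y.1 * y.2))
  have hβ : ContinuousAt β 0 := by fun_prop
  have hβ0 : β 0 = (0, 2, 0) := by simp [β]
  have hB : Filter.Tendsto β (𝓝 0) (𝓝 (0, 2, 0)) := hβ.tendsto_of_eq hβ0
  have hB' : Filter.Tendsto (fun y : ℂ × ℂ => (y.1, y.1 * y.2)) (𝓝 0) (𝓝 0) :=
    (by fun_prop : ContinuousAt (fun y : ℂ × ℂ => (y.1, y.1 * y.2)) 0).tendsto_of_eq (by simp)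
  have hc : ∀ {g : ℂ × ℂ × ℂ × ℂ → ℂ × ℂ}, AnalyticAt ℂ g (0, 2, 0) →
      ContinuousAt (fun y => g (β y)) 0 := fun {g} hg =>
    ContinuousAt.comp (g := g) (f := β) (by rw [hβ0]; exact hg.continuousAt) hβ
  -- Open general position conditions at ε = 0, r = 2: OB is not parallel to A'P, B' and D' have
  -- different abscissas, P and Q differ from T, A' is off D'Q, B is off AD, the denominator of φ is
  -- nonzero, and B is on neither OA nor OD.
  have c1 : ∀ᶠ y : ℂ × ℂ in 𝓝 0, (Λ.lA' (β y)).2 - y.2 ≠ 0 :=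
    ((hc Λ.lA'_an).snd.sub continuousAt_snd).eventually_ne (by simp [hβ0, Λ.lA'_val])
  have c2 : ∀ᶠ y : ℂ × ℂ in 𝓝 0, (Λ.φ (β y)).1 ≠ 1 :=
    (hc Λ.φ_an).fst.eventually_ne (by simp [hβ0, Λ.φ_val])
  have c3 : ∀ᶠ y : ℂ × ℂ in 𝓝 0, (Λ.P (β y)).1 ≠ 4 / 3 :=
    (hc Λ.P_an).fst.eventually_ne (by rw [hβ0, Λ.P_val]; norm_num)
  have c4 : ∀ᶠ y : ℂ × ℂ in 𝓝 0, (Λ.Q (β y)).1 ≠ 4 / 3 :=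
    (hc Λ.Q_an).fst.eventually_ne (by rw [hβ0, Λ.Q_val]; norm_num)
  have c5 : ∀ᶠ y : ℂ × ℂ in 𝓝 0, (Λ.lD' (β y)).1 + 2 * (Λ.lD' (β y)).2 ≠ 2 :=
    ((hc Λ.lD'_an).fst.add (continuousAt_const.mul (hc Λ.lD'_an).snd)).eventually_ne
      (by simp [hβ0, Λ.lD'_val]; norm_num)
  have c6 : ∀ᶠ y : ℂ × ℂ in 𝓝 0, 3 * y.1 + y.1 * y.2 - 4 ≠ 0 :=
    (by fun_prop : ContinuousAt (fun y : ℂ × ℂ => 3 * y.1 + y.1 * y.2 - 4) 0).eventually_ne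
      (by norm_num)
  have c7 : ∀ᶠ y : ℂ × ℂ in 𝓝 0, 2 - y.1 * y.2 ≠ 0 :=
    (by fun_prop : ContinuousAt (fun y : ℂ × ℂ => 2 - y.1 * y.2) 0).eventually_ne (by norm_num)
  have c8 : ∀ᶠ y : ℂ × ℂ in 𝓝 0, y.2 ≠ 1 := continuousAt_snd.eventually_ne (by simp)
  have c9 : ∀ᶠ y : ℂ × ℂ in 𝓝 0, y.2 ≠ -1 := continuousAt_snd.eventually_ne (by simp)
  filter_upwards [hB.eventually Λ.incA.eventually_nhds, hB.eventually Λ.incD.eventually_nhds,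
    hB'.eventually Λ.formula, hB.eventually Λ.lA_an.eventually_analyticAt,
    hB.eventually Λ.P_an.eventually_analyticAt, hB.eventually Λ.lA'_an.eventually_analyticAt,
    hB.eventually Λ.lD_an.eventually_analyticAt, hB.eventually Λ.Q_an.eventually_analyticAt,
    hB.eventually Λ.lD'_an.eventually_analyticAt, hB.eventually Λ.φ_an.eventually_analyticAt,
    c1, c2, c3, c4, c5, c6, c7, c8, c9]
    with y incA incD ⟨f1, f2, f3, f4, f5, f6⟩ anlA anP anlA' anlD anQ anlD' anφ c1 c2 c3 c4 c5 c6
      c7 c8 c9 hz hm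
  have IA := incA.self_of_nhds
  have ID := incD.self_of_nhds
  obtain ⟨z₀, m₀⟩ := y
  simp only at hz hm c1 c2 c3 c4 c5 c6 c7 c8 c9 f1 f2 f3 f4 f5 f6
  change (Λ.P (β (z₀, m₀))).2 = 0 at f1
  change (Λ.Q (β (z₀, m₀))).2 = 0 at f3
  change (Λ.P (β (z₀, m₀))).1 * _ = _ at f2
  change (Λ.Q (β (z₀, m₀))).1 * _ = _ at f4
  change (Λ.φ (β (z₀, m₀))).1 * _ = _ at f5
  change (Λ.φ (β (z₀, m₀))).2 * _ = _ at f6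
  set b₀ := β (z₀, m₀) with hb₀
  have hb1 : b₀.1 = 0 := rfl
  have hb2 : b₀.2.1 = 2 := rfl
  have hb3 : b₀.2.2 = (z₀, z₀ * m₀) := rfl
  rw [hb1, hb2, hb3] at IA ID
  obtain ⟨⟨-, -, -⟩, -, IA5, IA6, IA7⟩ := IA
  obtain ⟨⟨ID1, ID2, ID3⟩, -, ID5, ID6, ID7⟩ := ID
  have hzm : z₀ * m₀ ≠ 0 := mul_ne_zero hz hm
  set f : Filter ((ℂ × ℂ) × (ℂ × ℂ)) := 𝓝[{x | x.1.1 ≠ 0}] (((0 : ℂ), (2 : ℂ)), (z₀, m₀)) with hf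
  have hle : f ≤ 𝓝 (((0 : ℂ), (2 : ℂ)), (z₀, m₀)) := nhdsWithin_le_nhds
  suffices H : ∀ᶠ x in f, M.Inc x.1.1 (Λ.φ (x.1.1, x.1.2, M.pt x.2.2 x.1.1 x.2.1)) (0, x.2.2) from
    eventually_nhdsWithin_iff.mp H
  have he : Filter.Tendsto (fun x : (ℂ × ℂ) × (ℂ × ℂ) => x.1.1) f (𝓝[≠] 0) := tendsto_param _
  have cont : ∀ {g : (ℂ × ℂ) × (ℂ × ℂ) → ℂ × ℂ} {q : ℂ × ℂ},
      ContinuousAt g (((0 : ℂ), (2 : ℂ)), (z₀, m₀)) → g (((0 : ℂ), (2 : ℂ)), (z₀, m₀)) = q →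
      Filter.Tendsto g f (𝓝 q) := fun hg hq => (hg.tendsto_of_eq hq).mono_left hle
  -- the moving points and their limits
  have kB : ContinuousAt (fun x : (ℂ × ℂ) × (ℂ × ℂ) => M.pt x.2.2 x.1.1 x.2.1)
      (((0 : ℂ), (2 : ℂ)), (z₀, m₀)) :=
    ContinuousAt.comp (g := fun y : ℂ × ℂ × ℂ => M.pt y.2.2 y.1 y.2.1)
      (f := fun x : (ℂ × ℂ) × (ℂ × ℂ) => (x.1.1, x.2.1, x.2.2))
      (M.analyticAt_pt₃ z₀ m₀).continuousAt (by fun_prop)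
  have tB : Filter.Tendsto (fun x : (ℂ × ℂ) × (ℂ × ℂ) => M.pt x.2.2 x.1.1 x.2.1) f
      (𝓝 (z₀, z₀ * m₀)) := cont kB (M.pt_zero _ _)
  let X : (ℂ × ℂ) × (ℂ × ℂ) → ℂ × ℂ × ℂ × ℂ := fun x => (x.1.1, x.1.2, M.pt x.2.2 x.1.1 x.2.1)
  have tX : Filter.Tendsto X f (𝓝 b₀) := by
    have h1 : Filter.Tendsto (fun x : (ℂ × ℂ) × (ℂ × ℂ) => x.1.1) f (𝓝 0) :=
      he.mono_right nhdsWithin_le_nhds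
    have h2 : Filter.Tendsto (fun x : (ℂ × ℂ) × (ℂ × ℂ) => x.1.2) f (𝓝 2) :=
      ((by fun_prop : Continuous (fun x : (ℂ × ℂ) × (ℂ × ℂ) => x.1.2)).tendsto
        (((0 : ℂ), (2 : ℂ)), (z₀, m₀))).mono_left hle
    exact h1.prodMk_nhds (h2.prodMk_nhds tB)
  have tY : Filter.Tendsto (fun x : (ℂ × ℂ) × (ℂ × ℂ) => x.1) f (𝓝 (0, 2)) :=
    (continuous_fst.tendsto (((0 : ℂ), (2 : ℂ)), (z₀, m₀))).mono_left hle
  have tA : Filter.Tendsto (fun x : (ℂ × ℂ) × (ℂ × ℂ) => M.pt 1 x.1.1 1) f (𝓝 (1, 1)) := by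
    refine cont ?_ ((M.pt_zero _ _).trans (by simp))
    exact ContinuousAt.comp (g := fun y : ℂ × ℂ => M.pt 1 y.1 y.2)
      (f := fun x : (ℂ × ℂ) × (ℂ × ℂ) => (x.1.1, (1 : ℂ))) (M.analyticAt_pt 1 1).continuousAt
      (by fun_prop)
  have tA' : Filter.Tendsto (fun x : (ℂ × ℂ) × (ℂ × ℂ) => M.pt 1 x.1.1 x.1.2) f (𝓝 (2, 2)) := by
    refine cont ?_ ((M.pt_zero _ _).trans (by simp))
    exact ContinuousAt.comp (g := fun y : ℂ × ℂ => M.pt 1 y.1 y.2)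
      (f := fun x : (ℂ × ℂ) × (ℂ × ℂ) => x.1) (M.analyticAt_pt 1 2).continuousAt (by fun_prop)
  have tD : Filter.Tendsto (fun x : (ℂ × ℂ) × (ℂ × ℂ) => M.pt (-1) x.1.1 2) f (𝓝 (2, -2)) := by
    refine cont ?_ ((M.pt_zero _ _).trans (by simp))
    exact ContinuousAt.comp (g := fun y : ℂ × ℂ => M.pt (-1) y.1 y.2)
      (f := fun x : (ℂ × ℂ) × (ℂ × ℂ) => (x.1.1, (2 : ℂ))) (M.analyticAt_pt (-1) 2).continuousAt
      (by fun_prop)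
  have tD' : Filter.Tendsto (fun x : (ℂ × ℂ) × (ℂ × ℂ) => Λ.D' x.1) f (𝓝 (1, -1)) :=
    (Λ.D'_an.continuousAt.tendsto_of_eq Λ.D'_val).comp tY
  have tT : Filter.Tendsto (fun x : (ℂ × ℂ) × (ℂ × ℂ) => Λ.T x.1) f (𝓝 (4 / 3, 0)) :=
    (Λ.T_an.continuousAt.tendsto_of_eq Λ.T_val).comp tY
  have tlT : Filter.Tendsto (fun x : (ℂ × ℂ) × (ℂ × ℂ) => Λ.lT x.1) f (𝓝 (4, -3)) :=
    (Λ.lT_an.continuousAt.tendsto_of_eq Λ.lT_val).comp tY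
  have tlT' : Filter.Tendsto (fun x : (ℂ × ℂ) × (ℂ × ℂ) => Λ.lT' x.1) f (𝓝 (-4, 3)) :=
    (Λ.lT'_an.continuousAt.tendsto_of_eq Λ.lT'_val).comp tY
  have td : Filter.Tendsto (fun x : (ℂ × ℂ) × (ℂ × ℂ) => ((0 : ℂ), x.2.2)) f (𝓝 (0, m₀)) :=
    cont (by fun_prop) rfl
  have tlA := anlA.continuousAt.tendsto.comp tX
  have tP := anP.continuousAt.tendsto.comp tX
  have tlA' := anlA'.continuousAt.tendsto.comp tX
  have tlD := anlD.continuousAt.tendsto.comp tX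
  have tQ := anQ.continuousAt.tendsto.comp tX
  have tlD' := anlD'.continuousAt.tendsto.comp tX
  have tφ := anφ.continuousAt.tendsto.comp tX
  have c1' : (Λ.lA' b₀).2 ≠ m₀ := sub_ne_zero.mp c1
  have hφm : (Λ.φ b₀).2 = (Λ.φ b₀).1 * m₀ := by
    apply mul_right_cancel₀ c7
    linear_combination f6 - m₀ * f5
  -- For ε = 0 the explicit formula puts φ(B) on OB, so B' tends to the same limit as φ(B); their
  -- equality for ε ≠ 0 is what has to be proved.
  obtain ⟨B', tB', iB'⟩ := M.germ_meet he tlA' td IA7 (by rw [M.inc_zero, hφm]; simp) c1'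
  obtain ⟨bd', tbd', ibd'⟩ := M.germ_join he tD' tB' (by rw [← Λ.D'_val]; exact ID5) ID7
    (Ne.symm c2)
  have iA := tX.eventually incA
  have iD := tX.eventually incD
  have iY := tY.eventually Λ.inc
  have i1 := M.germ_origin he (tendsto_const_nhds (x := (1 : ℂ)))
  have i2 := M.germ_origin he (tendsto_const_nhds (x := (-1 : ℂ)))
  have i3 := M.germ_origin he td.snd_nhds
  -- DB and D'B' have the limits DQ and D'Q. If these were parallel they would coincide with the
  -- line OD, forcing Q = O and B on OD.
  have hs : (Λ.lD b₀).2 ≠ (Λ.lD' b₀).2 := by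
    intro h
    rw [M.inc_zero, M.pt_zero] at ID1
    rw [M.inc_zero, f3] at ID3 ID6
    rw [M.inc_zero, Λ.D'_val] at ID5
    have hk : (Λ.lD' b₀).2 = -1 := by
      simp only at ID1 ID5
      linear_combination -(ID1 - ID3 + ID6 - ID5) - (2 - (Λ.Q b₀).1) * h
    have hQ : (Λ.Q b₀).1 = 0 := by
      simp only at ID5
      linear_combination ID6 - ID5 + ((Λ.Q b₀).1 - 1) * hk
    rw [hQ, zero_mul] at f4
    have : z₀ * (m₀ - -1) = 0 := by linear_combination (-1 / 2) * f4
    exact (mul_ne_zero hz (sub_ne_zero.mpr c9)) this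
  have hPQ : (Λ.P b₀).1 ≠ (Λ.Q b₀).1 := by
    intro h
    rw [h] at f2
    refine mul_ne_zero hzm c6 ?_
    linear_combination (1 - z₀ * m₀) * f4 - (2 + z₀ * m₀) * f2
  have hφ1 : (Λ.φ b₀).1 ≠ 0 := by
    intro h
    rw [h, zero_mul] at f5
    exact mul_ne_zero two_ne_zero hz f5.symm
  have hφB : z₀ ≠ (Λ.φ b₀).1 := by
    intro h
    rw [← h] at f5
    have : z₀ * (z₀ * m₀) = 0 := by linear_combination -f5
    exact mul_ne_zero hz hzm this
  obtain ⟨R, tR, iR⟩ := M.germ_desargues hS hD he tA tD tB tA' tD' tB' tT tP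
    (tendsto_const_nhds (x := ((0 : ℂ), (1 : ℂ)))) (tendsto_const_nhds (x := ((0 : ℂ), (-1 : ℂ))))
    td tlT tlT' tlA tlA' tlD tbd'
    (i1.mono fun x hx => ⟨hx, M.inc_pt _ _ _, M.inc_pt _ _ _⟩)
    ((i2.and iY).mono fun x hx => ⟨hx.1, M.inc_pt _ _ _, hx.2.2.2.2⟩)
    ((i3.and iB').mono fun x hx => ⟨hx.1, M.inc_pt _ _ _, hx.2.2⟩)
    (iY.mono fun x hx => hx.1)
    (iY.mono fun x hx => ⟨hx.2.2.1.1, hx.2.2.1.2.2, hx.2.2.1.2.1⟩)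
    (iA.mono fun x hx => hx.1)
    ((iA.and iB').mono fun x hx => ⟨hx.1.2.2.1, hx.2.1, hx.1.2.2.2.1⟩)
    (iD.mono fun x hx => ⟨hx.1.1, hx.1.2.1⟩)
    ibd'
    ((iY.and iA).mono fun x hx => ⟨hx.1.2.1, hx.2.2.1⟩)
    (by simp [Prod.ext_iff]) (by simp [Prod.ext_iff]) (by simp [Prod.ext_iff])
    (by simp [Prod.ext_iff]) (by simp [Prod.ext_iff]) (by simp [Prod.ext_iff])
    (fun h => hz (congrArg Prod.fst h)) (fun h => hφ1 (congrArg Prod.fst h))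
    (fun h => hφB (congrArg Prod.fst h))
    (by rw [M.inc_zero]; norm_num)
    (by rw [M.inc_zero]
        intro h
        have : z₀ * (m₀ - 1) = 0 := by linear_combination h
        exact mul_ne_zero hz (sub_ne_zero.mpr c8) this)
    (by rw [M.inc_zero]
        intro h
        have : z₀ * (m₀ - -1) = 0 := by linear_combination h
        exact mul_ne_zero hz (sub_ne_zero.mpr c9) this)
    ID3 ID6 hs rfl f1 f3 c3.symm c4.symm hPQ
  have t0 : Filter.Tendsto (fun _ : (ℂ × ℂ) × (ℂ × ℂ) => (0 : ℂ × ℂ)) f (𝓝 0) := tendsto_const_nhds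
  have nA' : ¬ M.Inc 0 (2, 2) (Λ.lD' b₀) := by
    rw [M.inc_zero]
    exact fun h => c5 h.symm
  filter_upwards [he.eventually self_mem_nhdsWithin, M.germ_on he tR t0, M.germ_on he tR tlD,
    M.germ_on he tQ t0, M.germ_on he tQ tlD, M.germ_on he tR tbd', M.germ_on he tQ tlD',
    M.germ_on he tD tlD, M.germ_not_on he tD t0 (by rw [M.inc_axis_zero]; norm_num),
    M.germ_on he tD' tbd', M.germ_on he tD' tlD', M.germ_on he tB' tbd', M.germ_on he tB' tlA',
    M.germ_on he tφ tlA', M.germ_on he tφ tlD', M.germ_on he tA' tlA', M.germ_not_on he tA' tlD' nA',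
    M.germ_ne he tD' tQ (fun h => by
      have := congrArg Prod.snd h
      rw [f3] at this
      norm_num at this), iA, iD, iB', ibd', iR]
    with x hε oR0 oRD oQ0 oQD oRb oQD' oDD nD0 oD'b oD'D' oB'b oB'A oφA oφD' oA'A nA'D' nDQ jA jD jB
      jb jR
  -- R and Q both lie on DB and on the axis, hence agree. Then D'B' and D'Q are the same curve, and
  -- B' and φ(B) are both its intersection with A'P.
  have e1 : M.θ x.1.1 (R x) = M.θ x.1.1 (Λ.Q (X x)) :=
    hS.eq_point oRD.2.1 oR0.2.1 (oRD.2.2.mpr jR.1) (oR0.2.2.mpr jR.2.2) (oQD.2.2.mpr jD.1.2.2)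
      (oQ0.2.2.mpr jD.2.1) (oDD.2.2.mpr jD.1.1) nD0
  have e2 : M.κ x.1.1 (bd' x) = M.κ x.1.1 (Λ.lD' (X x)) := by
    refine hS _ _ nDQ _ oD'b.2.1 _ oD'D'.2.1 (oD'b.2.2.mpr jb.1) ?_ (oD'D'.2.2.mpr jD.2.2.1)
      (oQD'.2.2.mpr jD.2.2.2.1)
    have h := oRb.2.2.mpr jR.2.1
    rw [On, e1] at h
    exact h
  have hB'' := oB'b.2.2.mpr jb.2
  rw [On, e2] at hB''
  have e3 : B' x = Λ.φ (X x) := M.θ_injective hε <|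
    hS.eq_point oφA.2.1 oφD'.2.1 (oB'A.2.2.mpr jB.1) hB'' (oφA.2.2.mpr jA.2.2.2.2)
      (oφD'.2.2.mpr jD.2.2.2.2) (oA'A.2.2.mpr jA.2.2.1) nA'D'
  have h := jB.2
  rw [e3] at h
  exact h

/-- `φ` preserves the curves through the origin that are close to the axis. -/
theorem Elation.preserves_pencil {M : S.LineModel c₁} (Λ : M.Elation) (hS : S.TwoPointUnique)
    (hD : S.HasDesargues) : ∀ᶠ x in 𝓝 (((0 : ℂ), (2 : ℂ)), (0 : ℂ × ℂ)), x.1.1 ≠ 0 →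
        M.Inc x.1.1 (Λ.φ (x.1.1, x.1.2, M.pt x.2.2 x.1.1 x.2.1)) (0, x.2.2) := by
  let X : (ℂ × ℂ) × (ℂ × ℂ) → ℂ × ℂ × ℂ × ℂ := fun x => (x.1.1, x.1.2, M.pt x.2.2 x.1.1 x.2.1)
  have hX : AnalyticAt ℂ X ((0, 2), 0) := by
    have : AnalyticAt ℂ (fun x : (ℂ × ℂ) × (ℂ × ℂ) => M.pt x.2.2 x.1.1 x.2.1) ((0, 2), 0) :=
      AnalyticAt.comp (g := fun y : ℂ × ℂ × ℂ => M.pt y.2.2 y.1 y.2.1)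
        (f := fun x : (ℂ × ℂ) × (ℂ × ℂ) => (x.1.1, x.2.1, x.2.2)) (M.analyticAt_pt₃ 0 0)
        (by fun_prop)
    fun_prop
  have hX0 : X ((0, 2), 0) = (0, 2, 0) := by
    simp only [X, Prod.fst_zero, Prod.snd_zero, M.pt_zero]
    simp
  have hφ : AnalyticAt ℂ (fun x => Λ.φ (X x)) ((0, 2), 0) := by
    refine AnalyticAt.comp (g := Λ.φ) (f := X) ?_ hX
    rw [hX0]; exact Λ.φ_an
  have hφ0 : Λ.φ (X ((0, 2), 0)) = 0 := by rw [hX0, Λ.φ_val]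
  have hΨ : AnalyticAt ℂ (fun x : (ℂ × ℂ) × (ℂ × ℂ) => M.Ψ (x.1.1, (Λ.φ (X x)).1, 0, x.2.2))
      ((0, 2), 0) :=
    AnalyticAt.comp (g := M.Ψ) (f := fun x : (ℂ × ℂ) × (ℂ × ℂ) =>
      (x.1.1, (Λ.φ (X x)).1, (0 : ℂ), x.2.2)) (M.analyticAt _) (by fun_prop)
  have hH : AnalyticAt ℂ (fun x : (ℂ × ℂ) × (ℂ × ℂ) =>
      (Λ.φ (X x)).2 - M.Ψ (x.1.1, (Λ.φ (X x)).1, 0, x.2.2)) ((0, 2), 0) := by fun_prop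
  -- Generic base points accumulate at 0, so the identity theorem removes the genericity assumption.
  have hfr : ∃ᶠ y in 𝓝 (0 : ℂ × ℂ), y.1 ≠ 0 ∧ y.2 ≠ 0 := by
    have ht : Filter.Tendsto (fun t : ℂ => (t, t)) (𝓝[≠] 0) (𝓝 (0 : ℂ × ℂ)) :=
      ((by fun_prop : Continuous fun t : ℂ => (t, t)).tendsto 0).mono_left nhdsWithin_le_nhds
    refine ht.frequently (Filter.Eventually.frequently ?_)
    filter_upwards [self_mem_nhdsWithin] with t ht
    exact ⟨ht, ht⟩
  have := hH.eventually_eq_zero_of_frequently (P := fun a => a.1 ≠ 0)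
    ((hfr.and_eventually (Λ.preserves_generic hS hD)).mono fun y hy => by
      filter_upwards [hy.2 hy.1.1 hy.1.2] with x hx hε
      exact sub_eq_zero.mpr (hx hε))
  filter_upwards [this] with x hx hε
  exact sub_eq_zero.mp (hx hε)

/-- The point with abscissa `z` on the model line `l`. -/
def gr (M : S.LineModel c₁) (ε : ℂ) (l : ℂ × ℂ) (z : ℂ) : ℂ × ℂ := (z, M.Ψ (ε, z, l))

theorem inc_gr (M : S.LineModel c₁) (ε : ℂ) (l : ℂ × ℂ) (z : ℂ) : M.Inc ε (M.gr ε l z) l := rfl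

theorem gr_zero (M : S.LineModel c₁) (l : ℂ × ℂ) (z : ℂ) : M.gr 0 l z = (z, l.1 + z * l.2) := by
  obtain ⟨b, m⟩ := l
  simp [gr, M.Ψ_zero]

theorem analyticAt_gr (M : S.LineModel c₁) (z : ℂ) (l : ℂ × ℂ) :
    AnalyticAt ℂ (fun y : ℂ × ℂ × ℂ × ℂ => M.gr y.1 y.2.2 y.2.1) (0, z, l) :=
  (analyticAt_fst.comp analyticAt_snd).prod (M.analyticAt (z, l))

/-- If p lies on the axis, then P = Q = p, so p lies on both A'P and D'Q, which meet only once. -/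
theorem Elation.fixes_axis {M : S.LineModel c₁} (Λ : M.Elation) (hS : S.TwoPointUnique) :
    ∀ᶠ x in 𝓝 (((0 : ℂ), (2 : ℂ)), (0 : ℂ)), x.1.1 ≠ 0 →
      Λ.φ (x.1.1, x.1.2, (x.2, 0)) = (x.2, 0) := by
  set f : Filter ((ℂ × ℂ) × ℂ) := 𝓝[{x | x.1.1 ≠ 0}] (((0 : ℂ), (2 : ℂ)), (0 : ℂ)) with hf
  suffices H : ∀ᶠ x in f, Λ.φ (x.1.1, x.1.2, (x.2, 0)) = (x.2, 0) from eventually_nhdsWithin_iff.mp H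
  have hle : f ≤ 𝓝 (((0 : ℂ), (2 : ℂ)), (0 : ℂ)) := nhdsWithin_le_nhds
  have he : Filter.Tendsto (fun x : (ℂ × ℂ) × ℂ => x.1.1) f (𝓝[≠] 0) := tendsto_param _
  let X : (ℂ × ℂ) × ℂ → ℂ × ℂ × ℂ × ℂ := fun x => (x.1.1, x.1.2, (x.2, 0))
  have tX : Filter.Tendsto X f (𝓝 (0, 2, 0)) :=
    ((by fun_prop : Continuous X).tendsto (((0 : ℂ), (2 : ℂ)), (0 : ℂ))).mono_left hle
  have tB : Filter.Tendsto (fun x : (ℂ × ℂ) × ℂ => (x.2, (0 : ℂ))) f (𝓝 0) :=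
    ((by fun_prop : Continuous fun x : (ℂ × ℂ) × ℂ => (x.2, (0 : ℂ))).tendsto
      (((0 : ℂ), (2 : ℂ)), (0 : ℂ))).mono_left hle
  have tA : Filter.Tendsto (fun x : (ℂ × ℂ) × ℂ => M.pt 1 x.1.1 1) f (𝓝 (1, 1)) := by
    refine (ContinuousAt.tendsto_of_eq (a := (((0 : ℂ), (2 : ℂ)), (0 : ℂ))) ?_
      ((M.pt_zero _ _).trans (by simp))).mono_left hle
    exact ContinuousAt.comp (g := fun y : ℂ × ℂ => M.pt 1 y.1 y.2)
      (f := fun x : (ℂ × ℂ) × ℂ => (x.1.1, (1 : ℂ))) (M.analyticAt_pt 1 1).continuousAt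
      (by fun_prop)
  have tA' : Filter.Tendsto (fun x : (ℂ × ℂ) × ℂ => M.pt 1 x.1.1 x.1.2) f (𝓝 (2, 2)) := by
    refine (ContinuousAt.tendsto_of_eq (a := (((0 : ℂ), (2 : ℂ)), (0 : ℂ))) ?_
      ((M.pt_zero _ _).trans (by simp))).mono_left hle
    exact ContinuousAt.comp (g := fun y : ℂ × ℂ => M.pt 1 y.1 y.2)
      (f := fun x : (ℂ × ℂ) × ℂ => x.1) (M.analyticAt_pt 1 2).continuousAt (by fun_prop)
  have tD : Filter.Tendsto (fun x : (ℂ × ℂ) × ℂ => M.pt (-1) x.1.1 2) f (𝓝 (2, -2)) := by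
    refine (ContinuousAt.tendsto_of_eq (a := (((0 : ℂ), (2 : ℂ)), (0 : ℂ))) ?_
      ((M.pt_zero _ _).trans (by simp))).mono_left hle
    exact ContinuousAt.comp (g := fun y : ℂ × ℂ => M.pt (-1) y.1 y.2)
      (f := fun x : (ℂ × ℂ) × ℂ => (x.1.1, (2 : ℂ))) (M.analyticAt_pt (-1) 2).continuousAt
      (by fun_prop)
  have t0 : Filter.Tendsto (fun _ : (ℂ × ℂ) × ℂ => (0 : ℂ × ℂ)) f (𝓝 0) := tendsto_const_nhds
  have tl : ∀ {g : ℂ × ℂ × ℂ × ℂ → ℂ × ℂ} {q : ℂ × ℂ}, AnalyticAt ℂ g (0, 2, 0) →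
      g (0, 2, 0) = q → Filter.Tendsto (fun x => g (X x)) f (𝓝 q) := fun hg hq =>
    (hg.continuousAt.tendsto_of_eq hq).comp tX
  have iB : ∀ᶠ x in f, M.Inc x.1.1 (x.2, 0) 0 := by
    have : Filter.Tendsto (fun x : (ℂ × ℂ) × ℂ => (x.1.1, x.2)) f (𝓝 (0, 0)) :=
      ((by fun_prop : Continuous fun x : (ℂ × ℂ) × ℂ => (x.1.1, x.2)).tendsto
        (((0 : ℂ), (2 : ℂ)), (0 : ℂ))).mono_left hle
    filter_upwards [this.eventually (M.Ψ_axis 0)] with x hx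
    exact hx.symm
  have tlA := tl Λ.lA_an Λ.lA_val
  have tlA' := tl Λ.lA'_an Λ.lA'_val
  have tlD := tl Λ.lD_an Λ.lD_val
  have tlD' := tl Λ.lD'_an Λ.lD'_val
  have tP := tl Λ.P_an Λ.P_val
  have tQ := tl Λ.Q_an Λ.Q_val
  have tφ := tl Λ.φ_an Λ.φ_val
  filter_upwards [tX.eventually Λ.incA, tX.eventually Λ.incD, iB, he.eventually self_mem_nhdsWithin,
    M.germ_on he tB t0, M.germ_on he tB tlA, M.germ_on he tB tlD, M.germ_on he tP t0,
    M.germ_on he tP tlA, M.germ_on he tP tlA', M.germ_on he tQ t0, M.germ_on he tQ tlD,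
    M.germ_on he tQ tlD', M.germ_on he tφ tlA', M.germ_on he tφ tlD', M.germ_on he tA tlA,
    M.germ_on he tD tlD, M.germ_on he tA' tlA',
    M.germ_not_on he tA t0 (by rw [M.inc_axis_zero]; norm_num),
    M.germ_not_on he tD t0 (by rw [M.inc_axis_zero]; norm_num),
    M.germ_not_on he tA' tlD' (by rw [M.inc_zero]; norm_num)]
    with x jA jD jB hε oB0 oBA oBD oP0 oPA oPA' oQ0 oQD oQD' oφA oφD oAA oDD oA'A nA nD nA'
  have e1 : Λ.P (X x) = (x.2, 0) := M.θ_injective hε <|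
    hS.eq_point oPA.2.1 oP0.2.1 (oPA.2.2.mpr jA.1.2.2) (oP0.2.2.mpr jA.2.1) (oBA.2.2.mpr jA.1.2.1)
      (oB0.2.2.mpr jB) (oAA.2.2.mpr jA.1.1) nA
  have e2 : Λ.Q (X x) = (x.2, 0) := M.θ_injective hε <|
    hS.eq_point oQD.2.1 oQ0.2.1 (oQD.2.2.mpr jD.1.2.2) (oQ0.2.2.mpr jD.2.1) (oBD.2.2.mpr jD.1.2.1)
      (oB0.2.2.mpr jB) (oDD.2.2.mpr jD.1.1) nD
  have h1 := oPA'.2.2.mpr jA.2.2.2.1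
  have h2 := oQD'.2.2.mpr jD.2.2.2.1
  rw [e1] at h1
  rw [e2] at h2
  exact M.θ_injective hε <| hS.eq_point oφA.2.1 oφD.2.1 (oφA.2.2.mpr jA.2.2.2.2)
    (oφD.2.2.mpr jD.2.2.2.2) h1 h2 (oA'A.2.2.mpr jA.2.2.1) nA'

/-! ### Images of curves are curves. -/

/-- The conditions on a point `p` (for `ε = 0`, `r = 2`) under which the construction of `φ`
is available near `p`. -/
structure Elation.IsGood {M : S.LineModel c₁} (Λ : M.Elation) (p : ℂ × ℂ) : Prop where
  lA : AnalyticAt ℂ Λ.lA (0, 2, p)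
  P : AnalyticAt ℂ Λ.P (0, 2, p)
  lA' : AnalyticAt ℂ Λ.lA' (0, 2, p)
  φ : AnalyticAt ℂ Λ.φ (0, 2, p)
  inc : ∀ᶠ x in 𝓝 ((0 : ℂ), (2 : ℂ), p),
    (M.Inc x.1 (M.pt 1 x.1 1) (Λ.lA x) ∧ M.Inc x.1 x.2.2 (Λ.lA x) ∧ M.Inc x.1 (Λ.P x) (Λ.lA x)) ∧
    M.Inc x.1 (Λ.P x) 0 ∧
    (M.Inc x.1 (M.pt 1 x.1 x.2.1) (Λ.lA' x) ∧ M.Inc x.1 (Λ.P x) (Λ.lA' x) ∧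
      M.Inc x.1 (Λ.φ x) (Λ.lA' x))
  P2 : (Λ.P (0, 2, p)).2 = 0
  P1 : (Λ.P (0, 2, p)).1 * (1 - p.2) = p.1 - p.2
  φ1 : (Λ.φ (0, 2, p)).1 * (2 - p.2) = 2 * p.1
  φ2 : (Λ.φ (0, 2, p)).2 * (2 - p.2) = 2 * p.2
  ne_one : 1 - p.2 ≠ 0
  ne_two : 2 - p.2 ≠ 0

theorem Elation.eventually_isGood {M : S.LineModel c₁} (Λ : M.Elation) :
    ∀ᶠ p in 𝓝 (0 : ℂ × ℂ), Λ.IsGood p := by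
  have t := tendsto_slice 0
  have h1 : ∀ᶠ p : ℂ × ℂ in 𝓝 0, 1 - p.2 ≠ 0 :=
    (by fun_prop : ContinuousAt (fun p : ℂ × ℂ => 1 - p.2) 0).eventually_ne (by norm_num)
  have h2 : ∀ᶠ p : ℂ × ℂ in 𝓝 0, 2 - p.2 ≠ 0 :=
    (by fun_prop : ContinuousAt (fun p : ℂ × ℂ => 2 - p.2) 0).eventually_ne (by norm_num)
  filter_upwards [t.eventually Λ.lA_an.eventually_analyticAt, t.eventually
    Λ.P_an.eventually_analyticAt, t.eventually Λ.lA'_an.eventually_analyticAt, t.eventually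
    Λ.φ_an.eventually_analyticAt, t.eventually Λ.incA.eventually_nhds, Λ.formula, h1, h2]
    with p a1 a2 a3 a4 a5 ⟨f1, f2, _, _, f5, f6⟩ h1 h2
  exact ⟨a1, a2, a3, a4, a5, f1, f2, f5, f6, h1, h2⟩

/-- The line `BC` and its image `B'C'` meet on the axis, for germs of points `B`, `C` on
a line `l` close to `w = s (1 + z)`. -/
theorem Elation.germ_axis {M : S.LineModel c₁} (Λ : M.Elation) (hS : S.TwoPointUnique)
    (hD : S.HasDesargues) {X : Type*} {f : Filter X} {y : X → ℂ × ℂ} {l : X → ℂ × ℂ}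
    {z z' : X → ℂ} {s β γ : ℂ} (hy : Filter.Tendsto y f (𝓝 (0, 2)))
    (he : Filter.Tendsto (fun x => (y x).1) f (𝓝[≠] 0)) (hl : Filter.Tendsto l f (𝓝 (s, s)))
    (hz : Filter.Tendsto z f (𝓝 β)) (hz' : Filter.Tendsto z' f (𝓝 γ))
    (gB : Λ.IsGood (β, s * (1 + β))) (gC : Λ.IsGood (γ, s * (1 + γ)))
    (kB : ∀ᶠ x in 𝓝 (((0 : ℂ), (2 : ℂ)), (β, s * (1 + β) / β)), x.1.1 ≠ 0 →
      M.Inc x.1.1 (Λ.φ (x.1.1, x.1.2, M.pt x.2.2 x.1.1 x.2.1)) (0, x.2.2))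
    (kC : ∀ᶠ x in 𝓝 (((0 : ℂ), (2 : ℂ)), (γ, s * (1 + γ) / γ)), x.1.1 ≠ 0 →
      M.Inc x.1.1 (Λ.φ (x.1.1, x.1.2, M.pt x.2.2 x.1.1 x.2.1)) (0, x.2.2))
    (hs : s ≠ 0) (hs2 : 2 - s ≠ 0) (hs1 : 1 - 2 * s ≠ 0) (hβ : β ≠ 0) (hβ1 : 1 + β ≠ 0) (hγ : γ ≠ 0)
    (hγ1 : 1 + γ ≠ 0) (hβγ : β ≠ γ) (hβs : s * (1 + β) ≠ β) (hγs : s * (1 + γ) ≠ γ) :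
    ∃ R k : X → ℂ × ℂ, Filter.Tendsto R f (𝓝 (-1, 0)) ∧
      Filter.Tendsto k f (𝓝 (2 * s / (2 - s), 2 * s / (2 - s))) ∧
      ∀ᶠ x in f,
        (M.Inc (y x).1 (Λ.φ ((y x).1, (y x).2, M.gr (y x).1 (l x) (z x))) (k x) ∧
          M.Inc (y x).1 (Λ.φ ((y x).1, (y x).2, M.gr (y x).1 (l x) (z' x))) (k x)) ∧
        M.Inc (y x).1 (R x) (l x) ∧ M.Inc (y x).1 (R x) (k x) ∧ M.Inc (y x).1 (R x) 0 := by
  have he0 : Filter.Tendsto (fun x => (y x).1) f (𝓝 0) := he.mono_right nhdsWithin_le_nhds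
  have tgr : ∀ {ζ : X → ℂ} {δ : ℂ}, Filter.Tendsto ζ f (𝓝 δ) →
      Filter.Tendsto (fun x => M.gr (y x).1 (l x) (ζ x)) f (𝓝 (δ, s * (1 + δ))) := by
    intro ζ δ hζ
    exact ((M.analyticAt_gr δ (s, s)).continuousAt.tendsto_of_eq (by
      simp only [M.gr_zero]
      exact Prod.ext rfl (by ring))).comp (he0.prodMk_nhds (hζ.prodMk_nhds hl))
  have tX : ∀ {ζ : X → ℂ} {δ : ℂ}, Filter.Tendsto ζ f (𝓝 δ) →
      Filter.Tendsto (fun x => ((y x).1, (y x).2, M.gr (y x).1 (l x) (ζ x))) f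
        (𝓝 (0, 2, (δ, s * (1 + δ)))) := fun hζ =>
    he0.prodMk_nhds (hy.snd_nhds.prodMk_nhds (tgr hζ))
  -- the line joining the origin to a point of `l`, and its invariance
  have pencil : ∀ {ζ : X → ℂ} {δ : ℂ}, Filter.Tendsto ζ f (𝓝 δ) → δ ≠ 0 →
      (∀ᶠ x in 𝓝 (((0 : ℂ), (2 : ℂ)), (δ, s * (1 + δ) / δ)), x.1.1 ≠ 0 →
        M.Inc x.1.1 (Λ.φ (x.1.1, x.1.2, M.pt x.2.2 x.1.1 x.2.1)) (0, x.2.2)) →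
      ∃ d : X → ℂ × ℂ, Filter.Tendsto d f (𝓝 (0, s * (1 + δ) / δ)) ∧
        ∀ᶠ x in f, M.Inc (y x).1 0 (d x) ∧ M.Inc (y x).1 (M.gr (y x).1 (l x) (ζ x)) (d x) ∧
          M.Inc (y x).1 (Λ.φ ((y x).1, (y x).2, M.gr (y x).1 (l x) (ζ x))) (d x) := by
    intro ζ δ hζ hδ hk
    obtain ⟨d, td, hd⟩ := M.germ_join he (tendsto_const_nhds (x := (0 : ℂ × ℂ))) (tgr hζ)
      (l := (0, s * (1 + δ) / δ)) (by rw [M.inc_zero]; simp) (by rw [M.inc_zero]; field_simp; simp)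
      hδ.symm
    refine ⟨d, td, ?_⟩
    have h1 := (he0.prodMk_nhds td).eventually (M.Ψ_left _)
    have h2 := (hy.prodMk_nhds (hζ.prodMk_nhds td.snd_nhds)).eventually hk
    filter_upwards [hd, h1, h2, he.eventually self_mem_nhdsWithin] with x hd h1 h2 hε
    have hd1 : (d x).1 = 0 := by
      have h3 := hd.1
      simp only [Inc, Prod.fst_zero, Prod.snd_zero] at h3
      rw [← h1, ← h3]
    have hdx : d x = (0, (d x).2) := Prod.ext hd1 rfl
    have hpt : M.gr (y x).1 (l x) (ζ x) = M.pt (d x).2 (y x).1 (ζ x) := by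
      refine Prod.ext rfl ?_
      have h4 := hd.2
      rw [hdx] at h4
      exact h4
    refine ⟨hd.1, hd.2, ?_⟩
    rw [hpt, hdx]
    exact h2 hε
  obtain ⟨b, tb, ib⟩ := pencil hz hβ kB
  obtain ⟨d, td, id⟩ := pencil hz' hγ kC
  have φB1 := gB.φ1
  have φB2 := gB.φ2
  have φC1 := gC.φ1
  have φC2 := gC.φ2
  have PB1 := gB.P1
  have PC1 := gC.P1
  have nB1 := gB.ne_one
  have nC1 := gC.ne_one
  have nB2 := gB.ne_two
  have nC2 := gC.ne_two
  simp only at φB1 φB2 φC1 φC2 PB1 PC1 nB1 nC1 nB2 nC2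
  -- At ε = 0, r = 2 the line w = s(1 + z) has image w = k(1 + z) with k = 2s/(2 - s): the point
  -- (-1, 0) of the axis is fixed. The condition s ≠ 2 keeps the image from being vertical.
  have inck : ∀ {δ : ℂ} {q : ℂ × ℂ}, 2 - s * (1 + δ) ≠ 0 → q.1 * (2 - s * (1 + δ)) = 2 * δ →
      q.2 * (2 - s * (1 + δ)) = 2 * (s * (1 + δ)) →
      M.Inc 0 q (2 * s / (2 - s), 2 * s / (2 - s)) := by
    intro δ q h0 h1 h2
    rw [M.inc_zero]
    field_simp
    apply mul_left_cancel₀ h0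
    linear_combination (2 - s) * h2 - 2 * s * h1
  obtain ⟨k, tk, ik⟩ := M.germ_join he (gB.φ.continuousAt.tendsto.comp (tX hz))
    (gC.φ.continuousAt.tendsto.comp (tX hz')) (inck nB2 φB1 φB2) (inck nC2 φC1 φC2) (by
      intro h
      rw [h] at φB1
      have : (β - γ) * (2 - s) = 0 := by
        linear_combination (1 / 2) * ((2 - s * (1 + β)) * φC1 - (2 - s * (1 + γ)) * φB1)
      exact mul_ne_zero (sub_ne_zero.mpr hβγ) hs2 this)
  have tA : Filter.Tendsto (fun x => M.pt 1 (y x).1 1) f (𝓝 (1, 1)) :=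
    ((M.analyticAt_pt 1 1).continuousAt.tendsto_of_eq ((M.pt_zero _ _).trans (by simp))).comp
      (he0.prodMk_nhds tendsto_const_nhds)
  have tA' : Filter.Tendsto (fun x => M.pt 1 (y x).1 (y x).2) f (𝓝 (2, 2)) :=
    ((M.analyticAt_pt 1 2).continuousAt.tendsto_of_eq ((M.pt_zero _ _).trans (by simp))).comp hy
  have i1 := M.germ_origin he (tendsto_const_nhds (x := (1 : ℂ)))
  have iB := (tX hz).eventually gB.inc
  have iC := (tX hz').eventually gC.inc
  have φne : ∀ {δ : ℂ} {q : ℂ × ℂ}, δ ≠ 0 → q.1 * (2 - s * (1 + δ)) = 2 * δ → q.1 ≠ 0 := by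
    intro δ q h0 h1 h
    rw [h, zero_mul] at h1
    exact mul_ne_zero two_ne_zero h0 h1.symm
  have φne' : ∀ {δ : ℂ} {q : ℂ × ℂ}, δ ≠ 0 → 1 + δ ≠ 0 → q.1 * (2 - s * (1 + δ)) = 2 * δ →
      δ ≠ q.1 := by
    intro δ q h0 h0' h1 h
    rw [← h] at h1
    have : δ * (s * (1 + δ)) = 0 := by linear_combination -h1
    exact mul_ne_zero h0 (mul_ne_zero hs h0') this
  -- This keeps the limits of P and Q away from R₀ = (-1, 0): an equality would put A = (1, 1) on
  -- the line, excluded by 2s ≠ 1, or make the chosen point of the line equal to (-1, 0).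
  have Pne : ∀ {δ t : ℂ}, 1 + δ ≠ 0 → t * (1 - s * (1 + δ)) = δ - s * (1 + δ) → t ≠ -1 := by
    rintro δ t h0 h1 rfl
    have : (1 + δ) * (1 - 2 * s) = 0 := by linear_combination -h1
    exact mul_ne_zero h0 hs1 this
  -- The triangles are ABC and A'φ(B)φ(C), with B and C on l. They are in perspective from O because
  -- φ preserves OB and OC, and P and Q are the projections of B and C from A. Hence BC and its
  -- image meet on the axis.
  obtain ⟨R, tR, iR⟩ := M.germ_desargues hS hD he tA (tgr hz) (tgr hz') tA'
    (gB.φ.continuousAt.tendsto.comp (tX hz)) (gC.φ.continuousAt.tendsto.comp (tX hz'))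
    (gB.P.continuousAt.tendsto.comp (tX hz)) (gC.P.continuousAt.tendsto.comp (tX hz'))
    (tendsto_const_nhds (x := ((0 : ℂ), (1 : ℂ)))) tb td
    (gB.lA.continuousAt.tendsto.comp (tX hz)) (gB.lA'.continuousAt.tendsto.comp (tX hz))
    (gC.lA.continuousAt.tendsto.comp (tX hz')) (gC.lA'.continuousAt.tendsto.comp (tX hz'))
    hl tk
    (i1.mono fun x hx => ⟨hx, M.inc_pt _ _ _, M.inc_pt _ _ _⟩) ib id
    (iB.mono fun x hx => hx.1)
    (iB.mono fun x hx => ⟨hx.2.2.1, hx.2.2.2.2, hx.2.2.2.1⟩)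
    (iC.mono fun x hx => hx.1)
    (iC.mono fun x hx => ⟨hx.2.2.1, hx.2.2.2.2, hx.2.2.2.1⟩)
    (Filter.Eventually.of_forall fun x => ⟨M.inc_gr _ _ _, M.inc_gr _ _ _⟩)
    ik
    ((iB.and iC).mono fun x hx => ⟨hx.1.2.1, hx.2.2.1⟩)
    (R₀ := (-1, 0))
    (by simp [Prod.ext_iff]) (by simp [Prod.ext_iff]) (by simp [Prod.ext_iff])
    (fun h => hβ (congrArg Prod.fst h)) (fun h => φne hβ φB1 (congrArg Prod.fst h))
    (fun h => φne' hβ hβ1 φB1 (congrArg Prod.fst h))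
    (fun h => hγ (congrArg Prod.fst h)) (fun h => φne hγ φC1 (congrArg Prod.fst h))
    (fun h => φne' hγ hγ1 φC1 (congrArg Prod.fst h))
    (by rw [M.inc_zero]; simpa using hβs)
    (by rw [M.inc_zero]; simpa using hγs)
    (by rw [M.inc_zero]
        intro h
        simp only [zero_add] at h
        field_simp at h
        have : β - γ = 0 := by linear_combination h
        exact hβγ (sub_eq_zero.mp this))
    (by rw [M.inc_zero]; simp) (by rw [M.inc_zero]; simp)
    (by intro h
        simp only at h
        field_simp at h
        exact hs (by linear_combination -h))
    gB.P2 gC.P2 rfl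
    (by intro h
        rw [h] at PB1
        have : (β - γ) * (1 - 2 * s) = 0 := by
          linear_combination (1 - s * (1 + β)) * PC1 - (1 - s * (1 + γ)) * PB1
        exact mul_ne_zero (sub_ne_zero.mpr hβγ) hs1 this)
    (Pne hβ1 PB1) (Pne hγ1 PC1)
  refine ⟨R, k, tR, tk, ?_⟩
  filter_upwards [ik, iR] with x h1 h2
  exact ⟨h1, h2⟩

/-- If two points of a line close to the axis (with fixed abscissas `u` and `-u`) are mapped to
points of the line `Γ`, so is every point close to the origin, at least near a generic base. -/
theorem Elation.preserves_line_generic {M : S.LineModel c₁} (Λ : M.Elation) (hS : S.TwoPointUnique)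
    (hD : S.HasDesargues) {Γ : (ℂ × ℂ) × (ℂ × ℂ) → ℂ × ℂ} {u s t : ℂ}
    (hΓ : ContinuousAt Γ ((0, 2), (s, s)))
    (iΓ : ∀ᶠ x in 𝓝 (((0 : ℂ), (2 : ℂ)), (s, s)),
      M.Inc x.1.1 (Λ.φ (x.1.1, x.1.2, M.gr x.1.1 x.2 u)) (Γ x) ∧
      M.Inc x.1.1 (Λ.φ (x.1.1, x.1.2, M.gr x.1.1 x.2 (-u))) (Γ x))
    (g1 : Λ.IsGood (u, s * (1 + u))) (g2 : Λ.IsGood (-u, s * (1 + -u)))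
    (g3 : Λ.IsGood (t, s * (1 + t)))
    (k1 : ∀ᶠ x in 𝓝 (((0 : ℂ), (2 : ℂ)), (u, s * (1 + u) / u)), x.1.1 ≠ 0 →
      M.Inc x.1.1 (Λ.φ (x.1.1, x.1.2, M.pt x.2.2 x.1.1 x.2.1)) (0, x.2.2))
    (k2 : ∀ᶠ x in 𝓝 (((0 : ℂ), (2 : ℂ)), (-u, s * (1 + -u) / -u)), x.1.1 ≠ 0 →
      M.Inc x.1.1 (Λ.φ (x.1.1, x.1.2, M.pt x.2.2 x.1.1 x.2.1)) (0, x.2.2))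
    (k3 : ∀ᶠ x in 𝓝 (((0 : ℂ), (2 : ℂ)), (t, s * (1 + t) / t)), x.1.1 ≠ 0 →
      M.Inc x.1.1 (Λ.φ (x.1.1, x.1.2, M.pt x.2.2 x.1.1 x.2.1)) (0, x.2.2))
    (hs : s ≠ 0) (hs2 : 2 - s ≠ 0) (hs1 : 1 - 2 * s ≠ 0) (hu : u ≠ 0) (hu1 : 1 + u ≠ 0)
    (hu1' : 1 + -u ≠ 0) (ht : t ≠ 0) (ht1 : 1 + t ≠ 0) (hut : u ≠ t)
    (hus : s * (1 + u) ≠ u) (hus' : s * (1 + -u) ≠ -u) (hts : s * (1 + t) ≠ t) :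
    ∀ᶠ x in 𝓝 (((0 : ℂ), (2 : ℂ)), (t, (s, s))), x.1.1 ≠ 0 →
      M.Inc x.1.1 (Λ.φ (x.1.1, x.1.2, M.gr x.1.1 x.2.2 x.2.1)) (Γ (x.1, x.2.2)) := by
  set f : Filter ((ℂ × ℂ) × (ℂ × (ℂ × ℂ))) :=
    𝓝[{x | x.1.1 ≠ 0}] (((0 : ℂ), (2 : ℂ)), (t, (s, s))) with hf
  suffices H : ∀ᶠ x in f,
      M.Inc x.1.1 (Λ.φ (x.1.1, x.1.2, M.gr x.1.1 x.2.2 x.2.1)) (Γ (x.1, x.2.2)) from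
    eventually_nhdsWithin_iff.mp H
  have hle : f ≤ 𝓝 (((0 : ℂ), (2 : ℂ)), (t, (s, s))) := nhdsWithin_le_nhds
  have he : Filter.Tendsto (fun x : (ℂ × ℂ) × (ℂ × (ℂ × ℂ)) => x.1.1) f (𝓝[≠] 0) :=
    tendsto_param _
  have he0 := he.mono_right nhdsWithin_le_nhds
  have hx : Filter.Tendsto (fun x : (ℂ × ℂ) × (ℂ × (ℂ × ℂ)) => x) f
      (𝓝 (((0 : ℂ), (2 : ℂ)), (t, (s, s)))) := hle
  have ty := hx.fst_nhds
  have tz := hx.snd_nhds.fst_nhds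
  have tl := hx.snd_nhds.snd_nhds
  simp only at ty tz tl
  have tgr : ∀ {ζ : (ℂ × ℂ) × (ℂ × (ℂ × ℂ)) → ℂ} {δ : ℂ}, Filter.Tendsto ζ f (𝓝 δ) →
      Filter.Tendsto (fun x => M.gr x.1.1 x.2.2 (ζ x)) f (𝓝 (δ, s * (1 + δ))) := by
    intro ζ δ hζ
    exact ((M.analyticAt_gr δ (s, s)).continuousAt.tendsto_of_eq (by
      simp only [M.gr_zero]
      exact Prod.ext rfl (by ring))).comp (he0.prodMk_nhds (hζ.prodMk_nhds tl))
  have tφ : ∀ {ζ : (ℂ × ℂ) × (ℂ × (ℂ × ℂ)) → ℂ} {δ : ℂ}, Filter.Tendsto ζ f (𝓝 δ) →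
      Λ.IsGood (δ, s * (1 + δ)) →
      Filter.Tendsto (fun x => Λ.φ (x.1.1, x.1.2, M.gr x.1.1 x.2.2 (ζ x))) f
        (𝓝 (Λ.φ (0, 2, (δ, s * (1 + δ))))) := fun hζ hg =>
    hg.φ.continuousAt.tendsto.comp (he0.prodMk_nhds (ty.snd_nhds.prodMk_nhds (tgr hζ)))
  have tu : Filter.Tendsto (fun _ : (ℂ × ℂ) × (ℂ × (ℂ × ℂ)) => u) f (𝓝 u) := tendsto_const_nhds
  have tu' : Filter.Tendsto (fun _ : (ℂ × ℂ) × (ℂ × (ℂ × ℂ)) => -u) f (𝓝 (-u)) :=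
    tendsto_const_nhds
  -- Desargues is used for two pairs of points of l sharing the point B of abscissa u: with -u as
  -- second abscissa, and with the moving one.
  obtain ⟨R, k, tR, tk, hk⟩ := Λ.germ_axis hS hD ty he tl tu tu' g1 g2 k1 k2 hs hs2 hs1 hu hu1
    (neg_ne_zero.mpr hu) hu1' (fun h => hu (by linear_combination h / 2)) hus hus'
  obtain ⟨R', k', tR', tk', hk'⟩ := Λ.germ_axis hS hD ty he tl tu tz g1 g3 k1 k3 hs hs2 hs1 hu hu1
    ht ht1 hut hus hts
  have tyl := ty.prodMk_nhds tl
  have tΓ := hΓ.tendsto.comp tyl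
  have t0 : Filter.Tendsto (fun _ : (ℂ × ℂ) × (ℂ × (ℂ × ℂ)) => (0 : ℂ × ℂ)) f (𝓝 0) :=
    tendsto_const_nhds
  have a1 := g1.φ1
  have a2 := g1.φ2
  have b1 := g2.φ1
  simp only at a1 a2 b1
  filter_upwards [he.eventually self_mem_nhdsWithin, hk, hk', tyl.eventually iΓ,
    M.germ_on he tR tl, M.germ_on he tR' tl, M.germ_on he tR t0, M.germ_on he tR' t0,
    M.germ_on he (tgr tu) tl, M.germ_not_on he (tgr tu) t0 (by
      rw [M.inc_axis_zero]; exact mul_ne_zero hs hu1),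
    M.germ_on he tR tk, M.germ_on he tR' tk', M.germ_on he (tφ tu g1) tk,
    M.germ_on he (tφ tu g1) tk', M.germ_on he (tφ tu' g2) tk, M.germ_on he (tφ tz g3) tk',
    M.germ_on he (tφ tu g1) tΓ, M.germ_on he (tφ tu' g2) tΓ, M.germ_on he (tφ tz g3) tΓ,
    M.germ_ne he (tφ tu g1) tR (fun h => by
      rw [h, zero_mul] at a2
      exact mul_ne_zero two_ne_zero (mul_ne_zero hs hu1) a2.symm),
    M.germ_ne he (tφ tu g1) (tφ tu' g2) (fun h => by
      rw [← h] at b1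
      have h0 : (Λ.φ (0, 2, u, s * (1 + u))).1 * (2 - s) = 0 := by
        linear_combination (a1 + b1) / 2
      rw [(mul_eq_zero.mp h0).resolve_right hs2, zero_mul] at a1
      exact mul_ne_zero two_ne_zero hu a1.symm)]
    with x hε jk jk' jΓ oRl oRl' oR0 oR0' oBl nB oRk oRk' oBk oBk' oCk oCk' oBΓ oCΓ oDΓ nBR nBC
  -- Both R and R' are the intersection of l with the axis. The curves k and k' share this point and
  -- φ(B), so they coincide; k also equals Γ, since both contain the images of the points of
  -- abscissas u and -u. Thus Γ contains the image of the moving point.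
  have e1 := hS.eq_point oRl.2.1 oR0.2.1 (oRl.2.2.mpr jk.2.1) (oR0.2.2.mpr jk.2.2.2)
    (oRl'.2.2.mpr jk'.2.1) (oR0'.2.2.mpr jk'.2.2.2) (oBl.2.2.mpr (M.inc_gr _ _ _)) nB
  have h1 := oRk'.2.2.mpr jk'.2.2.1
  rw [On, ← e1] at h1
  have e2 := hS _ _ nBR _ oRk.2.1 _ oRk'.2.1 (oBk.2.2.mpr jk.1.1) (oRk.2.2.mpr jk.2.2.1)
    (oBk'.2.2.mpr jk'.1.1) h1
  have e3 := hS _ _ nBC _ oRk.2.1 _ oBΓ.2.1 (oBk.2.2.mpr jk.1.1) (oCk.2.2.mpr jk.1.2)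
    (oBΓ.2.2.mpr jΓ.1) (oCΓ.2.2.mpr jΓ.2)
  refine oDΓ.2.2.mp ?_
  have h2 := oCk'.2.2.mpr jk'.1.2
  rw [On, ← e2, e3] at h2
  exact h2

/-- `φ` maps lines close to the axis to lines. -/
theorem Elation.preserves_lines {M : S.LineModel c₁} (Λ : M.Elation) (hS : S.TwoPointUnique)
    (hD : S.HasDesargues) : ∃ Γ : (ℂ × ℂ) × (ℂ × ℂ) → ℂ × ℂ, ContinuousAt Γ ((0, 2), 0) ∧
      Γ ((0, 2), 0) = 0 ∧
      ∀ᶠ x in 𝓝 (((0 : ℂ), (2 : ℂ)), ((0 : ℂ), (0 : ℂ × ℂ))), x.1.1 ≠ 0 →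
        M.Inc x.1.1 (Λ.φ (x.1.1, x.1.2, M.gr x.1.1 x.2.2 x.2.1)) (Γ (x.1, x.2.2)) := by
  have good := Λ.eventually_isGood
  have pen := (Λ.preserves_pencil hS hD).eventually_nhds
  have pen' : ∀ᶠ y in 𝓝 (0 : ℂ × ℂ), ∀ᶠ x in 𝓝 (((0 : ℂ), (2 : ℂ)), y), x.1.1 ≠ 0 →
      M.Inc x.1.1 (Λ.φ (x.1.1, x.1.2, M.pt x.2.2 x.1.1 x.2.1)) (0, x.2.2) :=
    ((by fun_prop : Continuous fun y : ℂ × ℂ => (((0 : ℂ), (2 : ℂ)), y)).tendsto 0).eventually pen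
  -- The abscissa u is fixed and nonzero, and all conditions hold near the axis points (u, 0) and
  -- (-u, 0). Hence they are available for every l close enough to the axis, and Γ does not depend
  -- on the generic base point.
  obtain ⟨u, ⟨hgood, hpen⟩, ⟨hgood', hpen'⟩, hu1, hu1', hu⟩ :
      ∃ u : ℂ, ((∀ᶠ p in 𝓝 (u, (0 : ℂ)), Λ.IsGood p) ∧
        ∀ᶠ y in 𝓝 (u, (0 : ℂ)), ∀ᶠ x in 𝓝 (((0 : ℂ), (2 : ℂ)), y), x.1.1 ≠ 0 →
          M.Inc x.1.1 (Λ.φ (x.1.1, x.1.2, M.pt x.2.2 x.1.1 x.2.1)) (0, x.2.2)) ∧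
        ((∀ᶠ p in 𝓝 (-u, (0 : ℂ)), Λ.IsGood p) ∧
        ∀ᶠ y in 𝓝 (-u, (0 : ℂ)), ∀ᶠ x in 𝓝 (((0 : ℂ), (2 : ℂ)), y), x.1.1 ≠ 0 →
          M.Inc x.1.1 (Λ.φ (x.1.1, x.1.2, M.pt x.2.2 x.1.1 x.2.1)) (0, x.2.2)) ∧
        1 + u ≠ 0 ∧ 1 + -u ≠ 0 ∧ u ≠ 0 := by
    have h := good.eventually_nhds.and pen'.eventually_nhds
    have t1 : Filter.Tendsto (fun u : ℂ => (u, (0 : ℂ))) (𝓝[≠] 0) (𝓝 0) :=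
      ((by fun_prop : Continuous fun u : ℂ => (u, (0 : ℂ))).tendsto 0).mono_left nhdsWithin_le_nhds
    have t2 : Filter.Tendsto (fun u : ℂ => (-u, (0 : ℂ))) (𝓝[≠] 0) (𝓝 0) := by
      refine (ContinuousAt.tendsto_of_eq (a := (0 : ℂ)) (by fun_prop) ?_).mono_left
        nhdsWithin_le_nhds
      simp
    have h3 : ∀ᶠ u : ℂ in 𝓝[≠] 0, 1 + u ≠ 0 := nhdsWithin_le_nhds <|
      (by fun_prop : ContinuousAt (fun u : ℂ => 1 + u) 0).eventually_ne (by simp)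
    have h4 : ∀ᶠ u : ℂ in 𝓝[≠] 0, 1 + -u ≠ 0 := nhdsWithin_le_nhds <|
      (by fun_prop : ContinuousAt (fun u : ℂ => 1 + -u) 0).eventually_ne (by simp)
    exact ((t1.eventually h).and ((t2.eventually h).and (h3.and (h4.and
      self_mem_nhdsWithin)))).exists
  have an : ∀ v : ℂ, Λ.IsGood (v, 0) → AnalyticAt ℂ (fun x : (ℂ × ℂ) × (ℂ × ℂ) =>
      Λ.φ (x.1.1, x.1.2, M.gr x.1.1 x.2 v)) ((0, 2), 0) ∧ Λ.φ (0, 2, M.gr 0 0 v) = (v, 0) := by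
    intro v hv
    have h0 : M.gr 0 0 v = (v, 0) := (M.gr_zero _ _).trans (by simp)
    have h1 : AnalyticAt ℂ (fun x : (ℂ × ℂ) × (ℂ × ℂ) => M.gr x.1.1 x.2 v) ((0, 2), 0) :=
      AnalyticAt.comp (g := fun y : ℂ × ℂ × ℂ × ℂ => M.gr y.1 y.2.2 y.2.1)
        (f := fun x : (ℂ × ℂ) × (ℂ × ℂ) => (x.1.1, v, x.2)) (M.analyticAt_gr v 0) (by fun_prop)
    refine ⟨AnalyticAt.comp (g := Λ.φ) (f := fun x : (ℂ × ℂ) × (ℂ × ℂ) =>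
      (x.1.1, x.1.2, M.gr x.1.1 x.2 v)) ?_ (by fun_prop), ?_⟩
    · simp only [h0]
      exact hv.φ
    · have h2 := hv.φ1
      have h3 := hv.φ2
      simp only [sub_zero, mul_zero] at h2 h3
      rw [h0]
      exact Prod.ext (by linear_combination h2 / 2) (by linear_combination h3 / 2)
  obtain ⟨an1, v1⟩ := an u hgood.self_of_nhds
  obtain ⟨an2, v2⟩ := an (-u) hgood'.self_of_nhds
  obtain ⟨Γ, hΓ, hΓ0, iΓ⟩ := M.join_analytic (l := 0) (e := fun x : (ℂ × ℂ) × (ℂ × ℂ) => x.1.1)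
    (by fun_prop) rfl an1 an2 (by simp only [v1, M.inc_axis_zero]) (by simp only [v2, M.inc_axis_zero])
    (by simp only [v1, v2]; exact fun h => hu (by linear_combination h / 2))
  refine ⟨Γ, hΓ.continuousAt, hΓ0, ?_⟩
  let X : (ℂ × ℂ) × (ℂ × (ℂ × ℂ)) → ℂ × ℂ × ℂ × ℂ := fun x =>
    (x.1.1, x.1.2, M.gr x.1.1 x.2.2 x.2.1)
  have hX : AnalyticAt ℂ X ((0, 2), 0) := by
    have : AnalyticAt ℂ (fun x : (ℂ × ℂ) × (ℂ × (ℂ × ℂ)) => M.gr x.1.1 x.2.2 x.2.1) ((0, 2), 0) :=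
      AnalyticAt.comp (g := fun y : ℂ × ℂ × ℂ × ℂ => M.gr y.1 y.2.2 y.2.1)
        (f := fun x : (ℂ × ℂ) × (ℂ × (ℂ × ℂ)) => (x.1.1, x.2.1, x.2.2)) (M.analyticAt_gr 0 0)
        (by fun_prop)
    fun_prop
  have hX0 : X ((0, 2), 0) = (0, 2, 0) := by simp [X, M.gr_zero]
  have hφ : AnalyticAt ℂ (fun x => Λ.φ (X x)) ((0, 2), 0) := by
    refine AnalyticAt.comp (g := Λ.φ) (f := X) ?_ hX
    rw [hX0]; exact Λ.φ_an
  have hφ0 : Λ.φ (X ((0, 2), 0)) = 0 := by rw [hX0, Λ.φ_val]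
  have hΓ' : AnalyticAt ℂ (fun x : (ℂ × ℂ) × (ℂ × (ℂ × ℂ)) => Γ (x.1, x.2.2)) ((0, 2), 0) :=
    AnalyticAt.comp (g := Γ) (f := fun x : (ℂ × ℂ) × (ℂ × (ℂ × ℂ)) => (x.1, x.2.2)) hΓ
      (by fun_prop)
  have hΨ : AnalyticAt ℂ (fun x : (ℂ × ℂ) × (ℂ × (ℂ × ℂ)) =>
      M.Ψ (x.1.1, (Λ.φ (X x)).1, Γ (x.1, x.2.2))) ((0, 2), 0) :=
    AnalyticAt.comp (g := M.Ψ) (f := fun x : (ℂ × ℂ) × (ℂ × (ℂ × ℂ)) =>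
      (x.1.1, (Λ.φ (X x)).1, Γ (x.1, x.2.2))) (M.analyticAt _) (by fun_prop)
  have hH : AnalyticAt ℂ (fun x : (ℂ × ℂ) × (ℂ × (ℂ × ℂ)) =>
      (Λ.φ (X x)).2 - M.Ψ (x.1.1, (Λ.φ (X x)).1, Γ (x.1, x.2.2))) ((0, 2), 0) := by fun_prop
  have hgen : ∃ᶠ y in 𝓝 (0 : ℂ × (ℂ × ℂ)), ∀ᶠ x in 𝓝 (((0 : ℂ), (2 : ℂ)), y), x.1.1 ≠ 0 →
      M.Inc x.1.1 (Λ.φ (x.1.1, x.1.2, M.gr x.1.1 x.2.2 x.2.1)) (Γ (x.1, x.2.2)) := by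
    -- Generic base: the line w = s(1 + z) with s = t² and the point of abscissa t. The line joining
    -- this point to O then has slope t(1 + t), which tends to 0 as the invariance of the pencil
    -- requires; with s = t it would not.
    have ht : Filter.Tendsto (fun t : ℂ => (t, (t ^ 2, t ^ 2))) (𝓝[≠] 0) (𝓝 0) := by
      refine (ContinuousAt.tendsto_of_eq (a := (0 : ℂ)) (by fun_prop) ?_).mono_left
        nhdsWithin_le_nhds
      simp
    refine ht.frequently (Filter.Eventually.frequently ?_)
    have tend : ∀ {G : Type} [TopologicalSpace G] {g : ℂ → G} {y : G}, ContinuousAt g 0 → g 0 = y →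
        Filter.Tendsto g (𝓝[≠] 0) (𝓝 y) := fun hg hy =>
      (hg.tendsto_of_eq hy).mono_left nhdsWithin_le_nhds
    have ne : ∀ {g : ℂ → ℂ}, ContinuousAt g 0 → g 0 ≠ 0 → ∀ᶠ t in 𝓝[≠] 0, g t ≠ 0 :=
      fun hg h0 => nhdsWithin_le_nhds (hg.eventually_ne h0)
    have tl : Filter.Tendsto (fun t : ℂ => (((0 : ℂ), (2 : ℂ)), (t ^ 2, t ^ 2))) (𝓝[≠] 0)
      (𝓝 ((0, 2), 0)) := tend (by fun_prop) (by simp)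
    filter_upwards [self_mem_nhdsWithin, tl.eventually hΓ.eventually_analyticAt,
      tl.eventually iΓ.eventually_nhds,
      (tend (g := fun t : ℂ => (u, t ^ 2 * (1 + u))) (by fun_prop) (by simp)).eventually hgood,
      (tend (g := fun t : ℂ => (-u, t ^ 2 * (1 + -u))) (by fun_prop) (by simp)).eventually hgood',
      (tend (g := fun t : ℂ => (t, t ^ 2 * (1 + t))) (y := 0) (by fun_prop) (by simp)).eventually
        good,
      (tend (g := fun t : ℂ => (u, t ^ 2 * (1 + u) / u)) (by fun_prop) (by simp)).eventually hpen,
      (tend (g := fun t : ℂ => (-u, t ^ 2 * (1 + -u) / -u)) (by fun_prop) (by simp)).eventually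
        hpen',
      (tend (g := fun t : ℂ => (t, t * (1 + t))) (y := 0) (by fun_prop) (by simp)).eventually pen',
      ne (g := fun t : ℂ => 2 - t ^ 2) (by fun_prop) (by simp),
      ne (g := fun t : ℂ => 1 - 2 * t ^ 2) (by fun_prop) (by simp),
      ne (g := fun t : ℂ => 1 + t) (by fun_prop) (by simp),
      ne (g := fun t : ℂ => u - t) (by fun_prop) (by simpa),
      ne (g := fun t : ℂ => t ^ 2 * (1 + u) - u) (by fun_prop) (by simpa),
      ne (g := fun t : ℂ => t ^ 2 * (1 + -u) - -u) (by fun_prop) (by simpa),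
      ne (g := fun t : ℂ => t * (1 + t) - 1) (by fun_prop) (by simp)]
      with t ht a1 a2 a3 a4 a5 a6 a7 a8 n1 n2 n3 n4 n5 n6 n7
    have ht0 : t ≠ 0 := ht
    have e : t ^ 2 * (1 + t) / t = t * (1 + t) := by field_simp
    refine Λ.preserves_line_generic hS hD a1.continuousAt a2 a3 a4 a5 a6 a7 (by rw [e]; exact a8)
      (pow_ne_zero 2 ht0) n1 n2 hu hu1 hu1' ht0 n3 (sub_ne_zero.mp n4) (sub_ne_zero.mp n5)
      (sub_ne_zero.mp n6) (fun h => ?_)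
    have : t * (t * (1 + t) - 1) = 0 := by linear_combination h
    exact mul_ne_zero ht0 n7 this
  have := hH.eventually_eq_zero_of_frequently (P := fun a => a.1 ≠ 0)
    (hgen.mono fun y hy => by
      filter_upwards [hy] with x hx hε
      exact sub_eq_zero.mpr (hx hε))
  filter_upwards [this] with x hx hε
  exact sub_eq_zero.mp (hx hε)

/-! ### Local invertibility and the derivative at O. -/

theorem Elation.hasFDerivAt_slice {M : S.LineModel c₁} (Λ : M.Elation) :
    HasFDerivAt (fun p : ℂ × ℂ => Λ.φ (0, 2, p)) (ContinuousLinearMap.id ℂ (ℂ × ℂ)) 0 := by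
  have hc : DifferentiableAt ℂ (fun p : ℂ × ℂ => 2 / (2 - p.2)) 0 :=
    (DifferentiableAt.inv (h := fun p : ℂ × ℂ => 2 - p.2) (by fun_prop) (by simp)).const_mul 2
  have h := hc.hasFDerivAt.smul (hasFDerivAt_id (𝕜 := ℂ) (0 : ℂ × ℂ))
  have h' : HasFDerivAt (fun p : ℂ × ℂ => (2 / (2 - p.2)) • p)
      (ContinuousLinearMap.id ℂ (ℂ × ℂ)) 0 := by
    refine h.congr_fderiv ?_
    ext <;> simp
  refine h'.congr_of_eventuallyEq ?_
  have h2 : ∀ᶠ p : ℂ × ℂ in 𝓝 0, 2 - p.2 ≠ 0 :=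
    (by fun_prop : ContinuousAt (fun p : ℂ × ℂ => 2 - p.2) 0).eventually_ne (by norm_num)
  filter_upwards [Λ.formula, h2] with p ⟨_, _, _, _, h5, h6⟩ h2
  ext
  · simp only [Prod.smul_fst, smul_eq_mul]
    field_simp
    exact h5
  · simp only [Prod.smul_snd, smul_eq_mul]
    field_simp
    exact h6

/-- `φ (ε, r, ·)` has a local inverse `ψ (ε, r, ·)`. -/
theorem Elation.exists_inverse {M : S.LineModel c₁} (Λ : M.Elation) :
    ∃ ψ : ℂ × ℂ × ℂ × ℂ → ℂ × ℂ, AnalyticAt ℂ ψ (0, 2, 0) ∧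
      ∀ᶠ x in 𝓝 (((0 : ℂ), (2 : ℂ), (0 : ℂ × ℂ)), (0 : ℂ × ℂ)),
        Λ.φ (x.1.1, x.1.2.1, x.2) = x.1.2.2 ↔ x.2 = ψ x.1 := by
  let G : (ℂ × ℂ × ℂ × ℂ) × (ℂ × ℂ) → ℂ × ℂ := fun x => Λ.φ (x.1.1, x.1.2.1, x.2) - x.1.2.2
  have hG : AnalyticAt ℂ G ((0, 2, 0), 0) := by
    have : AnalyticAt ℂ (fun x : (ℂ × ℂ × ℂ × ℂ) × (ℂ × ℂ) => Λ.φ (x.1.1, x.1.2.1, x.2))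
        ((0, 2, 0), 0) :=
      AnalyticAt.comp (g := Λ.φ) (f := fun x : (ℂ × ℂ × ℂ × ℂ) × (ℂ × ℂ) =>
        (x.1.1, x.1.2.1, x.2)) Λ.φ_an (by fun_prop)
    fun_prop
  obtain ⟨ψ, hψ, -, h⟩ := hG.exists_implicit (by simp [G, Λ.φ_val])
    (A := ContinuousLinearMap.id ℂ (ℂ × ℂ)) (Λ.hasFDerivAt_slice.sub_const _)
    (fun _ _ h => h)
  refine ⟨ψ, hψ, ?_⟩
  filter_upwards [h] with x hx
  rw [← hx, sub_eq_zero]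

/-- Over a fixed abscissa, the equation saying that φ(p) lies on a given curve has derivative 1 in
the ordinate at the base. The unique solvability turns the inclusion of the image of a curve in
another curve into an equivalence. -/
theorem Elation.exists_ordinate {M : S.LineModel c₁} (Λ : M.Elation) :
    ∃ g : (ℂ × ℂ) × ℂ × (ℂ × ℂ) → ℂ,
      ∀ᶠ x in 𝓝 ((((0 : ℂ), (2 : ℂ)), (0 : ℂ), (0 : ℂ × ℂ)), (0 : ℂ)),
        M.Inc x.1.1.1 (Λ.φ (x.1.1.1, x.1.1.2, (x.1.2.1, x.2))) x.1.2.2 ↔ x.2 = g x.1 := by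
  let X : ((ℂ × ℂ) × ℂ × (ℂ × ℂ)) × ℂ → ℂ × ℂ := fun x => Λ.φ (x.1.1.1, x.1.1.2, (x.1.2.1, x.2))
  have hX : AnalyticAt ℂ X (((0, 2), 0, 0), 0) :=
    AnalyticAt.comp (g := Λ.φ) (f := fun x : ((ℂ × ℂ) × ℂ × (ℂ × ℂ)) × ℂ =>
      (x.1.1.1, x.1.1.2, (x.1.2.1, x.2))) Λ.φ_an (by fun_prop)
  have hΨ : AnalyticAt ℂ (fun x : ((ℂ × ℂ) × ℂ × (ℂ × ℂ)) × ℂ =>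
      M.Ψ (x.1.1.1, (X x).1, x.1.2.2)) (((0, 2), 0, 0), 0) :=
    AnalyticAt.comp (g := M.Ψ) (f := fun x : ((ℂ × ℂ) × ℂ × (ℂ × ℂ)) × ℂ =>
      (x.1.1.1, (X x).1, x.1.2.2)) (M.analyticAt _) (by fun_prop)
  let G : ((ℂ × ℂ) × ℂ × (ℂ × ℂ)) × ℂ → ℂ := fun x =>
    (X x).2 - M.Ψ (x.1.1.1, (X x).1, x.1.2.2)
  have hG : AnalyticAt ℂ G (((0, 2), 0, 0), 0) := by fun_prop
  have hG' : ∀ w, G (((0, 2), 0, 0), w) = (Λ.φ (0, 2, (0, w))).2 := by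
    intro w
    have : M.Ψ (0, (X (((0, 2), 0, 0), w)).1, 0) = 0 := by
      exact (M.Ψ_zero (X (((0, 2), 0, 0), w)).1 0 0).trans (by simp)
    simp only [G, this, sub_zero, X]
  have hd : HasDerivAt (fun w => G (((0, 2), 0, 0), w)) 1 0 := by
    simp only [hG']
    have h1 : HasDerivAt (fun w : ℂ => ((0 : ℂ), w)) (0, 1) 0 :=
      (hasDerivAt_const _ _).prodMk (hasDerivAt_id _)
    have h2 := HasFDerivAt.comp_hasDerivAt (f := fun w : ℂ => ((0 : ℂ), w))
      (l := fun p : ℂ × ℂ => Λ.φ (0, 2, p)) (0 : ℂ) Λ.hasFDerivAt_slice h1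
    exact (hasFDerivAt_snd (𝕜 := ℂ)).comp_hasDerivAt (0 : ℂ) h2
  obtain ⟨g, -, -, h⟩ := hG.exists_implicit_scalar
    ((hG' 0).trans (congrArg Prod.snd Λ.φ_val)) hd one_ne_zero
  refine ⟨g, ?_⟩
  filter_upwards [h] with x hx
  rw [← hx, sub_eq_zero]
  rfl

/-- If `φ` maps the line `l` to the line `l'`, then it maps no other point to `l'`. -/
theorem Elation.inc_iff {M : S.LineModel c₁} (Λ : M.Elation) :
    ∀ᶠ x in 𝓝 (((0 : ℂ), (2 : ℂ)), (0 : ℂ × ℂ), (0 : ℂ × ℂ), (0 : ℂ × ℂ)),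
      M.Inc x.1.1 (Λ.φ (x.1.1, x.1.2, M.gr x.1.1 x.2.2.1 x.2.1.1)) x.2.2.2 →
      (M.Inc x.1.1 (Λ.φ (x.1.1, x.1.2, x.2.1)) x.2.2.2 ↔ M.Inc x.1.1 x.2.1 x.2.2.1) := by
  obtain ⟨g, hg⟩ := Λ.exists_ordinate
  have t1 : Filter.Tendsto (fun x : (ℂ × ℂ) × (ℂ × ℂ) × (ℂ × ℂ) × (ℂ × ℂ) =>
      ((x.1, x.2.1.1, x.2.2.2), x.2.1.2)) (𝓝 ((0, 2), 0, 0, 0)) (𝓝 (((0, 2), 0, 0), 0)) :=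
    (by fun_prop : Continuous _).tendsto _
  have t2 : Filter.Tendsto (fun x : (ℂ × ℂ) × (ℂ × ℂ) × (ℂ × ℂ) × (ℂ × ℂ) =>
      ((x.1, x.2.1.1, x.2.2.2), M.Ψ (x.1.1, x.2.1.1, x.2.2.1))) (𝓝 ((0, 2), 0, 0, 0))
      (𝓝 (((0, 2), 0, 0), 0)) := by
    have h1 : AnalyticAt ℂ (fun x : (ℂ × ℂ) × (ℂ × ℂ) × (ℂ × ℂ) × (ℂ × ℂ) =>
        M.Ψ (x.1.1, x.2.1.1, x.2.2.1)) ((0, 2), 0, 0, 0) :=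
      AnalyticAt.comp (g := M.Ψ) (f := fun x : (ℂ × ℂ) × (ℂ × ℂ) × (ℂ × ℂ) × (ℂ × ℂ) =>
        (x.1.1, x.2.1.1, x.2.2.1)) (M.analyticAt _) (by fun_prop)
    refine ContinuousAt.tendsto_of_eq (ContinuousAt.prodMk (by fun_prop) h1.continuousAt) ?_
    exact Prod.ext rfl ((M.Ψ_zero 0 0 0).trans (by simp))
  filter_upwards [t1.eventually hg, t2.eventually hg] with x h1 h2 h
  have h3 := h2.mp h
  rw [show Λ.φ (x.1.1, x.1.2, x.2.1) = Λ.φ (x.1.1, x.1.2, (x.2.1.1, x.2.1.2)) from rfl, h1, Inc, h3]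

theorem Elation.inc_pencil_iff {M : S.LineModel c₁} (Λ : M.Elation) (hS : S.TwoPointUnique)
    (hD : S.HasDesargues) :
    ∀ᶠ x in 𝓝 (((0 : ℂ), (2 : ℂ)), (0 : ℂ × ℂ), (0 : ℂ × ℂ)), x.1.1 ≠ 0 → x.2.2.1 = 0 →
      (M.Inc x.1.1 (Λ.φ (x.1.1, x.1.2, x.2.1)) x.2.2 ↔ M.Inc x.1.1 x.2.1 x.2.2) := by
  have t1 : Filter.Tendsto (fun x : (ℂ × ℂ) × (ℂ × ℂ) × (ℂ × ℂ) => (x.1, (x.2.1.1, x.2.2.2)))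
      (𝓝 ((0, 2), 0, 0)) (𝓝 ((0, 2), 0)) := (by fun_prop : Continuous _).tendsto _
  have t2 : Filter.Tendsto (fun x : (ℂ × ℂ) × (ℂ × ℂ) × (ℂ × ℂ) => (x.1, x.2.1, x.2.2, x.2.2))
      (𝓝 ((0, 2), 0, 0)) (𝓝 ((0, 2), 0, 0, 0)) := (by fun_prop : Continuous _).tendsto _
  filter_upwards [t1.eventually (Λ.preserves_pencil hS hD), t2.eventually Λ.inc_iff]
    with x h1 h2 hε hl
  obtain ⟨y, p, b, m⟩ := x
  simp only at hl
  subst hl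
  exact h2 (h1 hε)

/-- Fixing the axis makes the derivative fix (1, 0). Preserving the curves through O makes every (1,
m) with small m an eigenvector. A linear map of the plane with these properties and eigenvalue 1 on
(1, 0) is the identity. -/
theorem Elation.eventually_hasFDerivAt {M : S.LineModel c₁} (Λ : M.Elation) (hS : S.TwoPointUnique)
    (hD : S.HasDesargues) : ∀ᶠ y in 𝓝 ((0 : ℂ), (2 : ℂ)), y.1 ≠ 0 →
      HasFDerivAt (fun p : ℂ × ℂ => Λ.φ (y.1, y.2, p)) (ContinuousLinearMap.id ℂ (ℂ × ℂ)) 0 := by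
  have t1 : Filter.Tendsto (fun y : ℂ × ℂ => (y.1, y.2, (0 : ℂ × ℂ))) (𝓝 (0, 2)) (𝓝 (0, 2, 0)) :=
    (by fun_prop : Continuous _).tendsto _
  have h2 : ∀ᶠ y in 𝓝 ((0 : ℂ), (2 : ℂ)), ∀ᶠ z in 𝓝 (0 : ℂ), y.1 ≠ 0 →
      Λ.φ (y.1, y.2, (z, 0)) = (z, 0) := (Λ.fixes_axis hS).curry_nhds
  have h3 : ∀ᶠ y in 𝓝 ((0 : ℂ), (2 : ℂ)), ∀ᶠ m in 𝓝 (0 : ℂ), ∀ᶠ z in 𝓝 (0 : ℂ), y.1 ≠ 0 →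
      M.Inc y.1 (Λ.φ (y.1, y.2, M.pt m y.1 z)) (0, m) := by
    have t : Filter.Tendsto (fun x : (ℂ × ℂ) × ℂ => (x.1, ((0 : ℂ), x.2))) (𝓝 ((0, 2), 0))
      (𝓝 ((0, 2), 0)) := (by fun_prop : Continuous _).tendsto _
    refine (?_ : ∀ᶠ x in 𝓝 (((0 : ℂ), (2 : ℂ)), (0 : ℂ)), ∀ᶠ z in 𝓝 (0 : ℂ), x.1.1 ≠ 0 →
      M.Inc x.1.1 (Λ.φ (x.1.1, x.1.2, M.pt x.2 x.1.1 z)) (0, x.2)).curry_nhds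
    filter_upwards [t.eventually (Λ.preserves_pencil hS hD).eventually_nhds] with x hx
    exact ((by fun_prop : Continuous fun z : ℂ => (x.1, (z, x.2))).tendsto 0).eventually hx
  have h4 : ∀ᶠ y in 𝓝 ((0 : ℂ), (2 : ℂ)), ∀ᶠ m in 𝓝 (0 : ℂ),
      HasDerivAt (fun z => M.Ψ (y.1, z, 0, m)) m 0 := by
    have t : Filter.Tendsto (fun x : (ℂ × ℂ) × ℂ => (x.1.1, x.2)) (𝓝 ((0, 2), 0)) (𝓝 0) :=
      (by fun_prop : Continuous _).tendsto _
    exact (t.eventually M.hasDerivAt).curry_nhds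
  have h5 : ∀ᶠ y in 𝓝 ((0 : ℂ), (2 : ℂ)), ∀ᶠ m in 𝓝 (0 : ℂ), M.Ψ (y.1, 0, 0, m) = 0 := by
    have t : Filter.Tendsto (fun x : (ℂ × ℂ) × ℂ => (x.1.1, (0 : ℂ), x.2)) (𝓝 ((0, 2), 0))
      (𝓝 (0, 0)) := (by fun_prop : Continuous _).tendsto _
    exact (t.eventually (M.Ψ_left 0)).curry_nhds
  filter_upwards [t1.eventually Λ.φ_an.eventually_analyticAt, h2, h3, h4, h5]
    with y han hax hpen hder hleft hε
  set F : ℂ × ℂ → ℂ × ℂ := fun p => Λ.φ (y.1, y.2, p) with hF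
  have hFan : AnalyticAt ℂ F 0 :=
    AnalyticAt.comp (g := Λ.φ) (f := fun p : ℂ × ℂ => (y.1, y.2, p)) han (by fun_prop)
  have hFd := hFan.differentiableAt.hasFDerivAt
  set A := fderiv ℂ F 0 with hA
  have hF0 : F 0 = 0 := hax.self_of_nhds hε
  have e1 : A (1, 0) = (1, 0) := by
    have d1 : HasDerivAt (fun z : ℂ => (z, (0 : ℂ))) (1, 0) 0 :=
      (hasDerivAt_id _).prodMk (hasDerivAt_const _ _)
    have d2 := HasFDerivAt.comp_hasDerivAt (l := F) (f := fun z : ℂ => (z, (0 : ℂ))) (0 : ℂ) hFd d1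
    exact d2.unique (d1.congr_of_eventuallyEq (hax.mono fun z hz => hz hε))
  -- This is the eigenvector condition for (1, m), divided by m. It is affine in m, so its validity
  -- for all small m ≠ 0 determines both entries.
  have e2 : ∀ᶠ m in 𝓝[≠] (0 : ℂ), (A (0, 1)).2 = 1 + m * (A (0, 1)).1 := by
    filter_upwards [nhdsWithin_le_nhds hpen, nhdsWithin_le_nhds hder, nhdsWithin_le_nhds hleft,
      self_mem_nhdsWithin] with m hp hd hl hm
    have p0 : M.pt m y.1 0 = 0 := Prod.ext rfl hl
    have d1 : HasDerivAt (fun z : ℂ => M.pt m y.1 z) (1, m) 0 := (hasDerivAt_id _).prodMk hd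
    have d2 : HasDerivAt (fun z : ℂ => F (M.pt m y.1 z)) (A (1, m)) 0 :=
      HasFDerivAt.comp_hasDerivAt (l := F) (f := fun z : ℂ => M.pt m y.1 z) (0 : ℂ)
        (by rw [p0]; exact hFd) d1
    have d3 := (hasFDerivAt_fst (𝕜 := ℂ)).comp_hasDerivAt (0 : ℂ) d2
    have d4 := (hasFDerivAt_snd (𝕜 := ℂ)).comp_hasDerivAt (0 : ℂ) d2
    have d5 := HasDerivAt.comp (h₂ := fun z => M.Ψ (y.1, z, 0, m))
      (h := fun z : ℂ => (F (M.pt m y.1 z)).1) (0 : ℂ) (by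
        simp only [p0, hF0]
        exact hd) d3
    have d6 := d4.unique (d5.congr_of_eventuallyEq (hp.mono fun z hz => hz hε))
    have d7 : A (1, m) = (1 + m * (A (0, 1)).1, m * (A (0, 1)).2) := by
      have : ((1 : ℂ), m) = (1, 0) + m • (0, 1) := by simp
      rw [this, map_add, map_smul, e1]
      simp [Prod.ext_iff]
    rw [d7] at d6
    exact mul_left_cancel₀ hm d6
  have e3 : (A (0, 1)).2 = 1 ∧ (A (0, 1)).1 = 0 := by
    have c1 : (A (0, 1)).2 = 1 := by
      have t : Filter.Tendsto (fun m : ℂ => 1 + m * (A (0, 1)).1) (𝓝[≠] 0) (𝓝 1) :=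
        (ContinuousAt.tendsto_of_eq (a := (0 : ℂ)) (by fun_prop) (by simp)).mono_left
          nhdsWithin_le_nhds
      exact tendsto_nhds_unique (tendsto_const_nhds.congr' e2) t
    refine ⟨c1, ?_⟩
    obtain ⟨m, hm, hm0⟩ := (e2.and self_mem_nhdsWithin).exists
    rw [c1] at hm
    have : m * (A (0, 1)).1 = 0 := by linear_combination -hm
    exact (mul_eq_zero.mp this).resolve_left hm0
  refine hFd.congr_fderiv ?_
  ext
  · simp [e1]
  · simp [e1]
  · simp [e3.2]
  · simp [e3.1]

end LineModel

end TransverseFamily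

/-! ### Nondegeneracy, transport to `U` and assembly of the family. -/

/-- The conjugate of a biholomorphism `f : W → T` with inverse `g` by a bijection `θ`. -/
theorem OpenPartialHomeomorph.exists_conj {E : Type*} [NormedAddCommGroup E] [NormedSpace ℂ E]
    {θ θi f g : E → E} {N W T : Set E} (hl : ∀ p, θi (θ p) = p) (hr : ∀ p, θ (θi p) = p)
    (hθ : ∀ p ∈ N, AnalyticAt ℂ θ p) (hθi : ∀ p ∈ N, AnalyticAt ℂ θi (θ p))
    (hWN : W ⊆ N) (hTN : T ⊆ N) (hW : IsOpen W) (hT : IsOpen T)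
    (hf : ∀ p ∈ W, AnalyticAt ℂ f p) (hg : ∀ p ∈ T, AnalyticAt ℂ g p)
    (hfT : ∀ p ∈ W, f p ∈ T) (hgW : ∀ p ∈ T, g p ∈ W)
    (hgf : ∀ p ∈ W, g (f p) = p) (hfg : ∀ p ∈ T, f (g p) = p) :
    ∃ e : OpenPartialHomeomorph E E, e.source = θi ⁻¹' W ∧ e.target = θi ⁻¹' T ∧
      (∀ x, e x = θ (f (θi x))) ∧ AnalyticOnNhd ℂ e e.source ∧
      AnalyticOnNhd ℂ e.symm e.target := by
  have hopen : ∀ {Z : Set E}, IsOpen Z → Z ⊆ N → IsOpen (θi ⁻¹' Z) := by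
    intro Z hZ hZN
    rw [isOpen_iff_mem_nhds]
    intro x hx
    have h := (hθi _ (hZN hx)).continuousAt
    rw [hr] at h
    exact h.preimage_mem_nhds (hZ.mem_nhds hx)
  have han : ∀ {Z Z' : Set E} {h : E → E}, Z ⊆ N → Z' ⊆ N → (∀ p ∈ Z, AnalyticAt ℂ h p) →
      (∀ p ∈ Z, h p ∈ Z') → AnalyticOnNhd ℂ (fun x => θ (h (θi x))) (θi ⁻¹' Z) := by
    intro Z Z' h hZ hZ' hh hm x hx
    have h1 := hθi _ (hZ hx)
    rw [hr] at h1
    exact AnalyticAt.fun_comp (hθ _ (hZ' (hm _ hx))) ((hh _ hx).fun_comp h1)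
  have a1 := han hWN hTN hf hfT
  have a2 := han hTN hWN hg hgW
  refine ⟨{ toFun := fun x => θ (f (θi x))
            invFun := fun x => θ (g (θi x))
            source := θi ⁻¹' W
            target := θi ⁻¹' T
            map_source' := fun x hx => ?_
            map_target' := fun x hx => ?_
            left_inv' := fun x hx => ?_
            right_inv' := fun x hx => ?_
            open_source := hopen hW hWN
            open_target := hopen hT hTN
            continuousOn_toFun := a1.continuousOn
            continuousOn_invFun := a2.continuousOn }, rfl, rfl, fun _ => rfl, a1, a2⟩
  · rw [Set.mem_preimage, hl]; exact hfT _ hx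
  · rw [Set.mem_preimage, hl]; exact hgW _ hx
  · simp only [hl, hgf _ hx, hr]
  · simp only [hl, hfg _ hx, hr]

namespace TransverseFamily

variable {S : TransverseFamily} {c₁ : ℂ × ℂ}

namespace LineModel

/-- The configuration defining `φ` at `x = (ε, r, p)` is nondegenerate and realized by curves
of the family. -/
structure Elation.IsConf {M : S.LineModel c₁} (Λ : M.Elation) (x : ℂ × ℂ × ℂ × ℂ) : Prop where
  ne_zero : x.1 ≠ 0
  ne_one : (1 : ℂ) ≠ x.2.1
  ne_abscissa : x.2.2.1 ≠ 1
  mem_A : M.κ x.1 (Λ.lA x) ∈ S.V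
  mem_A' : M.κ x.1 (Λ.lA' x) ∈ S.V
  mem_axis : M.κ x.1 0 ∈ S.V
  mem_one : M.κ x.1 (0, 1) ∈ S.V
  A_lA : M.On x.1 (M.pt 1 x.1 1) (Λ.lA x)
  p_lA : M.On x.1 x.2.2 (Λ.lA x)
  P_lA : M.On x.1 (Λ.P x) (Λ.lA x)
  P_axis : M.On x.1 (Λ.P x) 0
  A'_lA' : M.On x.1 (M.pt 1 x.1 x.2.1) (Λ.lA' x)
  P_lA' : M.On x.1 (Λ.P x) (Λ.lA' x)
  φ_lA' : M.On x.1 (Λ.φ x) (Λ.lA' x)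
  A_one : M.On x.1 (M.pt 1 x.1 1) (0, 1)
  A'_one : M.On x.1 (M.pt 1 x.1 x.2.1) (0, 1)
  zero_axis : M.On x.1 0 0
  zero_one : M.On x.1 0 (0, 1)
  A_axis : ¬ M.On x.1 (M.pt 1 x.1 1) 0
  φ_axis : M.On x.1 (Λ.φ x) 0 → x.2.2.2 = 0
  p_one : x.2.2.1 = 0 → M.On x.1 x.2.2 (0, 1) → x.2.2.2 = 0

theorem Elation.eventually_isConf {M : S.LineModel c₁} (Λ : M.Elation) (hS : S.TwoPointUnique)
    (hD : S.HasDesargues) : ∀ᶠ x in 𝓝 ((0 : ℂ), (2 : ℂ), (0 : ℂ × ℂ)), x.1 ≠ 0 → Λ.IsConf x := by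
  set f : Filter (ℂ × ℂ × ℂ × ℂ) := 𝓝[{x | x.1 ≠ 0}] (0, 2, 0) with hf
  suffices H : ∀ᶠ x in f, Λ.IsConf x from eventually_nhdsWithin_iff.mp H
  have hle : f ≤ 𝓝 (0, 2, 0) := nhdsWithin_le_nhds
  have hx : Filter.Tendsto (fun x : ℂ × ℂ × ℂ × ℂ => x) f (𝓝 (0, 2, 0)) := hle
  have he : Filter.Tendsto (fun x : ℂ × ℂ × ℂ × ℂ => x.1) f (𝓝[≠] 0) :=
    tendsto_nhdsWithin_iff.mpr ⟨hx.fst_nhds, self_mem_nhdsWithin⟩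
  have tp : Filter.Tendsto (fun x : ℂ × ℂ × ℂ × ℂ => x.2.2) f (𝓝 0) := hx.snd_nhds.snd_nhds
  have tA : Filter.Tendsto (fun x : ℂ × ℂ × ℂ × ℂ => M.pt 1 x.1 1) f (𝓝 (1, 1)) :=
    ((M.analyticAt_pt 1 1).continuousAt.tendsto_of_eq ((M.pt_zero _ _).trans (by simp))).comp
      (hx.fst_nhds.prodMk_nhds tendsto_const_nhds)
  have tA' : Filter.Tendsto (fun x : ℂ × ℂ × ℂ × ℂ => M.pt 1 x.1 x.2.1) f (𝓝 (2, 2)) :=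
    ((M.analyticAt_pt 1 2).continuousAt.tendsto_of_eq ((M.pt_zero _ _).trans (by simp))).comp
      (hx.fst_nhds.prodMk_nhds hx.snd_nhds.fst_nhds)
  have tl : ∀ {g : ℂ × ℂ × ℂ × ℂ → ℂ × ℂ} {q : ℂ × ℂ}, AnalyticAt ℂ g (0, 2, 0) →
      g (0, 2, 0) = q → Filter.Tendsto g f (𝓝 q) := fun hg hq =>
    (hg.continuousAt.tendsto_of_eq hq).mono_left hle
  have t0 : Filter.Tendsto (fun _ : ℂ × ℂ × ℂ × ℂ => (0 : ℂ × ℂ)) f (𝓝 0) := tendsto_const_nhds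
  have t1 : Filter.Tendsto (fun _ : ℂ × ℂ × ℂ × ℂ => ((0 : ℂ), (1 : ℂ))) f (𝓝 (0, 1)) :=
    tendsto_const_nhds
  have tlA := tl Λ.lA_an Λ.lA_val
  have tlA' := tl Λ.lA'_an Λ.lA'_val
  have tP := tl Λ.P_an Λ.P_val
  have tφ := tl Λ.φ_an Λ.φ_val
  have tax : Filter.Tendsto (fun x : ℂ × ℂ × ℂ × ℂ => (x.1, x.2.2.1)) f (𝓝 (0, 0)) :=
    hx.fst_nhds.prodMk_nhds tp.fst_nhds
  have tle : Filter.Tendsto (fun x : ℂ × ℂ × ℂ × ℂ => (x.1, ((0 : ℂ), (1 : ℂ)))) f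
      (𝓝 (0, (0, 1))) := hx.fst_nhds.prodMk_nhds t1
  have tpe : Filter.Tendsto (fun x : ℂ × ℂ × ℂ × ℂ => ((x.1, x.2.1), x.2.2, (0 : ℂ × ℂ))) f
      (𝓝 ((0, 2), 0, 0)) :=
    (hx.fst_nhds.prodMk_nhds hx.snd_nhds.fst_nhds).prodMk_nhds (tp.prodMk_nhds t0)
  filter_upwards [hx.eventually Λ.incA, he.eventually self_mem_nhdsWithin,
    hx.snd_nhds.fst_nhds.eventually_ne (by norm_num : (2 : ℂ) ≠ 1),
    tp.fst_nhds.eventually_ne (by norm_num : (0 : ℂ) ≠ 1), tax.eventually (M.Ψ_axis 0),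
    tle.eventually (M.Ψ_left (0, 1)), tpe.eventually (Λ.inc_pencil_iff hS hD),
    M.germ_origin he (tendsto_const_nhds (x := (0 : ℂ))),
    M.germ_origin he (tendsto_const_nhds (x := (1 : ℂ))),
    M.germ_on he tA tlA, M.germ_on he tp tlA, M.germ_on he tP tlA, M.germ_on he tP t0,
    M.germ_on he tA' tlA', M.germ_on he tP tlA', M.germ_on he tφ tlA', M.germ_on he tA t1,
    M.germ_on he tA' t1, M.germ_on he t0 t0, M.germ_on he t0 t1, M.germ_on he tφ t0,
    M.germ_on he tp t1, M.germ_not_on he tA t0 (by rw [M.inc_axis_zero]; norm_num)]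
    with x j hε n1 n2 hax hle' hpe i0 i1 o1 o2 o3 o4 o5 o6 o7 o8 o9 o10 o11 o12 o13 nA
  exact
    { ne_zero := hε
      ne_one := n1.symm
      ne_abscissa := n2
      mem_A := o1.2.1
      mem_A' := o5.2.1
      mem_axis := o4.2.1
      mem_one := o8.2.1
      A_lA := o1.2.2.mpr j.1.1
      p_lA := o2.2.2.mpr j.1.2.1
      P_lA := o3.2.2.mpr j.1.2.2
      P_axis := o4.2.2.mpr j.2.1
      A'_lA' := o5.2.2.mpr j.2.2.1
      P_lA' := o6.2.2.mpr j.2.2.2.1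
      φ_lA' := o7.2.2.mpr j.2.2.2.2
      A_one := o8.2.2.mpr (M.inc_pt _ _ _)
      A'_one := o9.2.2.mpr (M.inc_pt _ _ _)
      zero_axis := o10.2.2.mpr i0
      zero_one := o11.2.2.mpr i1
      A_axis := nA
      φ_axis := fun h => by
        have h1 := (hpe hε rfl).mp (o12.2.2.mp h)
        exact Eq.trans h1 hax
      p_one := fun h0 h => by
        have h1 := o13.2.2.mp h
        rw [Inc, h0] at h1
        exact h1.trans hle' }

/-- If φ fixed a point p off the axis, Ap and A'p would share P and p, hence coincide, and would
contain A and A'. They would be the curve OA, whose only point with abscissa 0 is O. -/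
theorem Elation.IsConf.φ_ne {M : S.LineModel c₁} {Λ : M.Elation} {x : ℂ × ℂ × ℂ × ℂ}
    (hx : Λ.IsConf x) (hS : S.TwoPointUnique) (h0 : x.2.2.1 = 0) (hw : x.2.2.2 ≠ 0) :
    Λ.φ x ≠ x.2.2 := by
  intro h
  have h1 := hx.φ_lA'
  have h2 := hx.φ_axis
  rw [h] at h1 h2
  have nP : M.θ x.1 (Λ.P x) ≠ M.θ x.1 x.2.2 := fun e => hw (h2 (by rw [On, ← e]; exact hx.P_axis))
  have e1 := hS _ _ nP _ hx.mem_A _ hx.mem_A' hx.P_lA hx.p_lA hx.P_lA' h1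
  have nA : M.θ x.1 (M.pt 1 x.1 1) ≠ M.θ x.1 (M.pt 1 x.1 x.2.1) := fun e =>
    hx.ne_one (congrArg Prod.fst (M.θ_injective hx.ne_zero e))
  have h3 := hx.A_lA
  rw [On, e1] at h3
  have e2 := hS _ _ nA _ hx.mem_A' _ hx.mem_one h3 hx.A'_lA' hx.A_one hx.A'_one
  rw [On, e2] at h1
  exact hw (hx.p_one h0 h1)

/-- P does not depend on r. If two parameters gave the same image, the two curves A'P would coincide
and contain two different points A' of OA, so they would equal OA. Then P = O, so Ap is OA as well,
and p, having abscissa 0, would be O. -/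
theorem Elation.IsConf.φ_ne_φ {M : S.LineModel c₁} {Λ : M.Elation} {ε r s : ℂ} {p : ℂ × ℂ}
    (hr : Λ.IsConf (ε, r, p)) (hs : Λ.IsConf (ε, s, p)) (hS : S.TwoPointUnique) (h0 : p.1 = 0)
    (hw : p.2 ≠ 0) (hrs : r ≠ s) : Λ.φ (ε, r, p) ≠ Λ.φ (ε, s, p) := by
  intro h
  have hε : ε ≠ 0 := hr.ne_zero
  have nAp : M.θ ε (M.pt 1 ε 1) ≠ M.θ ε p := fun e =>
    hr.ne_abscissa (congrArg Prod.fst (M.θ_injective hε e)).symm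
  have e1 := hS _ _ nAp _ hr.mem_A _ hs.mem_A hr.A_lA hr.p_lA hs.A_lA hs.p_lA
  simp only at e1
  have hP : M.θ ε (Λ.P (ε, s, p)) ∈ S.L (M.κ ε (Λ.lA (ε, r, p))) := by
    rw [e1]
    exact hs.P_lA
  have e2 := hS.eq_point hr.mem_A hr.mem_axis hr.P_lA hr.P_axis hP hs.P_axis hr.A_lA hr.A_axis
  have nP : M.θ ε (Λ.P (ε, r, p)) ≠ M.θ ε (Λ.φ (ε, r, p)) := fun e =>
    hw (hr.φ_axis (by rw [On, ← e]; exact hr.P_axis))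
  have h1 := hs.P_lA'
  have h2 := hs.φ_lA'
  rw [On, ← e2] at h1
  rw [← h] at h2
  have e3 := hS _ _ nP _ hr.mem_A' _ hs.mem_A' hr.P_lA' hr.φ_lA' h1 h2
  have nA : M.θ ε (M.pt 1 ε r) ≠ M.θ ε (M.pt 1 ε s) := fun e =>
    hrs (congrArg Prod.fst (M.θ_injective hε e))
  have h3 := hs.A'_lA'
  rw [On, ← e3] at h3
  have e4 := hS _ _ nA _ hr.mem_A' _ hr.mem_one hr.A'_lA' h3 hr.A'_one hs.A'_one
  have h4 := hr.P_lA'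
  rw [On, e4] at h4
  have e5 := hS.eq_point hr.mem_one hr.mem_axis h4 hr.P_axis hr.zero_one hr.zero_axis hr.A_one
    hr.A_axis
  have nA0 : M.θ ε (M.pt 1 ε 1) ≠ M.θ ε 0 := fun e =>
    one_ne_zero (congrArg Prod.fst (M.θ_injective hε e))
  have h5 := hr.P_lA
  rw [On, e5] at h5
  have e6 := hS _ _ nA0 _ hr.mem_A _ hr.mem_one hr.A_lA h5 hr.A_one hr.zero_one
  have h6 := hr.p_lA
  rw [On, e6] at h6
  exact hw (hr.p_one h0 h6)

/-- The properties of the local model at the parameters `y = (ε, r)`, the point `p` and the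
line (or point) `l` from which the local automorphisms are obtained. -/
structure Elation.IsRegular {M : S.LineModel c₁} (Λ : M.Elation) (ψ : ℂ × ℂ × ℂ × ℂ → ℂ × ℂ)
    (Γ : (ℂ × ℂ) × (ℂ × ℂ) → ℂ × ℂ) (ε r : ℂ) (p l : ℂ × ℂ) : Prop where
  θ_an : AnalyticAt ℂ (M.θ ε) p
  θinv_an : AnalyticAt ℂ (M.θinv ε) (M.θ ε p)
  φ_an : AnalyticAt ℂ Λ.φ (ε, r, p)
  ψ_an : AnalyticAt ℂ ψ (ε, r, p)
  inverse : Λ.φ (ε, r, p) = l ↔ p = ψ (ε, r, l)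
  mem_U : M.θ ε p ∈ S.U
  mem_V : M.κ ε (Γ ((ε, r), l)) ∈ S.V
  maps_line : M.On ε p l ↔ M.On ε (Λ.φ (ε, r, p)) (Γ ((ε, r), l))
  maps_pencil : M.On ε 0 l → (M.On ε p l ↔ M.On ε (Λ.φ (ε, r, p)) l)
  fixes : M.On ε p 0 → Λ.φ (ε, r, p) = p
  conf : Λ.IsConf (ε, r, p)
  deriv : HasFDerivAt (fun p => Λ.φ (ε, r, p)) (ContinuousLinearMap.id ℂ (ℂ × ℂ)) 0

/-- All local properties are combined into one statement so that a single radius in (ε, r), p and l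
serves them simultaneously. -/
theorem Elation.eventually_isRegular {M : S.LineModel c₁} (Λ : M.Elation) (hS : S.TwoPointUnique)
    (hD : S.HasDesargues) : ∃ (ψ : ℂ × ℂ × ℂ × ℂ → ℂ × ℂ) (Γ : (ℂ × ℂ) × (ℂ × ℂ) → ℂ × ℂ),
      ∀ᶠ x in 𝓝 (((0 : ℂ), (2 : ℂ)), (0 : ℂ × ℂ), (0 : ℂ × ℂ)), x.1.1 ≠ 0 →
        Λ.IsRegular ψ Γ x.1.1 x.1.2 x.2.1 x.2.2 := by
  obtain ⟨ψ, hψ, hinv⟩ := Λ.exists_inverse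
  obtain ⟨Γ, hΓ, hΓ0, hline⟩ := Λ.preserves_lines hS hD
  refine ⟨ψ, Γ, ?_⟩
  set f : Filter ((ℂ × ℂ) × (ℂ × ℂ) × (ℂ × ℂ)) := 𝓝[{x | x.1.1 ≠ 0}] ((0, 2), 0, 0) with hf
  suffices H : ∀ᶠ x in f, Λ.IsRegular ψ Γ x.1.1 x.1.2 x.2.1 x.2.2 from eventually_nhdsWithin_iff.mp H
  have hle : f ≤ 𝓝 ((0, 2), 0, 0) := nhdsWithin_le_nhds
  have he : Filter.Tendsto (fun x : (ℂ × ℂ) × (ℂ × ℂ) × (ℂ × ℂ) => x.1.1) f (𝓝[≠] 0) :=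
    tendsto_param _
  have hx : Filter.Tendsto (fun x : (ℂ × ℂ) × (ℂ × ℂ) × (ℂ × ℂ) => x) f (𝓝 ((0, 2), 0, 0)) := hle
  have he0 := hx.fst_nhds.fst_nhds
  have ty := hx.fst_nhds
  have tp := hx.snd_nhds.fst_nhds
  have tl := hx.snd_nhds.snd_nhds
  simp only at he0 ty tp tl
  have tep := he0.prodMk_nhds (ty.snd_nhds.prodMk_nhds tp)
  have t0 : Filter.Tendsto (fun _ : (ℂ × ℂ) × (ℂ × ℂ) × (ℂ × ℂ) => (0 : ℂ × ℂ)) f (𝓝 0) :=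
    tendsto_const_nhds
  have tΓ : Filter.Tendsto (fun x : (ℂ × ℂ) × (ℂ × ℂ) × (ℂ × ℂ) => Γ (x.1, x.2.2)) f (𝓝 0) :=
    (hΓ.tendsto_of_eq hΓ0).comp (ty.prodMk_nhds tl)
  have tφ := (Λ.φ_an.continuousAt.tendsto_of_eq Λ.φ_val).comp tep
  filter_upwards [he.eventually self_mem_nhdsWithin,
    (he0.prodMk_nhds tp).eventually M.analyticAt_θ, (he0.prodMk_nhds tp).eventually M.analyticAt_θinv,
    tep.eventually Λ.φ_an.eventually_analyticAt, tep.eventually hψ.eventually_analyticAt,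
    ((he0.prodMk_nhds (ty.snd_nhds.prodMk_nhds tl)).prodMk_nhds tp).eventually hinv,
    (ty.prodMk_nhds (tp.fst_nhds.prodMk_nhds tl)).eventually hline,
    (ty.prodMk_nhds (tp.prodMk_nhds (tl.prodMk_nhds tΓ))).eventually Λ.inc_iff,
    hx.eventually (Λ.inc_pencil_iff hS hD),
    (ty.prodMk_nhds tp.fst_nhds).eventually (Λ.fixes_axis hS),
    tep.eventually (Λ.eventually_isConf hS hD), ty.eventually (Λ.eventually_hasFDerivAt hS hD),
    (he0.prodMk_nhds tp.fst_nhds).eventually (M.Ψ_axis 0),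
    (he0.prodMk_nhds tl).eventually (M.Ψ_left 0),
    M.germ_on he tp tl, M.germ_on he tφ tΓ, M.germ_on he tφ tl, M.germ_on he t0 tl,
    M.germ_on he tp t0]
    with x hε a1 a2 a3 a4 h1 h2 h3 h4 h5 h6 h7 h8 h9 o1 o2 o3 o4 o5
  exact
    { θ_an := a1
      θinv_an := a2 hε
      φ_an := a3
      ψ_an := a4
      inverse := h1
      mem_U := o1.1
      mem_V := o2.2.1
      maps_line := o1.2.2.trans ((h3 (h2 hε)).symm.trans o2.2.2.symm)
      maps_pencil := fun h => by
        have hl : x.2.2.1 = 0 := h9.symm.trans (o4.2.2.mp h).symm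
        exact o1.2.2.trans ((h4 hε hl).symm.trans o3.2.2.symm)
      fixes := fun h => by
        have hp : x.2.1 = (x.2.1.1, 0) := Prod.ext rfl ((o5.2.2.mp h).trans h8)
        have := h5 hε
        rwa [← hp] at this
      conf := h6 hε
      deriv := h7 hε }

theorem Elation.exists_automorphisms {M : S.LineModel c₁} (Λ : M.Elation) (hS : S.TwoPointUnique)
    (hD : S.HasDesargues) :
    ∃ (Ω : Set ℂ) (φ : ℂ → OpenPartialHomeomorph (ℂ × ℂ) (ℂ × ℂ)),
      IsOpen Ω ∧ IsConnected Ω ∧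
      (∀ r ∈ Ω, S.IsLocalAutomorphism c₁ (φ r) ∧
        ¬ (∀ᶠ p in 𝓝 S.O, φ r p = p) ∧
        HasFDerivAt (φ r) (ContinuousLinearMap.id ℂ (ℂ × ℂ)) S.O ∧
        (∀ p ∈ S.L c₁ ∩ (φ r).source, φ r p = p) ∧
        (∀ᶠ c in 𝓝 c₁, S.O ∈ S.L c →
          φ r '' (S.L c ∩ (φ r).source) = S.L c ∩ (φ r).target)) ∧
      (∀ r ∈ Ω, ∀ s ∈ Ω, r ≠ s → ¬ (∀ᶠ p in 𝓝 S.O, φ r p = φ s p)) ∧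
      IsOpen {x : ℂ × (ℂ × ℂ) | x.1 ∈ Ω ∧ x.2 ∈ (φ x.1).source} ∧
      AnalyticOnNhd ℂ (fun x : ℂ × (ℂ × ℂ) => φ x.1 x.2)
        {x : ℂ × (ℂ × ℂ) | x.1 ∈ Ω ∧ x.2 ∈ (φ x.1).source} := by
  obtain ⟨ψ, Γ, hreg⟩ := Λ.eventually_isRegular hS hD
  obtain ⟨δ, hδ, hball⟩ := Metric.eventually_nhds_iff_ball.mp hreg
  have hreg' : ∀ ε ∈ Metric.ball (0 : ℂ) δ, ε ≠ 0 → ∀ r ∈ Metric.ball (2 : ℂ) δ,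
      ∀ p ∈ Metric.ball (0 : ℂ × ℂ) δ, ∀ l ∈ Metric.ball (0 : ℂ × ℂ) δ,
      Λ.IsRegular ψ Γ ε r p l := by
    intro ε hε hε0 r hr p hp l hl
    refine hball ((ε, r), p, l) ?_ hε0
    rw [← ball_prod_same, ← ball_prod_same, ← ball_prod_same]
    exact ⟨⟨hε, hr⟩, hp, hl⟩
  have hcont : ∀ᶠ x in 𝓝 ((0 : ℂ), (2 : ℂ), (0 : ℂ × ℂ)), Λ.φ x ∈ Metric.ball (0 : ℂ × ℂ) δ :=
    (Λ.φ_an.continuousAt.tendsto_of_eq Λ.φ_val).eventually (Metric.ball_mem_nhds _ hδ)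
  obtain ⟨η', hη', hφball'⟩ := Metric.eventually_nhds_iff_ball.mp hcont
  obtain ⟨η, hη, hηδ, hηη'⟩ : ∃ η > 0, η ≤ δ ∧ η ≤ η' :=
    ⟨min δ η', lt_min hδ hη', min_le_left _ _, min_le_right _ _⟩
  -- From here on ε is a fixed nonzero number. The radius η was chosen so that φ maps W into N for
  -- all r in Ω.
  obtain ⟨ε, hε, hε0⟩ : ∃ ε ∈ Metric.ball (0 : ℂ) η, ε ≠ 0 := by
    have h : ∀ᶠ ε in 𝓝[≠] (0 : ℂ), ε ∈ Metric.ball (0 : ℂ) η :=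
      nhdsWithin_le_nhds (Metric.ball_mem_nhds _ hη)
    obtain ⟨ε, h1, h2⟩ := (h.and self_mem_nhdsWithin).exists
    exact ⟨ε, h1, h2⟩
  set Ω : Set ℂ := Metric.ball 2 η with hΩ
  set N : Set (ℂ × ℂ) := Metric.ball 0 δ with hN
  set W : Set (ℂ × ℂ) := Metric.ball 0 η with hW
  have hWN : W ⊆ N := Metric.ball_subset_ball hηδ
  have h0W : (0 : ℂ × ℂ) ∈ W := Metric.mem_ball_self hη
  have h0N : (0 : ℂ × ℂ) ∈ N := hWN h0W
  have reg : ∀ r ∈ Ω, ∀ p ∈ N, ∀ l ∈ N, Λ.IsRegular ψ Γ ε r p l := fun r hr =>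
    hreg' ε (Metric.ball_subset_ball hηδ hε) hε0 r (Metric.ball_subset_ball hηδ hr)
  have hφN : ∀ r ∈ Ω, ∀ p ∈ W, Λ.φ (ε, r, p) ∈ N := by
    intro r hr p hp
    apply hφball'
    rw [← ball_prod_same, ← ball_prod_same]
    exact Set.prod_mono (Metric.ball_subset_ball hηη') (Set.prod_mono
      (Metric.ball_subset_ball hηη') (Metric.ball_subset_ball hηη')) ⟨hε, hr, hp⟩
  have θ0 := M.θ_zero ε
  have θi0 : M.θinv ε S.O = 0 := by rw [← θ0]; exact M.left_inv ε hε0 0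
  have θan : ∀ p ∈ N, AnalyticAt ℂ (M.θ ε) p := fun p hp =>
    (reg 2 (Metric.mem_ball_self hη) p hp 0 h0N).θ_an
  have θian : ∀ p ∈ N, AnalyticAt ℂ (M.θinv ε) (M.θ ε p) := fun p hp =>
    (reg 2 (Metric.mem_ball_self hη) p hp 0 h0N).θinv_an
  have φan : ∀ r ∈ Ω, ∀ p ∈ N, AnalyticAt ℂ (fun p => Λ.φ (ε, r, p)) p := fun r hr p hp =>
    AnalyticAt.fun_comp (g := Λ.φ) (f := fun p : ℂ × ℂ => (ε, r, p)) (reg r hr p hp 0 h0N).φ_an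
      (by fun_prop)
  have ψan : ∀ r ∈ Ω, ∀ p ∈ N, AnalyticAt ℂ (fun p => ψ (ε, r, p)) p := fun r hr p hp =>
    AnalyticAt.fun_comp (g := ψ) (f := fun p : ℂ × ℂ => (ε, r, p)) (reg r hr p hp 0 h0N).ψ_an
      (by fun_prop)
  have hψφ : ∀ r ∈ Ω, ∀ p ∈ W, ψ (ε, r, Λ.φ (ε, r, p)) = p := fun r hr p hp =>
    ((reg r hr p (hWN hp) _ (hφN r hr p hp)).inverse.mp rfl).symm
  -- The target consists of the points of N whose preimage under φ, given by ψ, falls in W; the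
  -- source is independent of r.
  have key : ∀ r ∈ Ω, ∃ e : OpenPartialHomeomorph (ℂ × ℂ) (ℂ × ℂ),
      e.source = M.θinv ε ⁻¹' W ∧ e.target = M.θinv ε ⁻¹' (N ∩ {q | ψ (ε, r, q) ∈ W}) ∧
      (∀ x, e x = M.θ ε (Λ.φ (ε, r, M.θinv ε x))) ∧ AnalyticOnNhd ℂ e e.source ∧
      AnalyticOnNhd ℂ e.symm e.target := by
    intro r hr
    refine OpenPartialHomeomorph.exists_conj (N := N) (f := fun p => Λ.φ (ε, r, p))
      (g := fun q => ψ (ε, r, q)) (M.left_inv ε hε0) (M.right_inv ε hε0) θan θian hWN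
      Set.inter_subset_left Metric.isOpen_ball ?_ (fun p hp => φan r hr p (hWN hp))
      (fun p hp => ψan r hr p hp.1) (fun p hp => ⟨hφN r hr p hp, ?_⟩) (fun p hp => hp.2)
      (hψφ r hr) (fun q hq => (reg r hr _ (hWN hq.2) q hq.1).inverse.mpr rfl)
    · exact ContinuousOn.isOpen_inter_preimage
        (fun q hq => (ψan r hr q hq).continuousAt.continuousWithinAt) Metric.isOpen_ball
        Metric.isOpen_ball
    · rw [Set.mem_ofPred_eq, hψφ r hr p hp]
      exact hp
  have : Nonempty (OpenPartialHomeomorph (ℂ × ℂ) (ℂ × ℂ)) := ⟨OpenPartialHomeomorph.refl _⟩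
  choose! e hsource htarget hcoe han hansymm using key
  -- An equality of images of curve portions follows from an equivalence of incidences on W, since
  -- `e r` is a bijection of source onto target. This is why two-sided incidence statements were
  -- needed.
  have himage : ∀ r ∈ Ω, ∀ C C' : Set (ℂ × ℂ),
      (∀ p ∈ W, M.θ ε p ∈ C ↔ M.θ ε (Λ.φ (ε, r, p)) ∈ C') →
      e r '' (C ∩ (e r).source) = C' ∩ (e r).target := by
    intro r hr C C' h
    have h' : ∀ x ∈ (e r).source, x ∈ C ↔ e r x ∈ C' := by
      intro x hx
      rw [hsource r hr] at hx
      rw [hcoe r hr, ← h _ hx, M.right_inv ε hε0]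
    ext y
    constructor
    · rintro ⟨x, ⟨hxC, hx⟩, rfl⟩
      exact ⟨(h' x hx).mp hxC, (e r).map_source hx⟩
    · rintro ⟨hyC, hy⟩
      refine ⟨(e r).symm y, ⟨(h' _ ((e r).map_target hy)).mpr ?_, (e r).map_target hy⟩,
        (e r).right_inv hy⟩
      rwa [(e r).right_inv hy]
  have hO : ∀ r ∈ Ω, S.O ∈ (e r).source := by
    intro r hr
    rw [hsource r hr, Set.mem_preimage, θi0]
    exact h0W
  have hφ0 : ∀ r ∈ Ω, Λ.φ (ε, r, 0) = 0 := fun r hr =>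
    (reg r hr 0 h0N 0 h0N).fixes (reg r hr 0 h0N 0 h0N).conf.zero_axis
  have hparam : ∀ᶠ c in 𝓝 c₁, ∃ l ∈ N, M.κ ε l = c :=
    M.param ε hε0 N (Metric.ball_mem_nhds _ hδ)
  have hcont0 : Filter.Tendsto (fun w : ℂ => M.θ ε (0, w)) (𝓝[≠] 0) (𝓝 S.O) := by
    refine (ContinuousAt.tendsto_of_eq (a := (0 : ℂ)) ?_ θ0).mono_left nhdsWithin_le_nhds
    exact ContinuousAt.comp (g := M.θ ε) (f := fun w : ℂ => ((0 : ℂ), w))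
      (θan 0 h0N).continuousAt (by fun_prop)
  -- Germs are compared on the points of abscissa 0 off the axis, which accumulate at O.
  have hgerm : ∀ {Q : ℂ × ℂ → Prop}, (∀ᶠ p in 𝓝 S.O, Q p) →
      ∃ w : ℂ, w ≠ 0 ∧ ((0 : ℂ), w) ∈ N ∧ Q (M.θ ε (0, w)) := by
    intro Q hQ
    have h1 : ∀ᶠ w in 𝓝[≠] (0 : ℂ), ((0 : ℂ), w) ∈ N := nhdsWithin_le_nhds <|
      (by fun_prop : Continuous fun w : ℂ => ((0 : ℂ), w)).tendsto 0 |>.eventually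
        (Metric.ball_mem_nhds _ hδ)
    obtain ⟨w, h2, h3, h4⟩ := ((hcont0.eventually hQ).and (h1.and self_mem_nhdsWithin)).exists
    exact ⟨w, h4, h3, h2⟩
  have hθφ : ∀ r ∈ Ω, ∀ p, e r (M.θ ε p) = M.θ ε (Λ.φ (ε, r, p)) := fun r hr p => by
    rw [hcoe r hr, M.left_inv ε hε0]
  have hset : {x : ℂ × (ℂ × ℂ) | x.1 ∈ Ω ∧ x.2 ∈ (e x.1).source} =
      Ω ×ˢ (e 2).source := by
    ext x
    simp only [Set.mem_ofPred_eq, Set.mem_prod]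
    refine and_congr_right fun h => ?_
    rw [hsource _ h, hsource 2 (Metric.mem_ball_self hη)]
  have hopen : IsOpen {x : ℂ × (ℂ × ℂ) | x.1 ∈ Ω ∧ x.2 ∈ (e x.1).source} := by
    rw [hset]
    exact Metric.isOpen_ball.prod (e 2).open_source
  refine ⟨Ω, e, Metric.isOpen_ball, ⟨⟨2, Metric.mem_ball_self hη⟩,
    (convex_ball (2 : ℂ) η).isPreconnected⟩, fun r hr => ⟨?_, ?_, ?_, ?_, ?_⟩, ?_, hopen, ?_⟩
  · have hsub : ∀ {x : ℂ × ℂ}, M.θinv ε x ∈ N → x ∈ S.U := by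
      intro x hx
      have := (reg r hr _ hx 0 h0N).mem_U
      rwa [M.right_inv ε hε0] at this
    refine ⟨hO r hr, ?_, ?_, ?_, han r hr, hansymm r hr, ?_⟩
    · rw [hcoe r hr, θi0, hφ0 r hr, θ0]
    · rw [hsource r hr]
      exact fun x hx => hsub (hWN hx)
    · rw [htarget r hr]
      exact fun x hx => hsub hx.1
    · filter_upwards [hparam] with c ⟨l, hl, hlc⟩
      subst hlc
      exact ⟨M.κ ε (Γ ((ε, r), l)), (reg r hr 0 h0N l hl).mem_V,
        himage r hr _ _ fun p hp => (reg r hr p (hWN hp) l hl).maps_line⟩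
  · intro h
    obtain ⟨w, hw, hwN, h1⟩ := hgerm h
    rw [hθφ r hr] at h1
    exact (reg r hr _ hwN 0 h0N).conf.φ_ne hS rfl hw (M.θ_injective hε0 h1)
  · have d1 := (θan 0 h0N).differentiableAt.hasFDerivAt
    have d2 := (θian 0 h0N).differentiableAt.hasFDerivAt
    rw [θ0] at d2
    have d3 := (reg r hr 0 h0N 0 h0N).deriv
    have c1 : HasFDerivAt (fun x => M.θ ε (M.θinv ε x))
        ((fderiv ℂ (M.θ ε) 0).comp (fderiv ℂ (M.θinv ε) S.O)) S.O :=
      HasFDerivAt.comp (g := M.θ ε) S.O (by rw [θi0]; exact d1) d2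
    have c2 : HasFDerivAt (fun x => M.θ ε (M.θinv ε x)) (ContinuousLinearMap.id ℂ (ℂ × ℂ)) S.O := by
      simp only [M.right_inv ε hε0]
      exact hasFDerivAt_id _
    have c3 : HasFDerivAt (fun x => Λ.φ (ε, r, M.θinv ε x))
        ((ContinuousLinearMap.id ℂ (ℂ × ℂ)).comp (fderiv ℂ (M.θinv ε) S.O)) S.O :=
      HasFDerivAt.comp (g := fun p => Λ.φ (ε, r, p)) S.O (by rw [θi0]; exact d3) d2
    have c4 : HasFDerivAt (fun x => M.θ ε (Λ.φ (ε, r, M.θinv ε x)))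
        ((fderiv ℂ (M.θ ε) 0).comp
          ((ContinuousLinearMap.id ℂ (ℂ × ℂ)).comp (fderiv ℂ (M.θinv ε) S.O))) S.O :=
      HasFDerivAt.comp (g := M.θ ε) S.O (by rw [θi0, hφ0 r hr]; exact d1) c3
    -- Conjugation by `θ ε` does not affect a derivative equal to the identity.
    rw [ContinuousLinearMap.id_comp, c1.unique c2] at c4
    rwa [show (e r : ℂ × ℂ → ℂ × ℂ) = fun x => M.θ ε (Λ.φ (ε, r, M.θinv ε x)) from
      funext (hcoe r hr)]
  · rintro x ⟨hxL, hx⟩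
    rw [hsource r hr] at hx
    rw [hcoe r hr, (reg r hr _ (hWN hx) 0 h0N).fixes, M.right_inv ε hε0]
    rw [On, M.right_inv ε hε0, M.κ_zero]
    exact hxL
  · filter_upwards [hparam] with c ⟨l, hl, hlc⟩ hOc
    subst hlc
    rw [← θ0] at hOc
    exact himage r hr _ _ fun p hp => (reg r hr p (hWN hp) l hl).maps_pencil hOc
  · intro r hr s hs hrs h
    obtain ⟨w, hw, hwN, h1⟩ := hgerm h
    rw [hθφ r hr, hθφ s hs] at h1
    exact (reg r hr _ hwN 0 h0N).conf.φ_ne_φ (reg s hs _ hwN 0 h0N).conf hS rfl hw hrs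
      (M.θ_injective hε0 h1)
  · intro x hx
    have hx2 : M.θinv ε x.2 ∈ W := by
      have := hx.2
      rwa [hsource _ hx.1] at this
    have a1 : AnalyticAt ℂ (M.θinv ε) x.2 := by
      have := θian _ (hWN hx2)
      rwa [M.right_inv ε hε0] at this
    have a2 : AnalyticAt ℂ (fun y : ℂ × (ℂ × ℂ) => M.θinv ε y.2) x :=
      AnalyticAt.fun_comp (g := M.θinv ε) (f := fun y : ℂ × (ℂ × ℂ) => y.2) a1 (by fun_prop)
    have a3 : AnalyticAt ℂ (fun y : ℂ × (ℂ × ℂ) => Λ.φ (ε, y.1, M.θinv ε y.2)) x :=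
      AnalyticAt.fun_comp (g := Λ.φ) (f := fun y : ℂ × (ℂ × ℂ) => (ε, y.1, M.θinv ε y.2))
        (reg _ hx.1 _ (hWN hx2) 0 h0N).φ_an (by fun_prop)
    have a4 : AnalyticAt ℂ (fun y : ℂ × (ℂ × ℂ) => M.θ ε (Λ.φ (ε, y.1, M.θinv ε y.2))) x :=
      AnalyticAt.fun_comp (g := M.θ ε) (f := fun y : ℂ × (ℂ × ℂ) => Λ.φ (ε, y.1, M.θinv ε y.2))
        (θan _ (hφN _ hx.1 _ hx2)) a3
    refine a4.congr ?_
    filter_upwards [hopen.mem_nhds hx] with y hy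
    exact (hcoe _ hy.1 _).symm

end LineModel

end TransverseFamily
theorem mainTheorem2 (S : TransverseFamily) (hS : S.TwoPointUnique) (hD : S.HasDesargues) :
    ∀ᶠ c₁ in 𝓝 S.c₀, S.O ∈ S.L c₁ →
      ∃ (Ω : Set ℂ) (φ : ℂ → OpenPartialHomeomorph (ℂ × ℂ) (ℂ × ℂ)),
        IsOpen Ω ∧ IsConnected Ω ∧
        (∀ r ∈ Ω, S.IsLocalAutomorphism c₁ (φ r) ∧
          ¬ (∀ᶠ p in 𝓝 S.O, φ r p = p) ∧
          HasFDerivAt (φ r) (ContinuousLinearMap.id ℂ (ℂ × ℂ)) S.O ∧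
          (∀ p ∈ S.L c₁ ∩ (φ r).source, φ r p = p) ∧
          (∀ᶠ c in 𝓝 c₁, S.O ∈ S.L c →
            φ r '' (S.L c ∩ (φ r).source) = S.L c ∩ (φ r).target)) ∧
        (∀ r ∈ Ω, ∀ s ∈ Ω, r ≠ s → ¬ (∀ᶠ p in 𝓝 S.O, φ r p = φ s p)) ∧
        IsOpen {x : ℂ × (ℂ × ℂ) | x.1 ∈ Ω ∧ x.2 ∈ (φ x.1).source} ∧
        AnalyticOnNhd ℂ (fun x : ℂ × (ℂ × ℂ) => φ x.1 x.2)
          {x : ℂ × (ℂ × ℂ) | x.1 ∈ Ω ∧ x.2 ∈ (φ x.1).source} := by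
  filter_upwards [S.exists_frame] with c₁ hc hO
  obtain ⟨Φ⟩ := hc hO
  obtain ⟨M⟩ := Φ.nonempty_lineModel
  obtain ⟨Λ⟩ := M.nonempty_elation
  exact Λ.exists_automorphisms hS hD
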